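/- Let $X=\{x_1,\dots,x_n\}$ be a finite alphabet. A directed graph with edges labelled by $X$ is *folded* if no two different edges with the same label have the same initial vertex or the same terminal vertex. An *elementary folding* of such a graph is the quotient map that identifies two different edges which have the same label and the same initial vertex, or the same label and the same terminal vertex; their endpoints are identified accordingly, and nothing else is identified. For words $J_1,\dots,J_m$ in $X^{\pm1}$ let $\Gamma_0$ be the bouquet of $m$ loops at a base vertex $v_0$ with labels $J_1,\dots,J_m$ (a letter $x$ is an edge labelled $x$ in the reading direction, a letter $x^{-1}$ an edge labelled $x$ in the opposite direction), and let $N=\sum_i|J_i|$. Let $\log^*(N)$ be the least $k\ge 0$ such that the $k$-fold iterate of the binary logarithm takes $N$ to a number $\le 1$. Running time is counted on machines that have finitely many variables and finitely many unary functions (fields, pointers) on objects named by natural numbers. Assigning a variable (a constant, another variable, or the successor of a variable), evaluating a field at one object, changing the value of a field at one object, and comparing two variables (a conditional jump) cost one unit each; there is no other arithmetic. **Theorem.** For every $n$ there are a program and a constant $C$, both depending only on $n$, such that on every input $J_1,\dots,J_m$ (words in $X^{\pm1}$, not necessarily reduced) the program halts and has then computed a sequence of elementary foldings $\Gamma_0\to\Gamma_1\to\dots\to\Gamma_M=\Gamma$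 such that $\Gamma$ is folded: it outputs the list of the $M$ pairs of edges that are successively identified, each edge named by an edge of $\Gamma_0$, together with the folded graph $\Gamma=\Gamma(J_1,\dots,J_m)$ and the image of $v_0$ in it. If the words $J_i$ are non-empty and $N\ge 2$, it does so in at most $C\cdot N\cdot\log^*(N)$ steps; that is, the running time is $O(N\cdot\log^*(N))$. -/

import Mathlib

namespace Stallings

/-! ### Directed labelled graphs and foldings -/

/-- A directed graph (loops and multiple edges allowed) with edges labelled by `X`. -/
structure LGraph (X : Type) where
  V : Type
  E : Type
  src : E → V
  tgt : E → V
  label : E → X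

namespace LGraph

variable {X : Type}

/-- Morphisms of directed labelled graphs. -/
structure Hom (Γ Δ : LGraph X) where
  onV : Γ.V → Δ.V
  onE : Γ.E → Δ.E
  src_onE : ∀ e, Δ.src (onE e) = onV (Γ.src e)
  tgt_onE : ∀ e, Δ.tgt (onE e) = onV (Γ.tgt e)
  label_onE : ∀ e, Δ.label (onE e) = Γ.label e

/-- The identity morphism. -/
def Hom.id (Γ : LGraph X) : Hom Γ Γ where
  onV := fun v => v
  onE := fun e => e
  src_onE := fun _ => rfl
  tgt_onE := fun _ => rfl
  label_onE := fun _ => rfl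

/-- Composition: first `π`, then `ρ`. -/
def Hom.comp {Γ Δ Θ : LGraph X} (ρ : Hom Δ Θ) (π : Hom Γ Δ) : Hom Γ Θ where
  onV := fun v => ρ.onV (π.onV v)
  onE := fun e => ρ.onE (π.onE e)
  src_onE := fun e => by rw [ρ.src_onE, π.src_onE]
  tgt_onE := fun e => by rw [ρ.tgt_onE, π.tgt_onE]
  label_onE := fun e => by rw [ρ.label_onE, π.label_onE]

/-- `Γ` is folded: at each vertex there is at most one outgoing and at most one incoming edge
with a given label. -/
def Folded (Γ : LGraph X) : Prop :=
  ∀ e e' : Γ.E, Γ.label e = Γ.label e' → (Γ.src e = Γ.src e' ∨ Γ.tgt e = Γ.tgt e') → e = e'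

/-- `π : Γ → Δ` is the elementary folding that identifies `e₁` with `e₂`: these are two
different edges with the same label which both start or both end at some vertex; `π` is a
quotient map that identifies them and their endpoints, and identifies nothing else. -/
structure IsElementaryFolding {Γ Δ : LGraph X} (π : Hom Γ Δ) (e₁ e₂ : Γ.E) : Prop where
  ne : e₁ ≠ e₂
  label_eq : Γ.label e₁ = Γ.label e₂
  incidence : Γ.src e₁ = Γ.src e₂ ∨ Γ.tgt e₁ = Γ.tgt e₂
  onV_surjective : Function.Surjective π.onV
  onE_surjective : Function.Surjective π.onE
  onV_eq_iff : ∀ u w : Γ.V, π.onV u = π.onV w ↔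
    u = w ∨
    (u = Γ.src e₁ ∧ w = Γ.src e₂) ∨ (u = Γ.src e₂ ∧ w = Γ.src e₁) ∨
    (u = Γ.tgt e₁ ∧ w = Γ.tgt e₂) ∨ (u = Γ.tgt e₂ ∧ w = Γ.tgt e₁)
  onE_eq_iff : ∀ e e' : Γ.E, π.onE e = π.onE e' ↔
    e = e' ∨ (e = e₁ ∧ e' = e₂) ∨ (e = e₂ ∧ e' = e₁)

/-- `FoldingSequence π L`: the morphism `π : Γ₀ → Γ_M` is the composition of a sequence
`Γ₀ → Γ₁ → ⋯ → Γ_M` of elementary foldings, where `L` is a list of `M` pairs of edges of `Γ₀`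
and the `k`-th folding identifies the images in its domain of the two edges of the `k`-th
pair. -/
inductive FoldingSequence {Γ₀ : LGraph X} :
    {Γ : LGraph X} → Hom Γ₀ Γ → List (Γ₀.E × Γ₀.E) → Prop
  | nil : FoldingSequence (Hom.id Γ₀) []
  | snoc {Γ Δ : LGraph X} {π : Hom Γ₀ Γ} {L : List (Γ₀.E × Γ₀.E)} (ρ : Hom Γ Δ)
      (e₁ e₂ : Γ₀.E) (hL : FoldingSequence π L)
      (hρ : IsElementaryFolding ρ (π.onE e₁) (π.onE e₂)) :
      FoldingSequence (ρ.comp π) (L ++ [(e₁, e₂)])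

end LGraph

/-! ### Words and bouquets -/

/-- Words in `X^{±1}` for `X = {x_0, …, x_{n-1}}`; the letter `(x, true)` is `x` and
`(x, false)` is `x⁻¹`, as for `FreeGroup`. -/
abbrev Word (n : ℕ) : Type := List (Fin n × Bool)

/-- The total length of a list of words. -/
def totalLength {n : ℕ} (J : List (Word n)) : ℕ := (J.map List.length).sum

/-- The edges of the bouquet: one for each letter occurrence. -/
abbrev BouquetEdge {n : ℕ} (J : List (Word n)) : Type :=
  (i : Fin J.length) × Fin (J.get i).length

/-- The vertices of the bouquet: the base vertex `none`, and the `ℓ - 1` inner vertices of each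
loop of length `ℓ`. -/
abbrev BouquetVertex {n : ℕ} (J : List (Word n)) : Type :=
  Option ((i : Fin J.length) × Fin ((J.get i).length - 1))

/-- The vertex reached on the `i`-th loop after reading `p` letters from the base vertex. -/
def loopVertex {n : ℕ} (J : List (Word n)) (i : Fin J.length) (p : ℕ) : BouquetVertex J :=
  if h : 0 < p ∧ p < (J.get i).length then some ⟨i, ⟨p - 1, by omega⟩⟩ else none

/-- The bouquet of loops labelled by the words of `J`, all attached at the base vertex `none`:
a letter `x` is an edge labelled `x` in the reading direction, a letter `x⁻¹` an edge labelled
`x` against it. -/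
def bouquet {n : ℕ} (J : List (Word n)) : LGraph (Fin n) where
  V := BouquetVertex J
  E := BouquetEdge J
  src := fun e =>
    if ((J.get e.1).get e.2).2 then loopVertex J e.1 e.2 else loopVertex J e.1 (e.2 + 1)
  tgt := fun e =>
    if ((J.get e.1).get e.2).2 then loopVertex J e.1 (e.2 + 1) else loopVertex J e.1 e.2
  label := fun e => ((J.get e.1).get e.2).1

/-- The base vertex of the bouquet. -/
def bouquetBase {n : ℕ} (J : List (Word n)) : (bouquet J).V := (none : BouquetVertex J)

/-! ### Machines

The storage of a machine consists of registers (variables) and of unary functions `ℕ → ℕ`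
(fields, pointers) on objects that are named by natural numbers. Assigning a variable, evaluating
a field at one object, changing the value of a field at one object, taking a successor, and
comparing two variables cost one time unit each. There is no other arithmetic. A program is
finite, so it uses finitely many registers and fields. -/

inductive Instr where
  /-- `reg r := k` for a constant `k` -/
  | const (r k : ℕ)
  /-- `reg r := reg s` -/
  | copy (r s : ℕ)
  /-- `reg r := reg s + 1` -/
  | succ (r s : ℕ)
  /-- `reg r := field f (reg a)` -/
  | load (r f a : ℕ)
  /-- `field f (reg a) := reg r` -/
  | store (f a r : ℕ)
  /-- go to line `l` if `reg r = reg s` -/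
  | jumpEq (r s l : ℕ)
  /-- go to line `l` if `reg r < reg s` -/
  | jumpLt (r s l : ℕ)

abbrev Program : Type := List Instr

structure Config where
  pc : ℕ
  reg : ℕ → ℕ
  field : ℕ → ℕ → ℕ

/-- The effect of one instruction. -/
def Instr.exec (c : Config) : Instr → Config
  | .const r k => { c with pc := c.pc + 1, reg := Function.update c.reg r k }
  | .copy r s => { c with pc := c.pc + 1, reg := Function.update c.reg r (c.reg s) }
  | .succ r s => { c with pc := c.pc + 1, reg := Function.update c.reg r (c.reg s + 1) }
  | .load r f a =>
      { c with pc := c.pc + 1, reg := Function.update c.reg r (c.field f (c.reg a)) }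
  | .store f a r =>
      { c with
        pc := c.pc + 1
        field := Function.update c.field f (Function.update (c.field f) (c.reg a) (c.reg r)) }
  | .jumpEq r s l => { c with pc := if c.reg r = c.reg s then l else c.pc + 1 }
  | .jumpLt r s l => { c with pc := if c.reg r < c.reg s then l else c.pc + 1 }

/-- One step of the program `P`; nothing happens once the program counter has left `P`. -/
def Program.step (P : Program) (c : Config) : Config :=
  match P[c.pc]? with
  | some i => i.exec c
  | none => c

/-- Started in `c₀`, the program halts after at most `t` steps, in the configuration `c`. -/
def Program.HaltsWithin (P : Program) (c₀ : Config) (t : ℕ) (c : Config) : Prop :=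
  (P.step)^[t] c₀ = c ∧ P.length ≤ c.pc

/-! ### Input and output -/

/-- The code of a letter. -/
def letterCode {n : ℕ} (a : Fin n × Bool) : ℕ := 2 * (a.1 : ℕ) + (if a.2 then 2 else 3)

/-- The input as a string: the letter codes of each word, followed by the end mark `1`. -/
def inputString {n : ℕ} (J : List (Word n)) : List ℕ :=
  J.flatMap fun w => w.map letterCode ++ [1]

/-- The initial configuration: field `0` holds the input string, at the places `0, 1, 2, …`;
everything else is `0`. -/
def initialConfig {n : ℕ} (J : List (Word n)) : Config where
  pc := 0
  reg := fun _ => 0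
  field := fun f a => if f = 0 then (inputString J).getD a 0 else 0

/-- The name of an edge of the bouquet: the place of its letter in the input string. -/
def edgeName {n : ℕ} (J : List (Word n)) (e : BouquetEdge J) : ℕ :=
  (inputString (J.take e.1)).length + e.2

/-- Register `0` holds the length of the list `L` of pairs of edges of the bouquet, and fields
`1` and `2` hold the names of the edges of the `k`-th pair at the place `k`. -/
def StoresFoldings {n : ℕ} (J : List (Word n)) (c : Config)
    (L : List (BouquetEdge J × BouquetEdge J)) : Prop :=
  c.reg 0 = L.length ∧
  ∀ k : Fin L.length,
    c.field 1 k = edgeName J (L.get k).1 ∧ c.field 2 k = edgeName J (L.get k).2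

/-- The graph `Γ` with base vertex `v₀` is stored, with its vertices and its edges numbered
consecutively from `0`: registers `1` and `2` hold the numbers of vertices and of edges,
register `3` the base vertex, and fields `3`, `4`, `5` the initial vertex, the label and the
terminal vertex of each edge. -/
def StoresGraph {n : ℕ} (c : Config) (Γ : LGraph (Fin n)) (v₀ : Γ.V) : Prop :=
  ∃ (numV : Γ.V ≃ Fin (c.reg 1)) (numE : Γ.E ≃ Fin (c.reg 2)),
    c.reg 3 = numV v₀ ∧
    ∀ e : Γ.E,
      c.field 3 (numE e) = numV (Γ.src e) ∧
      c.field 4 (numE e) = Γ.label e ∧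
      c.field 5 (numE e) = numV (Γ.tgt e)

/-- The storage contains the result of the folding process for `J`: a sequence of elementary
foldings from the bouquet to a folded graph, and that folded graph. -/
def StoresFoldingProcess {n : ℕ} (J : List (Word n)) (c : Config) : Prop :=
  ∃ (Γ : LGraph (Fin n)) (π : LGraph.Hom (bouquet J) Γ)
    (L : List (BouquetEdge J × BouquetEdge J)),
    LGraph.FoldingSequence (Γ₀ := bouquet J) π L ∧ Γ.Folded ∧
    StoresFoldings J c L ∧ StoresGraph c Γ (π.onV (bouquetBase J))

/-! ### The iterated logarithm -/

/-- `log* N`: the least `k` such that the `k`-fold iterate of the binary logarithm takes `N` to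
a number `≤ 1`. -/
noncomputable def logStar (N : ℕ) : ℕ :=
  sInf {k : ℕ | (fun x : ℝ => Real.logb 2 x)^[k] (N : ℝ) ≤ 1}

end Stallings

namespace Stallings

/-! ### A structured language and its compilation -/

/-- The storage of a machine together with a clock that counts the steps made so far. -/
structure Store where
  reg : ℕ → ℕ
  field : ℕ → ℕ → ℕ
  clk : ℕ

namespace Store

/-- The configuration with storage `s` and program counter `pc`. -/
def cfg (s : Store) (pc : ℕ) : Config := ⟨pc, s.reg, s.field⟩

/-- One time unit passes. -/
def tick (s : Store) : Store := { s with clk := s.clk + 1 }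

/-- Assign the value `v` to register `r`. -/
def set (s : Store) (r v : ℕ) : Store :=
  { s with reg := Function.update s.reg r v, clk := s.clk + 1 }

/-- Change the value of the field `f` at `a` to `v`. -/
def put (s : Store) (f a v : ℕ) : Store :=
  { s with field := Function.update s.field f (Function.update (s.field f) a v),
           clk := s.clk + 1 }

variable (s : Store)

@[simp] theorem reg_tick : s.tick.reg = s.reg := rfl
@[simp] theorem field_tick : s.tick.field = s.field := rfl
@[simp] theorem clk_tick : s.tick.clk = s.clk + 1 := rfl
@[simp] theorem field_set (r v : ℕ) : (s.set r v).field = s.field := rfl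
@[simp] theorem clk_set (r v : ℕ) : (s.set r v).clk = s.clk + 1 := rfl
@[simp] theorem reg_put (f a v : ℕ) : (s.put f a v).reg = s.reg := rfl
@[simp] theorem clk_put (f a v : ℕ) : (s.put f a v).clk = s.clk + 1 := rfl

@[simp] theorem reg_set (r v q : ℕ) :
    (s.set r v).reg q = if q = r then v else s.reg q := by
  simp [set, Function.update_apply]

@[simp] theorem field_put_self (f a v : ℕ) :
    (s.put f a v).field f = Function.update (s.field f) a v := by
  simp [put]

@[simp] theorem field_put_of_ne {f g : ℕ} (a v : ℕ) (h : g ≠ f) :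
    (s.put f a v).field g = s.field g := by
  simp [put, Function.update_of_ne h]

end Store

/-- Structured commands. The loop `untilEq r q c` repeats `c` until the registers `r` and `q`
agree. -/
inductive Cmd where
  | skip
  | const (r k : ℕ)
  | copy (r q : ℕ)
  | succ (r q : ℕ)
  | load (r f a : ℕ)
  | store (f a r : ℕ)
  | seq (c d : Cmd)
  | ifEq (r q : ℕ) (c d : Cmd)
  | ifLt (r q : ℕ) (c d : Cmd)
  | untilEq (r q : ℕ) (c : Cmd)

infixr:60 ";;" => Cmd.seq

namespace Cmd

/-- The number of instructions of the compiled command. -/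
def size : Cmd → ℕ
  | skip => 0
  | const _ _ => 1
  | copy _ _ => 1
  | succ _ _ => 1
  | load _ _ _ => 1
  | store _ _ _ => 1
  | seq c d => c.size + d.size
  | ifEq _ _ c d => c.size + d.size + 2
  | ifLt _ _ c d => c.size + d.size + 2
  | untilEq _ _ c => c.size + 2

/-- The compiled command, to be placed at line `o` of a program. -/
def code : Cmd → ℕ → List Instr
  | skip, _ => []
  | const r k, _ => [.const r k]
  | copy r q, _ => [.copy r q]
  | succ r q, _ => [.succ r q]
  | load r f a, _ => [.load r f a]
  | store f a r, _ => [.store f a r]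
  | seq c d, o => c.code o ++ d.code (o + c.size)
  | ifEq r q c d, o => .jumpEq r q (o + d.size + 2) ::
      (d.code (o + 1) ++
        .jumpEq 0 0 (o + c.size + d.size + 2) :: c.code (o + d.size + 2))
  | ifLt r q c d, o => .jumpLt r q (o + d.size + 2) ::
      (d.code (o + 1) ++
        .jumpEq 0 0 (o + c.size + d.size + 2) :: c.code (o + d.size + 2))
  | untilEq r q c, o => .jumpEq r q (o + c.size + 2) :: (c.code (o + 1) ++ [.jumpEq 0 0 o])

theorem length_code (c : Cmd) (o : ℕ) : (c.code o).length = c.size := by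
  induction c generalizing o <;> simp [code, size, *] <;> omega

/-- A condition on the storage under which the command halts in a storage with property `Q`.
Loops come with an invariant that bounds the clock. -/
def wp : Cmd → (Store → Prop) → Store → Prop
  | skip, Q, s => Q s
  | const r k, Q, s => Q (s.set r k)
  | copy r q, Q, s => Q (s.set r (s.reg q))
  | succ r q, Q, s => Q (s.set r (s.reg q + 1))
  | load r f a, Q, s => Q (s.set r (s.field f (s.reg a)))
  | store f a r, Q, s => Q (s.put f (s.reg a) (s.reg r))
  | seq c d, Q, s => c.wp (d.wp Q) s
  | ifEq r q c d, Q, s =>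
      (s.reg r = s.reg q → c.wp Q s.tick) ∧
      (s.reg r ≠ s.reg q → d.wp (fun s' => Q s'.tick) s.tick)
  | ifLt r q c d, Q, s =>
      (s.reg r < s.reg q → c.wp Q s.tick) ∧
      (¬ s.reg r < s.reg q → d.wp (fun s' => Q s'.tick) s.tick)
  | untilEq r q c, Q, s =>
      ∃ (I : Store → Prop) (B : ℕ), I s ∧ ∀ s', I s' →
        s'.clk ≤ B ∧ (s'.reg r = s'.reg q → Q s'.tick) ∧
        (s'.reg r ≠ s'.reg q → c.wp (fun s'' => I s''.tick) s'.tick)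

/-- The list `l` of instructions stands in `P` from line `o` on. -/
def At (P : Program) (o : ℕ) (l : List Instr) : Prop :=
  ∃ p q, P = p ++ (l ++ q) ∧ p.length = o

theorem At.left {P : Program} {o : ℕ} {l m : List Instr} (h : At P o (l ++ m)) : At P o l := by
  obtain ⟨p, q, rfl, rfl⟩ := h
  exact ⟨p, m ++ q, by simp, rfl⟩

theorem At.right {P : Program} {o : ℕ} {l m : List Instr} (h : At P o (l ++ m)) :
    At P (o + l.length) m := by
  obtain ⟨p, q, rfl, rfl⟩ := h
  exact ⟨p ++ l, q, by simp, by simp⟩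

theorem At.tail {P : Program} {o : ℕ} {i : Instr} {l : List Instr} (h : At P o (i :: l)) :
    At P (o + 1) l := by
  obtain ⟨p, q, rfl, rfl⟩ := h
  exact ⟨p ++ [i], q, by simp, by simp⟩

theorem At.step {P : Program} {i : Instr} {l : List Instr} {c : Config}
    (h : At P c.pc (i :: l)) : P.step c = i.exec c := by
  obtain ⟨p, q, rfl, hp⟩ := h
  simp [Program.step, ← hp]

/-- The command leads from the storage `s` to the storage `s'`, wherever it stands in a
program. -/
def Runs (c : Cmd) (s s' : Store) : Prop :=
  ∃ k, s'.clk = s.clk + k ∧ ∀ P o, At P o (c.code o) →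
    (Program.step P)^[k] (s.cfg o) = s'.cfg (o + c.size)

theorem exists_runs_untilEq {r q : ℕ} {c : Cmd} {I : Store → Prop} {B : ℕ}
    (ih : ∀ {Q s}, c.wp Q s → ∃ s', Runs c s s' ∧ Q s')
    (hI : ∀ s', I s' → s'.clk ≤ B ∧
        (s'.reg r ≠ s'.reg q → c.wp (fun s'' => I s''.tick) s'.tick))
    (m : ℕ) (s : Store) (hm : B - s.clk ≤ m) (hs : I s) :
    ∃ s', Runs (untilEq r q c) s s'.tick ∧ I s' ∧ s'.reg r = s'.reg q := by
  induction m using Nat.strong_induction_on generalizing s with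
  | _ m ihm =>
  by_cases hrq : s.reg r = s.reg q
  · refine ⟨s, ⟨1, rfl, fun P o h => ?_⟩, hs, hrq⟩
    rw [Function.iterate_one]
    refine Eq.trans (At.step (c := s.cfg o) h) ?_
    simp [Instr.exec, Store.cfg, hrq, size, add_assoc]
  · obtain ⟨s₁, ⟨k, hk, hrun⟩, hs₁⟩ := ih ((hI s hs).2 hrq)
    have hB := (hI _ hs₁).1
    simp only [Store.clk_tick] at hk hB
    obtain ⟨s', ⟨k', hk', hrun'⟩, hs', hrq'⟩ :=
      ihm (B - s₁.tick.clk) (by simp only [Store.clk_tick]; omega) s₁.tick le_rfl hs₁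
    simp only [Store.clk_tick] at hk'
    refine ⟨s', ⟨k' + (1 + (k + 1)), by simp only [Store.clk_tick]; omega, fun P o h => ?_⟩,
      hs', hrq'⟩
    rw [Function.iterate_add_apply, Function.iterate_add_apply, Function.iterate_add_apply,
      Function.iterate_one, At.step (c := s.cfg o) h]
    have e₁ : Instr.exec (s.cfg o) (.jumpEq r q (o + c.size + 2)) = s.tick.cfg (o + 1) := by
      simp [Instr.exec, Store.cfg, hrq]
    have h₂ : At P (o + 1) (c.code (o + 1) ++ [.jumpEq 0 0 o]) := At.tail h
    have h₃ := h₂.right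
    rw [length_code] at h₃
    rw [e₁, hrun P (o + 1) h₂.left, At.step (c := s₁.cfg _) h₃]
    have e₂ : Instr.exec (s₁.cfg (o + 1 + c.size)) (.jumpEq 0 0 o) = s₁.tick.cfg o := by
      simp [Instr.exec, Store.cfg]
    rw [e₂]
    exact hrun' P o h

theorem wp_sound {c : Cmd} {Q : Store → Prop} {s : Store} (h : c.wp Q s) :
    ∃ s', Runs c s s' ∧ Q s' := by
  induction c generalizing Q s with
  | skip => exact ⟨s, ⟨0, rfl, fun P o _ => rfl⟩, h⟩
  | seq c d ihc ihd =>
    obtain ⟨s₁, ⟨k, hk, hrun⟩, h₁⟩ := ihc h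
    obtain ⟨s₂, ⟨k', hk', hrun'⟩, h₂⟩ := ihd h₁
    refine ⟨s₂, ⟨k' + k, by omega, fun P o hP => ?_⟩, h₂⟩
    have hP' := At.right hP
    rw [length_code] at hP'
    rw [Function.iterate_add_apply, hrun P o (At.left hP), hrun' P _ hP']
    simp [size, add_assoc]
  | ifEq r q c d ihc ihd =>
    by_cases hrq : s.reg r = s.reg q
    · obtain ⟨s₁, ⟨k, hk, hrun⟩, h₁⟩ := ihc (h.1 hrq)
      refine ⟨s₁, ⟨k + 1, by simp at hk; omega, fun P o hP => ?_⟩, h₁⟩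
      rw [Function.iterate_add_apply, Function.iterate_one, At.step (c := s.cfg o) hP]
      have hP' := (At.tail hP).right.tail
      rw [length_code] at hP'
      have e : Instr.exec (s.cfg o) (.jumpEq r q (o + d.size + 2)) =
          s.tick.cfg (o + d.size + 2) := by simp [Instr.exec, Store.cfg, hrq]
      rw [e, hrun P _ (by convert hP' using 1; omega)]
      congr 1; simp [size]; omega
    · obtain ⟨s₁, ⟨k, hk, hrun⟩, h₁⟩ := ihd (h.2 hrq)
      refine ⟨s₁.tick, ⟨1 + (k + 1), by simp at hk ⊢; omega, fun P o hP => ?_⟩, h₁⟩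
      rw [Function.iterate_add_apply, Function.iterate_add_apply, Function.iterate_one,
        At.step (c := s.cfg o) hP]
      have hP' := (At.tail hP).right
      rw [length_code] at hP'
      have e : Instr.exec (s.cfg o) (.jumpEq r q (o + d.size + 2)) =
          s.tick.cfg (o + 1) := by simp [Instr.exec, Store.cfg, hrq]
      rw [e, hrun P _ (At.tail hP).left, At.step (c := s₁.cfg _) hP']
      simp [Instr.exec, Store.cfg, size]; omega
  | ifLt r q c d ihc ihd =>
    by_cases hrq : s.reg r < s.reg q
    · obtain ⟨s₁, ⟨k, hk, hrun⟩, h₁⟩ := ihc (h.1 hrq)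
      refine ⟨s₁, ⟨k + 1, by simp at hk; omega, fun P o hP => ?_⟩, h₁⟩
      rw [Function.iterate_add_apply, Function.iterate_one, At.step (c := s.cfg o) hP]
      have hP' := (At.tail hP).right.tail
      rw [length_code] at hP'
      have e : Instr.exec (s.cfg o) (.jumpLt r q (o + d.size + 2)) =
          s.tick.cfg (o + d.size + 2) := by simp [Instr.exec, Store.cfg, hrq]
      rw [e, hrun P _ (by convert hP' using 1; omega)]
      congr 1; simp [size]; omega
    · obtain ⟨s₁, ⟨k, hk, hrun⟩, h₁⟩ := ihd (h.2 hrq)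
      refine ⟨s₁.tick, ⟨1 + (k + 1), by simp at hk ⊢; omega, fun P o hP => ?_⟩, h₁⟩
      rw [Function.iterate_add_apply, Function.iterate_add_apply, Function.iterate_one,
        At.step (c := s.cfg o) hP]
      have hP' := (At.tail hP).right
      rw [length_code] at hP'
      have e : Instr.exec (s.cfg o) (.jumpLt r q (o + d.size + 2)) =
          s.tick.cfg (o + 1) := by
        simp only [Instr.exec, Store.cfg, hrq, if_false, Store.reg_tick, Store.field_tick]
      rw [e, hrun P _ (At.tail hP).left, At.step (c := s₁.cfg _) hP']
      simp [Instr.exec, Store.cfg, size]; omega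
  | untilEq r q c ih =>
    obtain ⟨I, B, hs, hI⟩ := h
    obtain ⟨s', hrun, hs', hrq⟩ := exists_runs_untilEq ih
      (fun s' hs' => ⟨(hI s' hs').1, (hI s' hs').2.2⟩) _ s le_rfl hs
    exact ⟨s'.tick, hrun, (hI s' hs').2.1 hrq⟩
  | _ =>
    refine ⟨_, ⟨1, rfl, fun P o hP => ?_⟩, h⟩
    rw [Function.iterate_one]
    exact At.step (c := s.cfg o) hP

/-- A command, compiled as a whole program. -/
theorem haltsWithin_of_wp {c : Cmd} {Q : Store → Prop} {c₀ : Config} (h₀ : c₀.pc = 0)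
    (h : c.wp Q ⟨c₀.reg, c₀.field, 0⟩) :
    ∃ s, Program.HaltsWithin (c.code 0) c₀ s.clk (s.cfg c.size) ∧ Q s := by
  obtain ⟨s, ⟨k, hk, hrun⟩, hs⟩ := wp_sound h
  refine ⟨s, ⟨?_, (length_code c 0).le⟩, hs⟩
  have := hrun (c.code 0) 0 ⟨[], [], by simp, rfl⟩
  rw [zero_add] at this hk
  rw [hk, ← this]
  obtain ⟨pc, r, f⟩ := c₀
  cases h₀
  rfl

end Cmd

/-! ### Towers and the iterated logarithm -/

/-- Iterated powers of two. -/
def tower : ℕ → ℕ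
  | 0 => 1
  | k + 1 => 2 ^ tower k

theorem lt_tower (k : ℕ) : k < tower k := by
  induction k with
  | zero => simp [tower]
  | succ k ih => exact lt_of_le_of_lt ih (Nat.lt_two_pow_self)

theorem tower_mono : Monotone tower :=
  monotone_nat_of_le_succ fun k => (Nat.lt_two_pow_self (n := tower k)).le

theorem exists_le_tower (r : ℕ) : ∃ k, r ≤ tower k := ⟨r, (lt_tower r).le⟩

/-- The least `k` with `r ≤ tower k`. -/
def grade (r : ℕ) : ℕ := Nat.find (exists_le_tower r)

theorem le_tower_grade (r : ℕ) : r ≤ tower (grade r) := Nat.find_spec (exists_le_tower r)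

theorem grade_le {r k : ℕ} (h : r ≤ tower k) : grade r ≤ k := Nat.find_min' _ h

theorem lt_grade {r k : ℕ} (h : tower k < r) : k < grade r := by
  by_contra! hk
  exact absurd ((le_tower_grade r).trans (tower_mono hk)) (not_le.2 h)

theorem grade_mono : Monotone grade := fun _ _ h => grade_le (h.trans (le_tower_grade _))

theorem grade_zero : grade 0 = 0 := Nat.le_zero.1 (grade_le (Nat.zero_le _))

theorem grade_succ (r : ℕ) :
    grade (r + 1) = grade r ∨ grade (r + 1) = grade r + 1 ∧ r = tower (grade r) := by
  rcases (le_tower_grade r).lt_or_eq with h | h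
  · exact Or.inl (le_antisymm (grade_le h) (grade_mono (Nat.le_succ r)))
  · refine Or.inr ⟨le_antisymm (grade_le ?_) (lt_grade (by omega)), h⟩
    rw [tower, ← h]
    exact Nat.lt_two_pow_self

theorem exists_iterate_logb_le_one {x : ℝ} {k : ℕ} (h : x ≤ tower k) :
    ∃ j, (fun x : ℝ => Real.logb 2 x)^[j] x ≤ 1 := by
  induction k generalizing x with
  | zero => exact ⟨0, by simpa [tower] using h⟩
  | succ k ih =>
    by_cases hx : x ≤ 1
    · exact ⟨0, hx⟩
    · obtain ⟨j, hj⟩ := ih (x := Real.logb 2 x) (by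
        rw [Real.logb_le_iff_le_rpow one_lt_two (by linarith), Real.rpow_natCast]
        simpa [tower] using h)
      exact ⟨j + 1, hj⟩

theorem le_tower_of_iterate_logb {x : ℝ} {k : ℕ}
    (h : (fun x : ℝ => Real.logb 2 x)^[k] x ≤ 1)
    (hk : ∀ j < k, ¬ (fun x : ℝ => Real.logb 2 x)^[j] x ≤ 1) : x ≤ tower k := by
  induction k generalizing x with
  | zero => simpa [tower] using h
  | succ k ih =>
    have hx : ¬ x ≤ 1 := hk 0 (Nat.succ_pos k)
    have := ih (x := Real.logb 2 x) h fun j hj => hk (j + 1) (Nat.succ_lt_succ hj)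
    rw [Real.logb_le_iff_le_rpow one_lt_two (by linarith), Real.rpow_natCast] at this
    simpa [tower] using this

theorem le_tower_logStar (N : ℕ) : N ≤ tower (logStar N) := by
  have hne : {k : ℕ | (fun x : ℝ => Real.logb 2 x)^[k] (N : ℝ) ≤ 1}.Nonempty :=
    exists_iterate_logb_le_one (k := N) (by exact_mod_cast (lt_tower N).le)
  exact_mod_cast le_tower_of_iterate_logb (x := N) (Nat.sInf_mem hne)
    fun j hj => Nat.notMem_of_lt_sInf hj

theorem logStar_pos {N : ℕ} (h : 2 ≤ N) : 1 ≤ logStar N := by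
  by_contra! h0
  have := le_tower_logStar N
  rw [Nat.lt_one_iff.1 h0, tower] at this
  omega

/-! ### Disjoint sets with linking by rank and path halving -/

/-- The pointers `par` form a forest on `V` in which `rt x` is the root of the tree of `x`, and
`rk` is a rank function on it. -/
structure Forest (V : Finset ℕ) (rt par rk : ℕ → ℕ) : Prop where
  par_mem : ∀ x ∈ V, par x ∈ V
  rt_mem : ∀ x ∈ V, rt x ∈ V
  rt_par : ∀ x ∈ V, rt (par x) = rt x
  par_rt : ∀ x ∈ V, par (rt x) = rt x
  rt_eq_self : ∀ x ∈ V, par x = x → rt x = x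
  rk_lt : ∀ x ∈ V, par x ≠ x → rk x < rk (par x)
  rk_le : ∀ x ∈ V, rk x ≤ V.card
  sum_le : ∑ x ∈ V, (if par x = x then rk x + 1 else 0) ≤ V.card

/-- The contribution of a root of rank `r` to the potential. -/
def rootPotential (G W r : ℕ) : ℕ := W + ((G - grade r) * 2 ^ r + tower (grade r))

/-- The potential of a forest; `G` bounds the grades of the ranks and `W` is an additional
weight of each root. -/
def potential (G W : ℕ) (V : Finset ℕ) (par rk : ℕ → ℕ) : ℕ :=
  ∑ x ∈ V, if par x = x then rootPotential G W (rk x) else tower (grade (rk x)) - rk (par x)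

theorem rootPotential_succ {G W r : ℕ} (h : grade (r + 1) ≤ G) :
    rootPotential G W (r + 1) + (tower (grade r) - (r + 1)) + W ≤
      rootPotential G W r + rootPotential G W r := by
  unfold rootPotential
  rcases grade_succ r with e | ⟨e, hr⟩
  · rw [e, pow_succ]
    have : (G - grade r) * (2 ^ r * 2) = (G - grade r) * 2 ^ r + (G - grade r) * 2 ^ r := by ring
    omega
  · rw [e] at h ⊢
    obtain ⟨d, hd⟩ := Nat.exists_eq_add_of_le h
    have e₁ : G - (grade r + 1) = d := by omega
    have e₂ : G - grade r = d + 1 := by omega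
    have e₃ : tower (grade r + 1) = 2 ^ r := by rw [tower, ← hr]
    rw [e₁, e₂, e₃, pow_succ]
    have e₄ : d * (2 ^ r * 2) = d * 2 ^ r + d * 2 ^ r := by ring
    have e₅ : (d + 1) * 2 ^ r = d * 2 ^ r + 2 ^ r := by ring
    omega

namespace Forest

variable {V : Finset ℕ} {rt par rk : ℕ → ℕ} {G W : ℕ}

theorem rt_rt (h : Forest V rt par rk) {x : ℕ} (hx : x ∈ V) : rt (rt x) = rt x :=
  h.rt_eq_self _ (h.rt_mem x hx) (h.par_rt x hx)

theorem grade_le (h : Forest V rt par rk) (hG : V.card ≤ tower G) {x : ℕ} (hx : x ∈ V) :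
    grade (rk x) ≤ G := Stallings.grade_le ((h.rk_le x hx).trans hG)

theorem rk_lt_par_par (h : Forest V rt par rk) {x : ℕ} (hx : x ∈ V) (hp : par x ≠ x) :
    rk x < rk (par (par x)) := by
  have h₁ := h.rk_lt x hx hp
  by_cases hq : par (par x) = par x
  · rwa [hq]
  · exact h₁.trans (h.rk_lt _ (h.par_mem x hx) hq)

theorem halve (h : Forest V rt par rk) {x : ℕ} (hx : x ∈ V) (hp : par x ≠ x) :
    Forest V rt (Function.update par x (par (par x))) rk := by
  have hr := h.rk_lt_par_par hx hp
  have hpp : par (par x) ≠ x := fun e => by rw [e] at hr; exact lt_irrefl _ hr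
  have hroot : ∀ y, Function.update par x (par (par x)) y = y ↔ par y = y := by
    intro y
    by_cases hy : y = x
    · subst hy; simp [hp, hpp]
    · rw [Function.update_of_ne hy]
  constructor
  · intro y hy
    by_cases hyx : y = x
    · subst hyx; simpa using h.par_mem _ (h.par_mem _ hy)
    · rw [Function.update_of_ne hyx]; exact h.par_mem y hy
  · exact h.rt_mem
  · intro y hy
    by_cases hyx : y = x
    · subst hyx
      rw [Function.update_self, h.rt_par _ (h.par_mem _ hy), h.rt_par _ hy]
    · rw [Function.update_of_ne hyx]; exact h.rt_par y hy
  · intro y hy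
    rw [hroot]; exact h.par_rt y hy
  · intro y hy e
    rw [hroot] at e; exact h.rt_eq_self y hy e
  · intro y hy e
    rw [ne_eq, hroot] at e
    by_cases hyx : y = x
    · subst hyx; rwa [Function.update_self]
    · rw [Function.update_of_ne hyx]; exact h.rk_lt y hy e
  · exact h.rk_le
  · simpa only [hroot] using h.sum_le

theorem potential_halve (h : Forest V rt par rk) (hG : V.card ≤ tower G) {x : ℕ} (hx : x ∈ V)
    (hp : par x ≠ x) (hq : par (par x) ≠ par x) :
    potential G W V (Function.update par x (par (par x))) rk +
      (G - grade (rk (par (par x)))) + 1 ≤ potential G W V par rk + (G - grade (rk x)) := by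
  have hr := h.rk_lt_par_par hx hp
  have hpp : par (par x) ≠ x := fun e => by rw [e] at hr; exact lt_irrefl _ hr
  have hr₂ := h.rk_lt _ (h.par_mem x hx) hq
  have hg := h.grade_le hG (h.par_mem _ (h.par_mem x hx))
  have hg' := h.grade_le hG hx
  have hmono : grade (rk x) ≤ grade (rk (par (par x))) := grade_mono hr.le
  unfold potential
  rw [← Finset.add_sum_erase V _ hx,
    ← Finset.add_sum_erase V (fun y => if par y = y then _ else _) hx]
  have e : ∑ y ∈ V.erase x, (if Function.update par x (par (par x)) y = y then
        rootPotential G W (rk y) else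
        tower (grade (rk y)) - rk (Function.update par x (par (par x)) y)) =
      ∑ y ∈ V.erase x, (if par y = y then rootPotential G W (rk y) else
        tower (grade (rk y)) - rk (par y)) := by
    refine Finset.sum_congr rfl fun y hy => ?_
    rw [Function.update_of_ne (Finset.ne_of_mem_erase hy)]
  rw [e]
  simp only [Function.update_self, hpp, hp, if_false]
  by_cases hT : rk (par x) < tower (grade (rk x))
  · omega
  · have : grade (rk x) < grade (rk (par (par x))) := lt_grade (by omega)
    omega

theorem rk_add_rk_lt (h : Forest V rt par rk) {l r : ℕ} (hl : l ∈ V) (hr : r ∈ V) (hlr : l ≠ r)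
    (hpl : par l = l) (hpr : par r = r) : rk l + rk r + 1 < V.card := by
  have := h.sum_le
  rw [← Finset.add_sum_erase V _ hl,
    ← Finset.add_sum_erase _ _ (Finset.mem_erase.2 ⟨hlr.symm, hr⟩)] at this
  simp only [hpl, hpr, if_true] at this
  omega

/-- Make the root `l` a child of the root `r`, where the rank of `l` is at most that of `r`. -/
theorem link (h : Forest V rt par rk) {l r : ℕ} (hl : l ∈ V) (hr : r ∈ V) (hlr : l ≠ r)
    (hpl : par l = l) (hpr : par r = r) (hle : rk l ≤ rk r) {rk' : ℕ → ℕ}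
    (hrk : rk' = if rk l = rk r then Function.update rk r (rk r + 1) else rk)
    (hG : V.card ≤ tower G) :
    Forest V (fun x => if rt x = l then r else rt x) (Function.update par l r) rk' ∧
      potential G W V (Function.update par l r) rk' + W ≤ potential G W V par rk := by
  have hne : ∀ y, y ≠ r → rk' y = rk y := by
    intro y hy
    rw [hrk]; split_ifs
    · rw [Function.update_of_ne hy]
    · rfl
  have hge : ∀ y, rk y ≤ rk' y := by
    intro y
    by_cases hy : y = r
    · subst hy; rw [hrk]; split_ifs <;> simp
    · exact (hne y hy).ge
  have hlt : rk' l < rk' r := by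
    rw [hne l hlr, hrk]; split_ifs with e
    · simp; omega
    · exact lt_of_le_of_ne hle e
  have hcard := h.rk_add_rk_lt hl hr hlr hpl hpr
  have hrk'r : rk' r + 1 ≤ rk l + rk r + 2 := by
    rw [hrk]; split_ifs
    · rw [Function.update_self]; omega
    · omega
  have hrtl : rt l = l := h.rt_eq_self l hl hpl
  have hrtr : rt r = r := h.rt_eq_self r hr hpr
  refine ⟨⟨?_, ?_, ?_, ?_, ?_, ?_, ?_, ?_⟩, ?_⟩
  · intro y hy
    by_cases e : y = l
    · subst e; simpa
    · rw [Function.update_of_ne e]; exact h.par_mem y hy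
  · intro y hy
    split_ifs
    · exact hr
    · exact h.rt_mem y hy
  · intro y hy
    by_cases e : y = l
    · subst e; simp [hrtr, hrtl, hlr.symm]
    · rw [Function.update_of_ne e]; simp only [h.rt_par y hy]
  · intro y hy
    split_ifs with e
    · rw [Function.update_of_ne hlr.symm, hpr]
    · rw [Function.update_of_ne e, h.par_rt y hy]
  · intro y hy e
    by_cases e' : y = l
    · subst e'; simp [hlr.symm] at e
    · rw [Function.update_of_ne e'] at e
      have := h.rt_eq_self y hy e
      simp [this, e']
  · intro y hy e
    by_cases e' : y = l
    · subst e'; simpa using hlt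
    · rw [Function.update_of_ne e'] at e ⊢
      have hyr : y ≠ r := fun e'' => e (e'' ▸ hpr)
      rw [hne y hyr]
      exact (h.rk_lt y hy e).trans_le (hge _)
  · intro y hy
    by_cases e : y = r
    · subst e; omega
    · rw [hne y e]; exact h.rk_le y hy
  · refine le_trans ?_ h.sum_le
    rw [← Finset.add_sum_erase V _ hl,
      ← Finset.add_sum_erase _ _ (Finset.mem_erase.2 ⟨hlr.symm, hr⟩),
      ← Finset.add_sum_erase V (fun x => if par x = x then rk x + 1 else 0) hl,
      ← Finset.add_sum_erase _ (fun x => if par x = x then rk x + 1 else 0)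
        (Finset.mem_erase.2 ⟨hlr.symm, hr⟩)]
    have e : ∑ y ∈ (V.erase l).erase r,
          (if Function.update par l r y = y then rk' y + 1 else 0) =
        ∑ y ∈ (V.erase l).erase r, (if par y = y then rk y + 1 else 0) := by
      refine Finset.sum_congr rfl fun y hy => ?_
      simp only [Finset.mem_erase] at hy
      rw [Function.update_of_ne hy.2.1, hne y hy.1]
    rw [e]
    simp only [Function.update_self, Function.update_of_ne hlr.symm, hpl, hpr, hlr.symm,
      if_true, if_false]
    omega
  · unfold potential
    rw [← Finset.add_sum_erase V _ hl,
      ← Finset.add_sum_erase _ _ (Finset.mem_erase.2 ⟨hlr.symm, hr⟩),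
      ← Finset.add_sum_erase V (fun x => if par x = x then rootPotential G W (rk x) else _) hl,
      ← Finset.add_sum_erase _ (fun x => if par x = x then rootPotential G W (rk x) else _)
        (Finset.mem_erase.2 ⟨hlr.symm, hr⟩)]
    have e : ∑ y ∈ (V.erase l).erase r,
          (if Function.update par l r y = y then rootPotential G W (rk' y) else
            tower (grade (rk' y)) - rk' (Function.update par l r y)) ≤
        ∑ y ∈ (V.erase l).erase r, (if par y = y then rootPotential G W (rk y) else
            tower (grade (rk y)) - rk (par y)) := by
      refine Finset.sum_le_sum fun y hy => ?_
      simp only [Finset.mem_erase] at hy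
      rw [Function.update_of_ne hy.2.1, hne y hy.1]
      split_ifs
      · exact le_rfl
      · exact Nat.sub_le_sub_left (hge _) _
    simp only [Function.update_self, Function.update_of_ne hlr.symm, hpl, hpr, hlr.symm,
      if_true, if_false]
    rw [hne l hlr]
    have key : tower (grade (rk l)) - rk' r + rootPotential G W (rk' r) + W ≤
        rootPotential G W (rk l) + rootPotential G W (rk r) := by
      by_cases e' : rk l = rk r
      · have e'' : rk' r = rk r + 1 := by rw [hrk, if_pos e', Function.update_self]
        rw [e'', e']
        have := rootPotential_succ (G := G) (W := W) (r := rk r)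
          (Stallings.grade_le (by omega))
        omega
      · have e'' : rk' r = rk r := by rw [hrk, if_neg e']
        rw [e'']
        unfold rootPotential
        omega
    omega

end Forest

theorem potential_discrete (G W : ℕ) (V : Finset ℕ) {par rk : ℕ → ℕ} (hp : ∀ x ∈ V, par x = x)
    (hr : ∀ x, rk x = 0) : potential G W V par rk = V.card * (W + G + 1) := by
  unfold potential
  rw [Finset.sum_congr rfl (g := fun _ => W + G + 1), Finset.sum_const, smul_eq_mul]
  intro x hx
  rw [if_pos (hp x hx), hr, rootPotential, grade_zero]
  simp [tower, add_assoc]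

theorem forest_discrete {V : Finset ℕ} {par rk : ℕ → ℕ} (hp : ∀ x ∈ V, par x = x)
    (hr : ∀ x, rk x = 0) : Forest V id par rk := by
  refine ⟨fun x hx => by rwa [hp x hx], fun x hx => hx, fun x hx => by rw [hp x hx],
    fun x hx => hp x hx, fun x _ _ => rfl, fun x hx h => absurd (hp x hx) h,
    fun x _ => by simp [hr], ?_⟩
  calc ∑ x ∈ V, (if par x = x then rk x + 1 else 0) ≤ ∑ x ∈ V, 1 :=
        Finset.sum_le_sum fun x hx => by rw [if_pos (hp x hx), hr]
    _ = V.card := by simp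

/-! ### Foldings -/

namespace LGraph

variable {X : Type}

/-- Every pair of different edges with the same label and a common endpoint can be folded. -/
theorem exists_isElementaryFolding (Γ : LGraph X) {e₁ e₂ : Γ.E} (hne : e₁ ≠ e₂)
    (hlab : Γ.label e₁ = Γ.label e₂) (hinc : Γ.src e₁ = Γ.src e₂ ∨ Γ.tgt e₁ = Γ.tgt e₂) :
    ∃ (Δ : LGraph X) (ρ : Hom Γ Δ), IsElementaryFolding ρ e₁ e₂ := by
  let sV : Setoid Γ.V :=
    { r := fun u w => u = w ∨
        (u = Γ.src e₁ ∧ w = Γ.src e₂) ∨ (u = Γ.src e₂ ∧ w = Γ.src e₁) ∨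
        (u = Γ.tgt e₁ ∧ w = Γ.tgt e₂) ∨ (u = Γ.tgt e₂ ∧ w = Γ.tgt e₁)
      iseqv := ⟨fun _ => Or.inl rfl, fun h => by tauto, fun h h' => by grind⟩ }
  let sE : Setoid Γ.E :=
    { r := fun e e' => e = e' ∨ (e = e₁ ∧ e' = e₂) ∨ (e = e₂ ∧ e' = e₁)
      iseqv := ⟨fun _ => Or.inl rfl, fun h => by tauto, fun h h' => by grind⟩ }
  have hsrc : ∀ e e', sE.r e e' → sV.r (Γ.src e) (Γ.src e') := by
    rintro e e' (rfl | ⟨rfl, rfl⟩ | ⟨rfl, rfl⟩)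
    · exact Or.inl rfl
    · exact Or.inr (Or.inl ⟨rfl, rfl⟩)
    · exact Or.inr (Or.inr (Or.inl ⟨rfl, rfl⟩))
  have htgt : ∀ e e', sE.r e e' → sV.r (Γ.tgt e) (Γ.tgt e') := by
    rintro e e' (rfl | ⟨rfl, rfl⟩ | ⟨rfl, rfl⟩)
    · exact Or.inl rfl
    · exact Or.inr (Or.inr (Or.inr (Or.inl ⟨rfl, rfl⟩)))
    · exact Or.inr (Or.inr (Or.inr (Or.inr ⟨rfl, rfl⟩)))
  have hlabel : ∀ e e', sE.r e e' → Γ.label e = Γ.label e' := by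
    rintro e e' (rfl | ⟨rfl, rfl⟩ | ⟨rfl, rfl⟩)
    · rfl
    · exact hlab
    · exact hlab.symm
  let Δ : LGraph X :=
    { V := Quotient sV
      E := Quotient sE
      src := Quotient.map' Γ.src hsrc
      tgt := Quotient.map' Γ.tgt htgt
      label := Quotient.lift Γ.label hlabel }
  let ρ : Hom Γ Δ :=
    { onV := Quotient.mk sV
      onE := Quotient.mk sE
      src_onE := fun _ => rfl
      tgt_onE := fun _ => rfl
      label_onE := fun _ => rfl }
  exact ⟨Δ, ρ, hne, hlab, hinc, Quotient.mk_surjective, Quotient.mk_surjective,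
    fun u w => Quotient.eq (r := sV), fun e e' => Quotient.eq (r := sE)⟩

/-- The list `L` describes a sequence of elementary foldings which starts at `Γ₀`. The vertices of
the resulting graph are the classes of vertices of `Γ₀` with the same value of `cl`, and its edges
are represented uniquely by the edges of `Γ₀` in `A`. -/
def FoldsTo (Γ₀ : LGraph X) (cl : Γ₀.V → ℕ) (A : Γ₀.E → Prop) (L : List (Γ₀.E × Γ₀.E)) : Prop :=
  ∃ (Γ : LGraph X) (π : Hom Γ₀ Γ), FoldingSequence π L ∧ Function.Surjective π.onV ∧
    Function.Surjective π.onE ∧ (∀ u w, π.onV u = π.onV w ↔ cl u = cl w) ∧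
    (∀ e, ∃ e', A e' ∧ π.onE e' = π.onE e) ∧
    ∀ e e', A e → A e' → π.onE e = π.onE e' → e = e'

theorem foldsTo_nil (Γ₀ : LGraph X) {cl : Γ₀.V → ℕ} (hcl : Function.Injective cl)
    {A : Γ₀.E → Prop} (hA : ∀ e, A e) : FoldsTo Γ₀ cl A [] :=
  ⟨Γ₀, Hom.id Γ₀, .nil, fun v => ⟨v, rfl⟩, fun e => ⟨e, rfl⟩, fun _ _ => hcl.eq_iff.symm,
    fun e => ⟨e, hA e, rfl⟩, fun _ _ _ _ h => h⟩

theorem FoldsTo.fold {Γ₀ : LGraph X} {cl cl' : Γ₀.V → ℕ} {A A' : Γ₀.E → Prop}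
    {L : List (Γ₀.E × Γ₀.E)} (h : FoldsTo Γ₀ cl A L) {e f : Γ₀.E} (he : A e) (hf : A f)
    (hef : e ≠ f) (hlab : Γ₀.label e = Γ₀.label f)
    (hinc : cl (Γ₀.src e) = cl (Γ₀.src f) ∨ cl (Γ₀.tgt e) = cl (Γ₀.tgt f))
    (hcl : ∀ u w, cl' u = cl' w ↔ cl u = cl w ∨
      (cl u = cl (Γ₀.src e) ∧ cl w = cl (Γ₀.src f)) ∨
      (cl u = cl (Γ₀.src f) ∧ cl w = cl (Γ₀.src e)) ∨
      (cl u = cl (Γ₀.tgt e) ∧ cl w = cl (Γ₀.tgt f)) ∨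
      (cl u = cl (Γ₀.tgt f) ∧ cl w = cl (Γ₀.tgt e)))
    (hA : ∀ g, A' g ↔ A g ∧ g ≠ e) : FoldsTo Γ₀ cl' A' (L ++ [(e, f)]) := by
  obtain ⟨Γ, π, h₁, h₂, h₃, h₄, h₅, h₆⟩ := h
  obtain ⟨Δ, ρ, hρ⟩ := exists_isElementaryFolding Γ (e₁ := π.onE e) (e₂ := π.onE f)
    (fun h => hef (h₆ _ _ he hf h)) (by rw [π.label_onE, π.label_onE, hlab])
    (by rw [π.src_onE, π.src_onE, π.tgt_onE, π.tgt_onE, h₄, h₄]; exact hinc)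
  refine ⟨Δ, ρ.comp π, .snoc ρ e f h₁ hρ, hρ.onV_surjective.comp h₂, hρ.onE_surjective.comp h₃,
    fun u w => ?_, fun g => ?_, fun g g' hg hg' hgg => ?_⟩
  · change ρ.onV (π.onV u) = ρ.onV (π.onV w) ↔ _
    rw [hρ.onV_eq_iff, hcl]
    simp only [π.src_onE, π.tgt_onE, h₄]
  · change ∃ e', A' e' ∧ ρ.onE (π.onE e') = ρ.onE (π.onE g)
    obtain ⟨g', hg', hgg⟩ := h₅ g
    by_cases e' : g' = e
    · subst e'
      refine ⟨f, (hA f).2 ⟨hf, hef.symm⟩, ?_⟩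
      rw [← hgg, hρ.onE_eq_iff]
      exact Or.inr (Or.inr ⟨rfl, rfl⟩)
    · exact ⟨g', (hA g').2 ⟨hg', e'⟩, by rw [hgg]⟩
  · change ρ.onE (π.onE g) = ρ.onE (π.onE g') at hgg
    rw [hA] at hg hg'
    rw [hρ.onE_eq_iff] at hgg
    rcases hgg with h | ⟨h, -⟩ | ⟨-, h⟩
    · exact h₆ _ _ hg.1 hg'.1 h
    · exact absurd (h₆ _ _ hg.1 he h) hg.2
    · exact absurd (h₆ _ _ hg'.1 he h) hg'.2

end LGraph

/-- What is to be stored for a folded graph, in terms of vertex classes and of edges that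
represent the edges of the graph. -/
theorem stores_of_foldsTo {n : ℕ} {J : List (Word n)} {c : Config}
    {cl : (bouquet J).V → ℕ} {A : (bouquet J).E → Prop}
    {L : List (BouquetEdge J × BouquetEdge J)} (h : (bouquet J).FoldsTo cl A L)
    (hL : StoresFoldings J c L)
    (hfold : ∀ e e', A e → A e' → (bouquet J).label e = (bouquet J).label e' →
      (cl ((bouquet J).src e) = cl ((bouquet J).src e') ∨
        cl ((bouquet J).tgt e) = cl ((bouquet J).tgt e')) → e = e')
    (num : ℕ → ℕ) (hnum : ∀ u, num (cl u) < c.reg 1)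
    (hnum_inj : ∀ u w, num (cl u) = num (cl w) → cl u = cl w)
    (hnum_surj : ∀ k < c.reg 1, ∃ u, num (cl u) = k)
    (hbase : c.reg 3 = num (cl (bouquetBase J)))
    (idx : (bouquet J).E → ℕ) (hidx : ∀ e, A e → idx e < c.reg 2)
    (hidx_inj : ∀ e e', A e → A e' → idx e = idx e' → e = e')
    (hidx_surj : ∀ k < c.reg 2, ∃ e, A e ∧ idx e = k)
    (hst : ∀ e, A e → c.field 3 (idx e) = num (cl ((bouquet J).src e)) ∧
      c.field 4 (idx e) = (bouquet J).label e ∧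
      c.field 5 (idx e) = num (cl ((bouquet J).tgt e))) :
    StoresFoldingProcess J c := by
  obtain ⟨Γ, π, h₁, h₂, h₃, h₄, h₅, h₆⟩ := h
  choose rv hrv using h₂
  choose re hre using h₃
  choose rA hA hrA using h₅
  have hclv : ∀ u, cl (rv (π.onV u)) = cl u := fun u => by rw [← h₄, hrv]
  have hE : ∀ e : Γ.E, π.onE (rA (re e)) = e := fun e => by rw [hrA, hre]
  have hEA : ∀ e, A e → rA (re (π.onE e)) = e := fun e he =>
    h₆ _ _ (hA _) he (by rw [hE])
  refine ⟨Γ, π, L, h₁, ?_, hL, ?_⟩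
  · intro e e' hl hinc
    rw [← hE e, ← hE e'] at hl hinc ⊢
    rw [π.label_onE, π.label_onE] at hl
    rw [π.src_onE, π.src_onE, π.tgt_onE, π.tgt_onE, h₄, h₄] at hinc
    rw [hfold _ _ (hA _) (hA _) hl hinc]
  · refine ⟨Equiv.ofBijective (fun v => ⟨num (cl (rv v)), hnum _⟩) ⟨fun v w hvw => ?_, fun k => ?_⟩,
      Equiv.ofBijective (fun e => ⟨idx (rA (re e)), hidx _ (hA _)⟩)
        ⟨fun e e' hee => ?_, fun k => ?_⟩, ?_, fun e => ?_⟩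
    · have := hnum_inj _ _ (Fin.mk.inj_iff.1 hvw)
      rwa [← h₄, hrv, hrv] at this
    · obtain ⟨u, hu⟩ := hnum_surj k k.2
      exact ⟨π.onV u, Fin.ext (by simpa [hclv] using hu)⟩
    · have := hidx_inj _ _ (hA _) (hA _) (Fin.mk.inj_iff.1 hee)
      rw [← hE e, ← hE e', this]
    · obtain ⟨e, he, hk⟩ := hidx_surj k k.2
      exact ⟨π.onE e, Fin.ext (by simpa [hEA e he] using hk)⟩
    · change c.reg 3 = num (cl (rv (π.onV _)))
      rw [hbase, hclv]
    · have hs := π.src_onE (rA (re e))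
      have ht := π.tgt_onE (rA (re e))
      have hl := π.label_onE (rA (re e))
      rw [hE] at hs ht hl
      change c.field 3 (idx (rA (re e))) = num (cl (rv (Γ.src e))) ∧
        c.field 4 (idx (rA (re e))) = Γ.label e ∧
        c.field 5 (idx (rA (re e))) = num (cl (rv (Γ.tgt e)))
      rw [hs, ht, hl, hclv, hclv]
      exact hst (rA (re e)) (hA _)

/-! ### Registers and fields of the folding program -/

notation "fPar" => (6 : ℕ)
notation "fRank" => (7 : ℕ)
notation "fSrc" => (8 : ℕ)
notation "fTgt" => (9 : ℕ)
notation "fLab" => (10 : ℕ)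
notation "fName" => (11 : ℕ)
notation "fAlive" => (12 : ℕ)
notation "fQueue" => (13 : ℕ)
notation "fNum" => (14 : ℕ)
notation "fOut" => (20 : ℕ)
notation "fInn" => (21 : ℕ)

notation "rZero" => (4 : ℕ)
notation "rOne" => (5 : ℕ)
notation "rPos" => (6 : ℕ)
notation "rHead" => (7 : ℕ)
notation "rTail" => (8 : ℕ)
notation "rEnd" => (9 : ℕ)
notation "rX" => (10 : ℕ)
notation "rXp" => (11 : ℕ)
notation "rXpp" => (12 : ℕ)
notation "rTmp" => (13 : ℕ)
notation "rCode" => (14 : ℕ)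
notation "rCur" => (15 : ℕ)
notation "rNext" => (16 : ℕ)
notation "rId" => (17 : ℕ)
notation "rAhead" => (18 : ℕ)
notation "rLab" => (19 : ℕ)
notation "rSrc" => (20 : ℕ)
notation "rTgt" => (21 : ℕ)
notation "rE" => (22 : ℕ)
notation "rU" => (23 : ℕ)
notation "rV" => (24 : ℕ)
notation "rF" => (25 : ℕ)
notation "rName" => (26 : ℕ)
notation "rA" => (27 : ℕ)
notation "rB" => (28 : ℕ)
notation "rRankA" => (29 : ℕ)
notation "rRankB" => (30 : ℕ)
notation "rSwap" => (31 : ℕ)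
notation "rI" => (32 : ℕ)
notation "rN" => (33 : ℕ)
notation "rG" => (34 : ℕ)

theorem Store.field_put_apply (s : Store) (f a v g b : ℕ) :
    (s.put f a v).field g b = if g = f ∧ b = a then v else s.field g b := by
  by_cases h : g = f
  · subst h; by_cases h' : b = a
    · subst h'; simp
    · simp [h']
  · simp [h]

/-! ### Access to a family of fields -/

namespace Cmd

/-- Load the value at the register `a` of the `reg x`-th field of the family `2 * i + b`,
`i < k`. -/
def loadAt : ℕ → ℕ → ℕ → ℕ → ℕ → Cmd
  | 0, _, _, _, _ => skip
  | k + 1, b, r, x, a =>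
      const rTmp k ;; ifEq x rTmp (load r (2 * k + b) a) (loadAt k b r x a)

/-- Store the register `r` at the register `a` of the `reg x`-th field of the family `2 * i + b`,
`i < k`. -/
def storeAt : ℕ → ℕ → ℕ → ℕ → ℕ → Cmd
  | 0, _, _, _, _ => skip
  | k + 1, b, x, a, r =>
      const rTmp k ;; ifEq x rTmp (store (2 * k + b) a r) (storeAt k b x a r)

theorem wp_loadAt {k b r x a : ℕ} {s : Store} {Q : Store → Prop} (hx : s.reg x < k)
    (hxt : x ≠ rTmp) (hat : a ≠ rTmp)
    (h : ∀ s', (∀ q, q ≠ rTmp → s'.reg q =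
        if q = r then s.field (2 * s.reg x + b) (s.reg a) else s.reg q) →
      s'.field = s.field → s'.clk ≤ s.clk + 3 * k → Q s') : (loadAt k b r x a).wp Q s := by
  induction k generalizing s Q with
  | zero => omega
  | succ k ih =>
    simp only [loadAt, wp, Store.reg_set, hxt, if_true, if_false]
    refine ⟨fun hk => h _ (fun q hq => ?_) rfl ?_, fun hk => ?_⟩
    · simp [hq, hat, hk]
    · simp; omega
    · refine ih (by simp [hxt]; omega) fun s' h₁ h₂ h₃ => h _ (fun q hq => ?_) ?_ ?_
      · rw [Store.reg_tick, h₁ q hq]; simp [hq, hat, hxt]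
      · simpa using h₂
      · simp at h₃ ⊢; omega

theorem wp_storeAt {k b r x a : ℕ} {s : Store} {Q : Store → Prop} (hx : s.reg x < k)
    (hxt : x ≠ rTmp) (hat : a ≠ rTmp) (hrt : r ≠ rTmp)
    (h : ∀ s', (∀ q, q ≠ rTmp → s'.reg q = s.reg q) →
      (∀ f c, s'.field f c = if f = 2 * s.reg x + b ∧ c = s.reg a then s.reg r
        else s.field f c) → s'.clk ≤ s.clk + 3 * k → Q s') : (storeAt k b x a r).wp Q s := by
  induction k generalizing s Q with
  | zero => omega
  | succ k ih =>
    simp only [storeAt, wp, Store.reg_set, hxt, if_true, if_false]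
    refine ⟨fun hk => h _ (fun q hq => ?_) (fun f c => ?_) ?_, fun hk => ?_⟩
    · simp [hq]
    · simp [Store.field_put_apply, hat, hrt, hk]
    · simp; omega
    · refine ih (by simp [hxt]; omega) fun s' h₁ h₂ h₃ => h _ (fun q hq => ?_) (fun f c => ?_) ?_
      · rw [Store.reg_tick, h₁ q hq]; simp [hq]
      · rw [Store.field_tick, h₂]; simp [hat, hxt, hrt]
      · simp at h₃ ⊢; omega

/-! ### The root of a vertex -/

/-- Replace the vertex in `rX` by its root, with path halving. -/
def find : Cmd :=
  load rXp fPar rX ;;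
  untilEq rX rXp (load rXpp fPar rXp ;; store fPar rX rXpp ;; copy rX rXpp ;; load rXp fPar rX)

theorem wp_find {V : Finset ℕ} {rt : ℕ → ℕ} {G : ℕ} (W : ℕ) {s : Store} {Q : Store → Prop}
    (hF : Forest V rt (s.field fPar) (s.field fRank)) (hG : V.card ≤ tower G)
    (hx : s.reg rX ∈ V)
    (h : ∀ s', s'.reg rX = rt (s.reg rX) → (∀ q ∉ [rX, rXp, rXpp], s'.reg q = s.reg q) →
      (∀ f, f ≠ fPar → s'.field f = s.field f) →
      (∀ v ∉ V, s'.field fPar v = s.field fPar v) →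
      Forest V rt (s'.field fPar) (s'.field fRank) →
      s'.clk + 6 * potential G W V (s'.field fPar) (s'.field fRank) ≤
        s.clk + 6 * potential G W V (s.field fPar) (s.field fRank) + (6 * G + 8) → Q s') :
    find.wp Q s := by
  simp only [find, wp]
  refine ⟨fun s₁ => s₁.reg rX ∈ V ∧ rt (s₁.reg rX) = rt (s.reg rX) ∧
    s₁.reg rXp = s₁.field fPar (s₁.reg rX) ∧
    (∀ q ∉ [rX, rXp, rXpp], s₁.reg q = s.reg q) ∧
    (∀ f, f ≠ fPar → s₁.field f = s.field f) ∧
    (∀ v ∉ V, s₁.field fPar v = s.field fPar v) ∧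
    Forest V rt (s₁.field fPar) (s₁.field fRank) ∧
    s₁.clk + 6 * (potential G W V (s₁.field fPar) (s₁.field fRank) +
      (G - grade (s₁.field fRank (s₁.reg rX))) +
      (if s₁.reg rX = s₁.reg rXp then 0 else 1)) ≤
      s.clk + 6 * potential G W V (s.field fPar) (s.field fRank) + (6 * G + 7),
    s.clk + 6 * potential G W V (s.field fPar) (s.field fRank) + (6 * G + 7), ?_, ?_⟩
  · refine ⟨by simpa, by simp, by simp, fun q hq => ?_, fun f _ => rfl, fun v _ => rfl, hF, ?_⟩
    · simp at hq; simp [hq]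
    · simp only [Store.clk_set, Store.field_set]
      split_ifs <;> omega
  · rintro s₁ ⟨hV, hrt, hp, hreg, hfld, hout, hF₁, hclk⟩
    refine ⟨by omega, fun heq => ?_, fun hne => ?_⟩
    · refine h _ ?_ hreg hfld hout hF₁ ?_
      · rw [Store.reg_tick, ← hrt, hF₁.rt_eq_self _ hV (by rw [← hp, ← heq])]
      · rw [if_pos heq] at hclk
        simp only [Store.clk_tick, Store.field_tick]
        omega
    · have hpne : s₁.field fPar (s₁.reg rX) ≠ s₁.reg rX := by rw [← hp]; exact Ne.symm hne
      have hppV := hF₁.par_mem _ (hF₁.par_mem _ hV)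
      have hhalve := hF₁.halve hV hpne
      rw [if_neg hne] at hclk
      set par := s₁.field fPar with hpar
      set x := s₁.reg rX with hxdef
      have hfr : ∀ f, f ≠ fPar → ((((s₁.tick.set rXpp (par (par x))).put fPar x
          (par (par x))).set rX (par (par x))).set rXp
          (Function.update par x (par (par x)) (par (par x)))).tick.field f = s₁.field f := by
        intro f hf
        simp [hf]
      simp only [Store.reg_set, Store.reg_tick, Store.field_tick, Store.field_set, Store.reg_put,
        Store.field_put_self, hp, ← hpar, ← hxdef, Nat.reduceEqDiff,
        if_true, if_false]
      simp only [Store.clk_set, Store.clk_put, Store.clk_tick]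
      have hfr7 := hfr fRank (by simp)
      simp only [Store.field_tick, Store.field_set] at hfr7
      rw [hfr7]
      refine ⟨hppV, ?_, trivial, fun q hq => ?_, fun f hf => ?_, fun v hv => ?_, hhalve, ?_⟩
      · rw [hF₁.rt_par _ (hF₁.par_mem _ hV), hF₁.rt_par _ hV, hrt]
      · rw [← hreg q hq]
        simp at hq; simp [hq]
      · rw [← hfld f hf]; simp [hf]
      · rw [Function.update_of_ne (fun e => hv (by rw [e]; exact hV))]; exact hout v hv
      · by_cases hq : par (par x) = par x
        · have e : Function.update par x (par (par x)) = par := by rw [hq]; simp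
          rw [e, hq, hq, if_pos rfl]
          have := grade_mono (hF₁.rk_lt x hV hpne).le
          omega
        · have := hF₁.potential_halve (W := W) hG hV hpne hq
          split_ifs <;> omega

end Cmd

/-! ### Installed and pending edges -/

/-- The edges in `A` are either pending or installed. The installed edges form a folded graph on
the vertices `rt v`: `out x v` and `inn x v` are the installed edges with label `x` that start
or end at `v`, and `0` if there is none. -/
structure Slots (n : ℕ) (V : Finset ℕ) (src tgt lab rt : ℕ → ℕ) (A : Set ℕ)
    (out inn : ℕ → ℕ → ℕ) (pend : Set ℕ) : Prop where
  edge : ∀ e ∈ A, e ≠ 0 ∧ src e ∈ V ∧ tgt e ∈ V ∧ lab e < n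
  out_spec : ∀ x < n, ∀ v, out x v ≠ 0 → out x v ∈ A ∧ lab (out x v) = x ∧
    rt (src (out x v)) = v ∧ inn x (rt (tgt (out x v))) = out x v ∧ out x v ∉ pend
  inn_spec : ∀ x < n, ∀ v, inn x v ≠ 0 → inn x v ∈ A ∧ lab (inn x v) = x ∧
    rt (tgt (inn x v)) = v ∧ out x (rt (src (inn x v))) = inn x v ∧ inn x v ∉ pend
  pend_subset : pend ⊆ A
  cover : ∀ e ∈ A, e ∈ pend ∨
    (out (lab e) (rt (src e)) = e ∧ inn (lab e) (rt (tgt e)) = e)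

namespace Slots

variable {n : ℕ} {V : Finset ℕ} {src tgt lab rt : ℕ → ℕ} {A : Set ℕ} {out inn : ℕ → ℕ → ℕ}
  {pend : Set ℕ}

theorem swap (h : Slots n V src tgt lab rt A out inn pend) :
    Slots n V tgt src lab rt A inn out pend :=
  ⟨fun e he => ⟨(h.edge e he).1, (h.edge e he).2.2.1, (h.edge e he).2.1, (h.edge e he).2.2.2⟩,
    h.inn_spec, h.out_spec, h.pend_subset, fun e he => (h.cover e he).imp_right And.symm⟩

theorem pop (h : Slots n V src tgt lab rt A out inn pend) {e : ℕ} (he : e ∈ pend) :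
    Slots n V src tgt lab rt (A \ {e}) out inn (pend \ {e}) := by
  refine ⟨fun f hf => h.edge f hf.1, fun x hx v hv => ?_, fun x hx v hv => ?_,
    Set.sdiff_subset_sdiff_left h.pend_subset, fun f hf => ?_⟩
  · obtain ⟨h₁, h₂, h₃, h₄, h₅⟩ := h.out_spec x hx v hv
    exact ⟨⟨h₁, fun hh => h₅ (Set.mem_singleton_iff.1 hh ▸ he)⟩, h₂, h₃, h₄, fun hh => h₅ hh.1⟩
  · obtain ⟨h₁, h₂, h₃, h₄, h₅⟩ := h.inn_spec x hx v hv
    exact ⟨⟨h₁, fun hh => h₅ (Set.mem_singleton_iff.1 hh ▸ he)⟩, h₂, h₃, h₄, fun hh => h₅ hh.1⟩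
  · exact (h.cover f hf.1).imp_left fun hh => ⟨hh, hf.2⟩

theorem install (h : Slots n V src tgt lab rt A out inn pend) {e x u v : ℕ} (heA : e ∉ A)
    (he : e ≠ 0 ∧ src e ∈ V ∧ tgt e ∈ V ∧ lab e < n) (hx : lab e = x) (hu : rt (src e) = u)
    (hv : rt (tgt e) = v) (hou : out x u = 0) (hiv : inn x v = 0) {out' inn' : ℕ → ℕ → ℕ}
    (hout : ∀ y w, out' y w = if y = x ∧ w = u then e else out y w)
    (hinn : ∀ y w, inn' y w = if y = x ∧ w = v then e else inn y w) :
    Slots n V src tgt lab rt (insert e A) out' inn' pend := by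
  subst hx hu hv
  refine ⟨?_, fun y hy w hw => ?_, fun y hy w hw => ?_,
    h.pend_subset.trans (Set.subset_insert e A), ?_⟩
  · rintro f (rfl | hf)
    · exact he
    · exact h.edge f hf
  · rw [hout] at hw ⊢
    split_ifs at hw ⊢ with hc
    · obtain ⟨rfl, rfl⟩ := hc
      exact ⟨Set.mem_insert _ _, rfl, rfl, by simp [hinn], fun hp => heA (h.pend_subset hp)⟩
    · obtain ⟨h₁, h₂, h₃, h₄, h₅⟩ := h.out_spec y hy w hw
      refine ⟨Set.mem_insert_of_mem _ h₁, h₂, h₃, ?_, h₅⟩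
      rw [hinn, if_neg, h₄]
      rintro ⟨rfl, hc'⟩
      rw [hc', hiv] at h₄
      exact hw h₄.symm
  · rw [hinn] at hw ⊢
    split_ifs at hw ⊢ with hc
    · obtain ⟨rfl, rfl⟩ := hc
      exact ⟨Set.mem_insert _ _, rfl, rfl, by simp [hout], fun hp => heA (h.pend_subset hp)⟩
    · obtain ⟨h₁, h₂, h₃, h₄, h₅⟩ := h.inn_spec y hy w hw
      refine ⟨Set.mem_insert_of_mem _ h₁, h₂, h₃, ?_, h₅⟩
      rw [hout, if_neg, h₄]
      rintro ⟨rfl, hc'⟩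
      rw [hc', hou] at h₄
      exact hw h₄.symm
  · rintro f (rfl | hf)
    · exact Or.inr ⟨by simp [hout], by simp [hinn]⟩
    · refine (h.cover f hf).imp_right fun ⟨h₁, h₂⟩ => ?_
      have hf0 := (h.edge f hf).1
      rw [hout, hinn, if_neg, if_neg]
      · exact ⟨h₁, h₂⟩
      · rintro ⟨hl, hc⟩
        rw [hl, hc, hiv] at h₂
        exact hf0 h₂.symm
      · rintro ⟨hl, hc⟩
        rw [hl, hc, hou] at h₁
        exact hf0 h₁.symm

theorem detach (h : Slots n V src tgt lab rt A out inn pend) {x v f z : ℕ} (hx : x < n)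
    (hf : out x v = f) (hf0 : f ≠ 0) (hz : rt (tgt f) = z) {out' inn' : ℕ → ℕ → ℕ}
    (hout : ∀ y w, out' y w = if y = x ∧ w = v then 0 else out y w)
    (hinn : ∀ y w, inn' y w = if y = x ∧ w = z then 0 else inn y w) :
    Slots n V src tgt lab rt A out' inn' (insert f pend) := by
  obtain ⟨k₁, k₂, k₃, k₄, k₅⟩ := h.out_spec x hx v (by rwa [hf])
  subst hz
  rw [hf] at k₁ k₂ k₃ k₄ k₅
  refine ⟨h.edge, fun y hy w hw => ?_, fun y hy w hw => ?_, ?_, fun e he => ?_⟩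
  · rw [hout] at hw ⊢
    split_ifs at hw ⊢ with hc
    · exact absurd rfl hw
    · obtain ⟨h₁, h₂, h₃, h₄, h₅⟩ := h.out_spec y hy w hw
      have hne : out y w ≠ f := by
        rintro rfl
        exact hc ⟨h₂.symm.trans k₂, h₃.symm.trans k₃⟩
      refine ⟨h₁, h₂, h₃, ?_, ?_⟩
      · rw [hinn, if_neg, h₄]
        rintro ⟨rfl, hc'⟩
        rw [hc', k₄] at h₄
        exact hne h₄.symm
      · rintro (hc' | hc')
        · exact hne hc'
        · exact h₅ hc'
  · rw [hinn] at hw ⊢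
    split_ifs at hw ⊢ with hc
    · exact absurd rfl hw
    · obtain ⟨h₁, h₂, h₃, h₄, h₅⟩ := h.inn_spec y hy w hw
      have hne : inn y w ≠ f := by
        rintro rfl
        exact hc ⟨h₂.symm.trans k₂, h₃.symm⟩
      refine ⟨h₁, h₂, h₃, ?_, ?_⟩
      · rw [hout, if_neg, h₄]
        rintro ⟨rfl, hc'⟩
        rw [hc', hf] at h₄
        exact hne h₄.symm
      · rintro (hc' | hc')
        · exact hne hc'
        · exact h₅ hc'
  · exact Set.insert_subset k₁ h.pend_subset
  · by_cases hef : e = f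
    · exact Or.inl (Or.inl hef)
    · rcases h.cover e he with h₁ | ⟨h₁, h₂⟩
      · exact Or.inl (Or.inr h₁)
      · right
        rw [hout, hinn, if_neg, if_neg]
        · exact ⟨h₁, h₂⟩
        · rintro ⟨hl, hc⟩
          rw [hl, hc, k₄] at h₂
          exact hef h₂.symm
        · rintro ⟨hl, hc⟩
          rw [hl, hc, hf] at h₁
          exact hef h₁.symm

/-- Vertices without installed edges may be identified with other vertices. -/
theorem union (h : Slots n V src tgt lab rt A out inn pend) {l r : ℕ}
    (hl : ∀ x < n, out x l = 0 ∧ inn x l = 0) :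
    Slots n V src tgt lab (fun v => if rt v = l then r else rt v) A out inn pend := by
  have ho : ∀ x < n, ∀ v, out x v ≠ 0 → v ≠ l := fun x hx v hv e => hv (e ▸ (hl x hx).1)
  have hi : ∀ x < n, ∀ v, inn x v ≠ 0 → v ≠ l := fun x hx v hv e => hv (e ▸ (hl x hx).2)
  refine ⟨h.edge, fun x hx v hv => ?_, fun x hx v hv => ?_, h.pend_subset, fun e he => ?_⟩
  · obtain ⟨h₁, h₂, h₃, h₄, h₅⟩ := h.out_spec x hx v hv
    have h₆ := hi x hx _ (by rwa [h₄])
    rw [if_neg (by rw [h₃]; exact ho x hx v hv), if_neg h₆]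
    exact ⟨h₁, h₂, h₃, h₄, h₅⟩
  · obtain ⟨h₁, h₂, h₃, h₄, h₅⟩ := h.inn_spec x hx v hv
    have h₆ := ho x hx _ (by rwa [h₄])
    rw [if_neg (by rw [h₃]; exact hi x hx v hv), if_neg h₆]
    exact ⟨h₁, h₂, h₃, h₄, h₅⟩
  · refine (h.cover e he).imp_right fun ⟨h₁, h₂⟩ => ?_
    obtain ⟨h0, -, -, hn⟩ := h.edge e he
    rw [if_neg (ho _ hn _ (by rwa [h₁])), if_neg (hi _ hn _ (by rwa [h₂]))]
    exact ⟨h₁, h₂⟩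

end Slots

/-- The places `i` with `a ≤ i < b` of the field `q` contain the elements of `pend`, without
repetitions. -/
structure Queue (q : ℕ → ℕ) (a b : ℕ) (pend : Set ℕ) : Prop where
  le : a ≤ b
  mem : ∀ i, a ≤ i → i < b → q i ∈ pend
  exists_eq : ∀ e ∈ pend, ∃ i, a ≤ i ∧ i < b ∧ q i = e
  inj : ∀ i j, a ≤ i → i < b → a ≤ j → j < b → q i = q j → i = j

namespace Queue

variable {q : ℕ → ℕ} {a b : ℕ} {pend : Set ℕ}

theorem pop (h : Queue q a b pend) (hab : a ≠ b) : Queue q (a + 1) b (pend \ {q a}) := by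
  have hlt : a < b := lt_of_le_of_ne h.le hab
  refine ⟨hlt, fun i hi hb => ⟨h.mem i (by omega) hb, fun e => ?_⟩, fun e he => ?_,
    fun i j hi hib hj hjb => h.inj i j (by omega) hib (by omega) hjb⟩
  · have := h.inj i a (by omega) hb le_rfl hlt e
    omega
  · obtain ⟨i, h₁, h₂, h₃⟩ := h.exists_eq e he.1
    refine ⟨i, lt_of_le_of_ne h₁ ?_, h₂, h₃⟩
    rintro rfl
    exact he.2 h₃.symm

theorem push (h : Queue q a b pend) {e : ℕ} (he : e ∉ pend) :
    Queue (Function.update q b e) a (b + 1) (insert e pend) := by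
  have hlt : ∀ i, i < b → Function.update q b e i = q i := fun i hi =>
    Function.update_of_ne (by omega) _ _
  refine ⟨h.le.trans (Nat.le_succ b), fun i hi hb => ?_, ?_, fun i j hi hib hj hjb hij => ?_⟩
  · rcases Nat.lt_succ_iff_lt_or_eq.1 hb with h' | rfl
    · rw [hlt i h']; exact Set.mem_insert_of_mem _ (h.mem i hi h')
    · simp
  · rintro f (rfl | hf)
    · exact ⟨b, h.le, Nat.lt_succ_self b, by simp⟩
    · obtain ⟨i, h₁, h₂, h₃⟩ := h.exists_eq f hf
      exact ⟨i, h₁, by omega, by rw [hlt i h₂, h₃]⟩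
  · rcases Nat.lt_succ_iff_lt_or_eq.1 hib with h' | rfl <;>
      rcases Nat.lt_succ_iff_lt_or_eq.1 hjb with h'' | rfl
    · rw [hlt i h', hlt j h''] at hij
      exact h.inj i j hi h' hj h'' hij
    · rw [hlt i h', Function.update_self] at hij
      exact absurd (hij ▸ h.mem i hi h') he
    · rw [hlt j h'', Function.update_self] at hij
      exact absurd (hij ▸ h.mem j hj h'') he
    · rfl

end Queue

/-! ### Merging vertices -/

/-- At most the registers in `R` and, among the first `20` fields, those in `F` are changed. -/
structure Frame (R F : List ℕ) (s s' : Store) : Prop where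
  reg : ∀ q ∉ R, s'.reg q = s.reg q
  field : ∀ f ∉ F, f < 20 → s'.field f = s.field f

/-- The invariant of the folding program: a forest on the vertices, and slots and a queue for the
edges in `A`. The fields `S` and `T` contain the initial and terminal vertices, the families
`2 * x + o` and `2 * x + i` the slots for outgoing and incoming edges. -/
structure Work (n : ℕ) (V : Finset ℕ) (o i S T : ℕ) (rt : ℕ → ℕ) (A pend : Set ℕ) (s : Store) :
    Prop where
  forest : Forest V rt (s.field fPar) (s.field fRank)
  slots : Slots n V (s.field S) (s.field T) (s.field fLab) rt A (fun x => s.field (2 * x + o))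
    (fun x => s.field (2 * x + i)) pend
  queue : Queue (s.field fQueue) (s.reg rHead) (s.reg rTail) pend
  outside : ∀ v ∉ V, s.field fPar v ≠ v
  zero : s.reg rZero = 0

theorem Work.swap {n : ℕ} {V : Finset ℕ} {o i S T : ℕ} {rt : ℕ → ℕ} {A pend : Set ℕ} {s : Store}
    (h : Work n V o i S T rt A pend s) : Work n V i o T S rt A pend s :=
  ⟨h.forest, h.slots.swap, h.queue, h.outside, h.zero⟩

/-- The time that has passed, together with the potential of the forest and the queue. -/
def charge (G W : ℕ) (V : Finset ℕ) (a : ℕ) (s : Store) : ℕ :=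
  s.clk + 6 * potential G W V (s.field fPar) (s.field fRank) + a * s.reg rTail

namespace Cmd

theorem wp_find_work {n : ℕ} {V : Finset ℕ} {o i S T : ℕ} {rt : ℕ → ℕ} {A pend : Set ℕ} {G : ℕ}
    (W a : ℕ) {s : Store} {Q : Store → Prop} (hw : Work n V o i S T rt A pend s)
    (hST : S ≠ fPar ∧ T ≠ fPar) (hoi : 20 ≤ o ∧ 20 ≤ i)
    (hG : V.card ≤ tower G) (hx : s.reg rX ∈ V)
    (h : ∀ s', Work n V o i S T rt A pend s' → s'.reg rX = rt (s.reg rX) →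
      Frame [rX, rXp, rXpp] [fPar] s s' → (∀ f, f ≠ fPar → s'.field f = s.field f) →
      charge G W V a s' ≤ charge G W V a s + (6 * G + 8) → Q s') : find.wp Q s := by
  refine wp_find W hw.forest hG hx fun s' h₁ h₂ h₃ h₄ h₅ h₆ => h s' ?_ h₁
    ⟨h₂, fun f hf _ => h₃ f (by simpa using hf)⟩ h₃ ?_
  · refine ⟨h₅, ?_, ?_, fun v hv => by rw [h₄ v hv]; exact hw.outside v hv, ?_⟩
    · rw [h₃ S hST.1, h₃ T hST.2, h₃ fLab (by simp)]
      have e₁ : (fun x => s'.field (2 * x + o)) = fun x => s.field (2 * x + o) :=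
        funext fun x => h₃ _ (by omega)
      have e₂ : (fun x => s'.field (2 * x + i)) = fun x => s.field (2 * x + i) :=
        funext fun x => h₃ _ (by omega)
      rw [e₁, e₂]
      exact hw.slots
    · rw [h₃ fQueue (by simp), h₂ rHead (by simp), h₂ rTail (by simp)]
      exact hw.queue
    · rw [h₂ rZero (by simp)]; exact hw.zero
  · unfold charge
    rw [h₂ rTail (by simp)]
    omega

/-- If there is an edge with label `rI` in the slot family `o` at the vertex `rA`, remove it from
its two slots and append it to the queue. -/
def detachSlot (n o i T : ℕ) : Cmd :=
  loadAt n o rG rI rA ;;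
  ifEq rG rZero skip
    (load rX T rG ;; find ;; storeAt n o rI rA rZero ;; storeAt n i rI rX rZero ;;
      store fQueue rTail rG ;; succ rTail rTail)

theorem wp_detachSlot {n : ℕ} {V : Finset ℕ} {o i S T : ℕ} {rt : ℕ → ℕ} {A pend : Set ℕ} {G : ℕ}
    (W a : ℕ) {s : Store} {Q : Store → Prop} (hw : Work n V o i S T rt A pend s)
    (hST : S = fSrc ∧ T = fTgt ∨ S = fTgt ∧ T = fSrc)
    (hoi : o = fOut ∧ i = fInn ∨ o = fInn ∧ i = fOut)
    (hG : V.card ≤ tower G) (hx : s.reg rI < n)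
    (h : ∀ s' pend', Work n V o i S T rt A pend' s' →
      s'.field (2 * s.reg rI + o) (s.reg rA) = 0 →
      (∀ f v, 20 ≤ f → s.field f v = 0 → s'.field f v = 0) →
      Frame [rX, rXp, rXpp, rTmp, rTail, rG] [fPar, fQueue] s s' →
      charge G W V a s' ≤ charge G W V a s + (6 * G + 9 * n + 14 + a) → Q s') :
    (detachSlot n o i T).wp Q s := by
  simp only [detachSlot, wp]
  refine wp_loadAt hx (by simp) (by simp) fun s₁ hr₁ hf₁ hc₁ => ?_
  have hw₁ : Work n V o i S T rt A pend s₁ := by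
    refine ⟨by rw [hf₁]; exact hw.forest, by rw [hf₁]; exact hw.slots, ?_,
      by rw [hf₁]; exact hw.outside, ?_⟩
    · rw [hf₁, hr₁ rHead (by simp), hr₁ rTail (by simp)]; exact hw.queue
    · rw [hr₁ rZero (by simp)]; exact hw.zero
  have hG₁ : s₁.reg rG = s.field (2 * s.reg rI + o) (s.reg rA) := by
    rw [hr₁ rG (by simp), if_pos rfl]
  have hI₁ : s₁.reg rI = s.reg rI := by rw [hr₁ rI (by simp)]; simp
  have hA₁ : s₁.reg rA = s.reg rA := by rw [hr₁ rA (by simp)]; simp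
  have hT₁ : s₁.reg rTail = s.reg rTail := by rw [hr₁ rTail (by simp)]; simp
  refine ⟨fun hz => ?_, fun hz => ?_⟩
  · rw [hw₁.zero] at hz
    refine h _ pend ⟨hw₁.forest, hw₁.slots, hw₁.queue, hw₁.outside, hw₁.zero⟩ ?_ ?_ ?_ ?_
    · rw [Store.field_tick, hf₁, ← hG₁, hz]
    · intro f v _ hfv
      rw [Store.field_tick, hf₁, hfv]
    · refine ⟨fun q hq => ?_, fun f _ _ => by rw [Store.field_tick, hf₁]⟩
      simp only [List.mem_cons, not_or] at hq
      rw [Store.reg_tick, hr₁ q hq.2.2.2.1, if_neg hq.2.2.2.2.2.1]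
    · simp only [charge, Store.clk_tick, Store.field_tick, Store.reg_tick, hf₁, hT₁]
      omega
  · rw [hw₁.zero] at hz
    have hgspec := hw₁.slots.out_spec (s.reg rI) hx (s.reg rA)
      (by rwa [hf₁, ← hG₁])
    rw [hf₁, ← hG₁, ← hf₁] at hgspec
    obtain ⟨g₁, g₂, g₃, g₄, g₅⟩ := hgspec
    have hedge := hw₁.slots.edge _ g₁
    have hw₂ : Work n V o i S T rt A pend (s₁.tick.set rX (s₁.field T (s₁.reg rG))) :=
      ⟨hw₁.forest, hw₁.slots, by simpa using hw₁.queue, hw₁.outside, by simpa using hw₁.zero⟩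
    refine wp_find_work W a hw₂ (by omega) (by omega) hG (by simpa using hedge.2.2.1) ?_
    intro s₃ hw₃ hx₃ fr₃ hf₃ hc₃
    have hr₃ : ∀ q ∉ [rX, rXp, rXpp], s₃.reg q = s₁.reg q := fun q hq => by
      rw [fr₃.reg q hq]; simp at hq; simp [hq]
    have hX₃ : s₃.reg rX = rt (s₁.field T (s₁.reg rG)) := by simpa using hx₃
    refine wp_storeAt (by rw [hr₃ rI (by simp), hI₁]; exact hx) (by simp) (by simp) (by simp) ?_
    intro s₄ hr₄ hf₄ hc₄
    refine wp_storeAt (by rw [hr₄ rI (by simp), hr₃ rI (by simp), hI₁]; exact hx)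
      (by simp) (by simp) (by simp) ?_
    intro s₅ hr₅ hf₅ hc₅
    have e₀ : s₄.reg rZero = 0 := by rw [hr₄ rZero (by simp), hw₃.zero]
    rw [hr₃ rI (by simp), hI₁, hr₃ rA (by simp), hA₁, hw₃.zero] at hf₄
    rw [hr₄ rI (by simp), hr₃ rI (by simp), hI₁, hr₄ rX (by simp), hX₃, e₀] at hf₅
    have hr₅' : ∀ q ∉ [rX, rXp, rXpp, rTmp], s₅.reg q = s₁.reg q := fun q hq => by
      simp only [List.mem_cons, not_or] at hq
      rw [hr₅ q hq.2.2.2.1, hr₄ q hq.2.2.2.1, hr₃ q (by simp [hq])]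
    have hlow : ∀ f, f < 20 → s₅.field f = s₃.field f := fun f hf => by
      funext c
      rw [hf₅, if_neg (by omega), hf₄, if_neg (by omega)]
    have hlow' : ∀ f, f < 20 → f ≠ fPar → s₅.field f = s.field f := fun f hf hp => by
      rw [hlow f hf, hf₃ f hp]; simp [hf₁]
    have hhigh : ∀ f c, 20 ≤ f → s₃.field f c = s.field f c := fun f c hf => by
      rw [hf₃ f (by omega)]; simp [hf₁]
    refine h _ (insert (s₁.reg rG) pend) ⟨?_, ?_, ?_, ?_, ?_⟩ ?_ ?_ ⟨?_, ?_⟩ ?_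
    · simp only [Store.field_tick, Store.field_set]
      rw [Store.field_put_of_ne _ _ _ (by simp), Store.field_put_of_ne _ _ _ (by simp),
        hlow fPar (by simp), hlow fRank (by simp)]
      exact hw₃.forest
    · have hfq : ∀ f, f ≠ fQueue → (((s₅.put fQueue (s₅.reg rTail) (s₅.reg rG)).set rTail
          ((s₅.put fQueue (s₅.reg rTail) (s₅.reg rG)).reg rTail + 1)).tick).field f =
          s₅.field f := fun f hf => by simp [hf]
      rw [hfq S (by omega), hfq T (by omega), hfq fLab (by simp), hlow S (by omega),
        hlow T (by omega), hlow fLab (by simp)]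
      have hf0 : s₁.reg rG ≠ 0 := hz
      have hzz : rt (s₃.field T (s₁.reg rG)) = rt (s₁.field T (s₁.reg rG)) := by
        rw [hf₃ T (by omega)]; simp
      refine hw₃.slots.detach hx (v := s.reg rA) ?_ hf0 hzz (fun y w => ?_) (fun y w => ?_)
      · rw [hhigh _ _ (by omega), hG₁]
      · rw [hfq _ (by omega), hf₅, if_neg (by omega), hf₄]
        exact if_congr (by omega) rfl rfl
      · rw [hfq _ (by omega), hf₅, hf₄]
        have e₁ : ¬ (2 * y + i = 2 * s.reg rI + o ∧ w = s.reg rA) := by omega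
        rw [if_neg e₁]
        exact if_congr (by omega) rfl rfl
    · have := hw₃.queue.push g₅
      simp only [Store.field_tick, Store.field_set, Store.field_put_self, Store.reg_tick,
        Store.reg_set, Store.reg_put]
      rw [hr₅' rHead (by simp), hr₅' rTail (by simp), hr₅' rG (by simp), hlow fQueue (by simp)]
      rw [hr₃ rTail (by simp), hr₃ rHead (by simp)] at this
      simpa using this
    · intro v hv
      simp only [Store.field_tick, Store.field_set]
      rw [Store.field_put_of_ne _ _ _ (by simp), hlow fPar (by simp)]
      exact hw₃.outside v hv
    · simp only [Store.reg_tick, Store.reg_set, Store.reg_put]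
      rw [hr₅' rZero (by simp), hw₁.zero]
      simp
    · simp only [Store.field_tick, Store.field_set]
      rw [Store.field_put_of_ne _ _ _ (by omega), hf₅, if_neg (by omega), hf₄, if_pos ⟨rfl, rfl⟩]
    · intro f v hf hfv
      simp only [Store.field_tick, Store.field_set]
      rw [Store.field_put_of_ne _ _ _ (by omega), hf₅, hf₄, hhigh _ _ hf, hfv]
      simp
    · intro q hq
      simp only [List.mem_cons, not_or] at hq
      simp only [Store.reg_tick, Store.reg_set, Store.reg_put]
      rw [if_neg hq.2.2.2.2.1, hr₅' q (by simp [hq]), hr₁ q hq.2.2.2.1,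
        if_neg hq.2.2.2.2.2.1]
    · intro f hf hf'
      simp only [List.mem_cons, not_or] at hf
      simp only [Store.field_tick, Store.field_set]
      rw [Store.field_put_of_ne _ _ _ hf.2.1, hlow' f hf' hf.1]
    · unfold charge at hc₃ ⊢
      simp only [Store.field_tick, Store.field_set, Store.reg_tick, Store.reg_set, Store.reg_put,
        Store.clk_tick, Store.clk_set, Store.clk_put, if_true] at hc₃ ⊢
      rw [Store.field_put_of_ne _ _ _ (by simp), Store.field_put_of_ne _ _ _ (by simp),
        hlow fPar (by simp), hlow fRank (by simp), hr₅' rTail (by simp), hT₁, Nat.mul_add]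
      rw [hr₃ rTail (by simp), hT₁, hf₁, if_neg (by simp)] at hc₃
      omega

/-- Remove all installed edges at the vertex `rA` and append them to the queue. -/
def detach (n : ℕ) : Cmd :=
  const rI 0 ;; const rN n ;;
  untilEq rI rN (detachSlot n fOut fInn fTgt ;; detachSlot n fInn fOut fSrc ;; succ rI rI)

theorem wp_detach {n : ℕ} {V : Finset ℕ} {rt : ℕ → ℕ} {A pend : Set ℕ} {G : ℕ}
    (W a : ℕ) {s : Store} {Q : Store → Prop} (hw : Work n V fOut fInn fSrc fTgt rt A pend s)
    (hG : V.card ≤ tower G)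
    (h : ∀ s' pend', Work n V fOut fInn fSrc fTgt rt A pend' s' →
      (∀ x < n, s'.field (2 * x + fOut) (s.reg rA) = 0 ∧ s'.field (2 * x + fInn) (s.reg rA) = 0) →
      Frame [rX, rXp, rXpp, rTmp, rTail, rG, rI, rN] [fPar, fQueue] s s' →
      charge G W V a s' ≤
        charge G W V a s + (n * (2 * (6 * G + 9 * n + 14 + a) + 3) + 3) → Q s') :
    (detach n).wp Q s := by
  simp only [detach, wp]
  set D := 6 * G + 9 * n + 14 + a with hD
  refine ⟨fun s₁ => ∃ pend₁, Work n V fOut fInn fSrc fTgt rt A pend₁ s₁ ∧ s₁.reg rI ≤ n ∧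
    s₁.reg rN = n ∧
    (∀ x < s₁.reg rI, s₁.field (2 * x + fOut) (s.reg rA) = 0 ∧
      s₁.field (2 * x + fInn) (s.reg rA) = 0) ∧
    Frame [rX, rXp, rXpp, rTmp, rTail, rG, rI, rN] [fPar, fQueue] s s₁ ∧
    charge G W V a s₁ ≤ charge G W V a s + (s₁.reg rI * (2 * D + 3) + 2),
    charge G W V a s + (n * (2 * D + 3) + 2), ?_, ?_⟩
  · refine ⟨pend, ⟨hw.forest, hw.slots, by simpa using hw.queue, hw.outside,
      by simpa using hw.zero⟩, by simp, by simp, by simp, ⟨fun q hq => ?_, fun f _ _ => rfl⟩, ?_⟩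
    · simp at hq; simp [hq]
    · simp [charge]; omega
  · rintro s₁ ⟨pend₁, hw₁, hle, hN, hz₁, fr₁, hc₁⟩
    have hmul : s₁.reg rI * (2 * D + 3) ≤ n * (2 * D + 3) := Nat.mul_le_mul_right _ hle
    refine ⟨?_, fun heq => ?_, fun hne => ?_⟩
    · have : s₁.clk ≤ charge G W V a s₁ := by unfold charge; omega
      omega
    · rw [hN] at heq
      rw [heq] at hz₁ hc₁
      refine h _ pend₁ ⟨hw₁.forest, hw₁.slots, hw₁.queue, hw₁.outside, hw₁.zero⟩ hz₁
        ⟨fr₁.reg, fr₁.field⟩ ?_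
      have : charge G W V a s₁.tick = charge G W V a s₁ + 1 := by simp [charge]; omega
      omega
    · rw [hN] at hne
      have hlt : s₁.reg rI < n := lt_of_le_of_ne hle hne
      have hw₁' : Work n V fOut fInn fSrc fTgt rt A pend₁ s₁.tick :=
        ⟨hw₁.forest, hw₁.slots, hw₁.queue, hw₁.outside, hw₁.zero⟩
      refine wp_detachSlot W a hw₁' (by simp) (by simp) hG hlt ?_
      intro s₂ pend₂ hw₂ hz₂ hk₂ fr₂ hc₂
      have hI₂ : s₂.reg rI = s₁.reg rI := fr₂.reg rI (by simp)
      have hA₂ : s₂.reg rA = s.reg rA := (fr₂.reg rA (by simp)).trans (fr₁.reg rA (by simp))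
      refine wp_detachSlot W a hw₂.swap (by simp) (by simp) hG (by rw [hI₂]; exact hlt) ?_
      intro s₃ pend₃ hw₃ hz₃ hk₃ fr₃ hc₃
      have hw₃' := hw₃.swap
      have hI₃ : s₃.reg rI = s₁.reg rI := (fr₃.reg rI (by simp)).trans hI₂
      rw [hI₂, hA₂] at hz₃
      rw [Store.reg_tick, fr₁.reg rA (by simp)] at hz₂
      refine ⟨pend₃, ⟨hw₃'.forest, hw₃'.slots, by simpa using hw₃'.queue, hw₃'.outside,
        by simpa using hw₃'.zero⟩, ?_, ?_, ?_, ⟨fun q hq => ?_, fun f hf hf' => ?_⟩, ?_⟩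
      · simp [hI₃]; omega
      · simp only [Store.reg_tick, Store.reg_set]
        rw [if_neg (by simp), fr₃.reg rN (by simp), fr₂.reg rN (by simp)]
        exact hN
      · intro x hx
        simp only [Store.reg_tick, Store.reg_set, if_true, hI₃] at hx
        simp only [Store.field_tick, Store.field_set]
        rcases Nat.lt_succ_iff_lt_or_eq.1 hx with hx | rfl
        · have := hz₁ x hx
          exact ⟨hk₃ _ _ (by omega) (hk₂ _ _ (by omega) this.1),
            hk₃ _ _ (by omega) (hk₂ _ _ (by omega) this.2)⟩
        · exact ⟨hk₃ _ _ (by omega) hz₂, hz₃⟩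
      · have e : s₃.reg q = s₁.reg q := by
          simp only [List.mem_cons, not_or] at hq
          rw [fr₃.reg q (by simp [hq]), fr₂.reg q (by simp [hq]), Store.reg_tick]
        rw [← fr₁.reg q hq]
        simp only [List.mem_cons, not_or] at hq
        simp [hq, e]
      · simp only [Store.field_tick, Store.field_set]
        rw [fr₃.field f hf hf', fr₂.field f hf hf']
        exact fr₁.field f hf hf'
      · have e₁ : charge G W V a s₁.tick = charge G W V a s₁ + 1 := by simp [charge]; omega
        have e₂ : ∀ v, charge G W V a (s₃.set rI v).tick = charge G W V a s₃ + 2 := by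
          intro v; simp [charge]; omega
        rw [e₂]
        simp only [Store.reg_tick, Store.reg_set, if_true, hI₃]
        rw [Nat.add_mul]
        omega

end Cmd

theorem charge_tick (G W : ℕ) (V : Finset ℕ) (a : ℕ) (s : Store) :
    charge G W V a s.tick = charge G W V a s + 1 := by
  simp [charge]; omega

theorem charge_set (G W : ℕ) (V : Finset ℕ) (a : ℕ) (s : Store) {r v : ℕ} (hr : r ≠ rTail) :
    charge G W V a (s.set r v) = charge G W V a s + 1 := by
  simp [charge, hr.symm]; omega

theorem charge_put (G W : ℕ) (V : Finset ℕ) (a : ℕ) (s : Store) {f b v : ℕ} (h₁ : f ≠ fPar)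
    (h₂ : f ≠ fRank) : charge G W V a (s.put f b v) = charge G W V a s + 1 := by
  simp [charge, h₁.symm, h₂.symm]; omega

namespace Work

variable {n : ℕ} {V : Finset ℕ} {o i S T : ℕ} {rt : ℕ → ℕ} {A pend : Set ℕ} {s : Store}

theorem tick (h : Work n V o i S T rt A pend s) : Work n V o i S T rt A pend s.tick :=
  ⟨h.forest, h.slots, h.queue, h.outside, h.zero⟩

theorem set (h : Work n V o i S T rt A pend s) {r v : ℕ} (h₁ : r ≠ rHead) (h₂ : r ≠ rTail)
    (h₃ : r ≠ rZero) : Work n V o i S T rt A pend (s.set r v) :=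
  ⟨h.forest, h.slots, by simpa [h₁.symm, h₂.symm] using h.queue, h.outside,
    by simpa [h₃.symm] using h.zero⟩

end Work

/-- The classes of `rt'` arise from those of `rt` by uniting the classes of `a` and `b`. -/
def Merges (V : Finset ℕ) (rt rt' : ℕ → ℕ) (a b : ℕ) : Prop :=
  ∀ u ∈ V, ∀ w ∈ V, rt' u = rt' w ↔
    rt u = rt w ∨ (rt u = rt a ∧ rt w = rt b) ∨ (rt u = rt b ∧ rt w = rt a)

theorem Merges.symm {V : Finset ℕ} {rt rt' : ℕ → ℕ} {a b : ℕ} (h : Merges V rt rt' a b) :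
    Merges V rt rt' b a := fun u hu w hw => by rw [h u hu w hw]; tauto

namespace Cmd

/-- Make the root `rA` a child of the root `rB`. -/
def link (n : ℕ) : Cmd :=
  detach n ;; load rRankA fRank rA ;; load rRankB fRank rB ;;
  ifEq rRankA rRankB (succ rRankB rRankB ;; store fRank rB rRankB) skip ;;
  store fPar rA rB

theorem wp_link {n : ℕ} {V : Finset ℕ} {rt : ℕ → ℕ} {A pend : Set ℕ} {G W a : ℕ} {s : Store}
    {Q : Store → Prop} (hw : Work n V fOut fInn fSrc fTgt rt A pend s) (hG : V.card ≤ tower G)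
    (hW : n * (2 * (6 * G + 9 * n + 14 + a) + 3) + 20 ≤ 6 * W)
    (hA : s.reg rA ∈ V) (hB : s.reg rB ∈ V) (hrtA : rt (s.reg rA) = s.reg rA)
    (hrtB : rt (s.reg rB) = s.reg rB) (hne : s.reg rA ≠ s.reg rB)
    (hle : s.field fRank (s.reg rA) ≤ s.field fRank (s.reg rB))
    (h : ∀ s' pend', Work n V fOut fInn fSrc fTgt
        (fun x => if rt x = s.reg rA then s.reg rB else rt x) A pend' s' →
      Frame [rX, rXp, rXpp, rTmp, rTail, rG, rI, rN, rRankA, rRankB] [fPar, fQueue, fRank] s s' →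
      charge G W V a s' ≤ charge G W V a s → Q s') : (link n).wp Q s := by
  simp only [link, wp]
  refine wp_detach W a hw hG fun s₁ pend₁ hw₁ hz₁ fr₁ hc₁ => ?_
  have hA₁ : s₁.reg rA = s.reg rA := fr₁.reg rA (by simp)
  have hB₁ : s₁.reg rB = s.reg rB := fr₁.reg rB (by simp)
  have hR₁ : s₁.field fRank = s.field fRank := fr₁.field fRank (by simp) (by simp)
  have hpA : s₁.field fPar (s.reg rA) = s.reg rA := by
    have := hw₁.forest.par_rt _ hA; rwa [hrtA] at this
  have hpB : s₁.field fPar (s.reg rB) = s.reg rB := by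
    have := hw₁.forest.par_rt _ hB; rwa [hrtB] at this
  have key := fun rk' hrk => hw₁.forest.link (W := W) hA hB hne hpA hpB
    (by rw [hR₁]; exact hle) (rk' := rk') hrk hG
  have hslots := hw₁.slots.union (l := s.reg rA) (r := s.reg rB) hz₁
  have fin : ∀ s₂ : Store, (∀ q ∉ [rRankA, rRankB], s₂.reg q = s₁.reg q) →
      (∀ f ∉ [fPar, fRank], s₂.field f = s₁.field f) →
      s₂.field fPar = Function.update (s₁.field fPar) (s.reg rA) (s.reg rB) →
      s₂.field fRank = (if s₁.field fRank (s.reg rA) = s₁.field fRank (s.reg rB) then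
        Function.update (s₁.field fRank) (s.reg rB) (s₁.field fRank (s.reg rB) + 1)
        else s₁.field fRank) →
      s₂.clk ≤ s₁.clk + 10 → Q s₂ := by
    intro s₂ hr₂ hf₂ hp₂ hk₂ hc₂
    obtain ⟨k₁, k₂⟩ := key _ hk₂
    refine h s₂ pend₁ ⟨?_, ?_, ?_, fun v hv => ?_, ?_⟩ ⟨fun q hq => ?_, fun f hf hf' => ?_⟩ ?_
    · rw [hp₂]; exact k₁
    · rw [hf₂ fSrc (by simp), hf₂ fTgt (by simp), hf₂ fLab (by simp)]
      have e₁ : (fun x => s₂.field (2 * x + fOut)) = fun x => s₁.field (2 * x + fOut) :=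
        funext fun x => hf₂ _ (by simp only [List.mem_cons, List.not_mem_nil, or_false]; omega)
      have e₂ : (fun x => s₂.field (2 * x + fInn)) = fun x => s₁.field (2 * x + fInn) :=
        funext fun x => hf₂ _ (by simp only [List.mem_cons, List.not_mem_nil, or_false]; omega)
      rw [e₁, e₂]
      exact hslots
    · rw [hf₂ fQueue (by simp), hr₂ rHead (by simp), hr₂ rTail (by simp)]
      exact hw₁.queue
    · rw [hp₂, Function.update_of_ne (fun e => hv (by rw [e]; exact hA))]
      exact hw₁.outside v hv
    · rw [hr₂ rZero (by simp)]; exact hw₁.zero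
    · simp only [List.mem_cons, not_or] at hq
      rw [hr₂ q (by simp [hq]), fr₁.reg q (by simp [hq])]
    · simp only [List.mem_cons, not_or] at hf
      rw [hf₂ f (by simp [hf]), fr₁.field f (by simp [hf]) hf']
    · unfold charge at hc₁ ⊢
      rw [hp₂, hr₂ rTail (by simp)]
      omega
  refine ⟨fun heq => fin _ ?_ ?_ ?_ ?_ ?_, fun hneq => fin _ ?_ ?_ ?_ ?_ ?_⟩
  · intro q hq; simp at hq; simp [hq]
  · intro f hf; simp at hf; simp [hf]
  · simp [hA₁, hB₁]
  · simp [hA₁, hB₁] at heq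
    simp [hA₁, hB₁, heq]
  · simp
  · intro q hq; simp at hq; simp [hq]
  · intro f hf; simp at hf; simp [hf]
  · simp [hA₁, hB₁]
  · simp [hA₁, hB₁] at hneq
    simp [hneq]
  · simp

/-- Merge the vertices `rA` and `rB`. -/
def merge (n : ℕ) : Cmd :=
  copy rX rA ;; find ;; copy rA rX ;; copy rX rB ;; find ;; copy rB rX ;;
  ifEq rA rB skip
    (load rRankA fRank rA ;; load rRankB fRank rB ;;
      ifLt rRankB rRankA (copy rSwap rA ;; copy rA rB ;; copy rB rSwap) skip ;;
      link n)

theorem wp_merge {n : ℕ} {V : Finset ℕ} {rt : ℕ → ℕ} {A pend : Set ℕ} {G W a : ℕ} {s : Store}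
    {Q : Store → Prop} (hw : Work n V fOut fInn fSrc fTgt rt A pend s) (hG : V.card ≤ tower G)
    (hW : n * (2 * (6 * G + 9 * n + 14 + a) + 3) + 20 ≤ 6 * W)
    (hA : s.reg rA ∈ V) (hB : s.reg rB ∈ V)
    (h : ∀ s' rt' pend', Work n V fOut fInn fSrc fTgt rt' A pend' s' →
      Merges V rt rt' (s.reg rA) (s.reg rB) →
      Frame [rX, rXp, rXpp, rTmp, rTail, rG, rI, rN, rRankA, rRankB, rA, rB, rSwap]
        [fPar, fQueue, fRank] s s' →
      charge G W V a s' ≤ charge G W V a s + (12 * G + 40) → Q s') : (merge n).wp Q s := by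
  simp only [merge, wp]
  refine wp_find_work W a (hw.set (by simp) (by simp) (by simp)) (by simp) (by simp) hG
    (by simpa using hA) ?_
  intro s₁ hw₁ hx₁ fr₁ hf₁ hc₁
  have hx₁' : s₁.reg rX = rt (s.reg rA) := by simpa using hx₁
  have hB₁ : s₁.reg rB = s.reg rB := by rw [fr₁.reg rB (by simp)]; simp
  refine wp_find_work W a ((hw₁.set (by simp) (by simp) (by simp)).set (by simp) (by simp)
    (by simp)) (by simp) (by simp) hG (by simpa [hB₁] using hB) ?_
  intro s₂ hw₂ hx₂ fr₂ hf₂ hc₂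
  have hx₂' : s₂.reg rX = rt (s.reg rB) := by simpa [hB₁] using hx₂
  have hA₂ : s₂.reg rA = rt (s.reg rA) := by rw [fr₂.reg rA (by simp)]; simp [hx₁']
  rw [charge_set _ _ _ _ _ (by simp)] at hc₁
  rw [charge_set _ _ _ _ _ (by simp), charge_set _ _ _ _ _ (by simp)] at hc₂
  have frr : ∀ q ∉ [rX, rXp, rXpp, rA], s₂.reg q = s.reg q := by
    intro q hq
    simp only [List.mem_cons, not_or] at hq
    rw [fr₂.reg q (by simp [hq])]
    simp only [Store.reg_set, hq, if_false]
    rw [fr₁.reg q (by simp [hq])]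
    simp [hq]
  have frf : ∀ f ∉ [fPar], f < 20 → s₂.field f = s.field f := by
    intro f hf hf'
    rw [fr₂.field f hf hf', Store.field_set, Store.field_set, fr₁.field f hf hf', Store.field_set]
  have hAV := hw.forest.rt_mem _ hA
  have hBV := hw.forest.rt_mem _ hB
  refine ⟨fun heq => ?_, fun hne => ?_⟩
  · have heq' : rt (s.reg rA) = rt (s.reg rB) := by simpa [hA₂, hx₂'] using heq
    refine h _ rt pend (hw₂.set (by simp) (by simp) (by simp)).tick ?_ ⟨?_, ?_⟩ ?_
    · intro u _ w _
      rw [heq']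
      constructor
      · exact Or.inl
      · rintro (h | ⟨h, h'⟩ | ⟨h, h'⟩)
        · exact h
        · rw [h, h']
        · rw [h, h']
    · intro q hq
      simp only [List.mem_cons, not_or] at hq
      simp only [Store.reg_tick, Store.reg_set, hq, if_false]
      exact frr q (by simp [hq])
    · intro f hf hf'
      simp only [List.mem_cons, not_or] at hf
      exact frf f (by simp [hf]) hf'
    · rw [charge_tick, charge_set _ _ _ _ _ (by simp)]
      omega
  · have hne' : rt (s.reg rA) ≠ rt (s.reg rB) := by simpa [hA₂, hx₂'] using hne
    have fin : ∀ s₃ : Store, (∀ q ∉ [rA, rB, rSwap, rRankA, rRankB], s₃.reg q = s₂.reg q) →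
        s₃.field = s₂.field → s₃.clk ≤ s₂.clk + 8 →
        (s₃.reg rA = rt (s.reg rA) ∧ s₃.reg rB = rt (s.reg rB) ∨
          s₃.reg rA = rt (s.reg rB) ∧ s₃.reg rB = rt (s.reg rA)) →
        s₃.field fRank (s₃.reg rA) ≤ s₃.field fRank (s₃.reg rB) →
        (link n).wp (fun s' => Q s'.tick) s₃ := by
      intro s₃ hr₃ hf₃ hc₃ hAB hrk
      have hw₃ : Work n V fOut fInn fSrc fTgt rt A pend s₃ := by
        refine ⟨by rw [hf₃]; exact hw₂.forest, by rw [hf₃]; exact hw₂.slots, ?_,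
          by rw [hf₃]; exact hw₂.outside, ?_⟩
        · rw [hf₃, hr₃ rHead (by simp), hr₃ rTail (by simp)]; exact hw₂.queue
        · rw [hr₃ rZero (by simp)]; exact hw₂.zero
      have hrr := fun x hx => hw.forest.rt_rt (x := x) hx
      refine wp_link hw₃ hG hW ?_ ?_ ?_ ?_ ?_ hrk ?_
      · rcases hAB with ⟨e, -⟩ | ⟨e, -⟩ <;> rw [e] <;> assumption
      · rcases hAB with ⟨-, e⟩ | ⟨-, e⟩ <;> rw [e] <;> assumption
      · rcases hAB with ⟨e, -⟩ | ⟨e, -⟩ <;> rw [e] <;> apply hrr <;> assumption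
      · rcases hAB with ⟨-, e⟩ | ⟨-, e⟩ <;> rw [e] <;> apply hrr <;> assumption
      · rcases hAB with ⟨e, e'⟩ | ⟨e, e'⟩ <;> rw [e, e']
        · exact hne'
        · exact hne'.symm
      · intro s₄ pend₄ hw₄ fr₄ hc₄
        refine h _ _ pend₄ hw₄.tick ?_ ⟨?_, ?_⟩ ?_
        · have gen : ∀ a b l r, l = rt a → r = rt b → l ≠ r →
              Merges V rt (fun x => if rt x = l then r else rt x) a b := by
            rintro a b l r rfl rfl hlr u - w -
            dsimp only
            grind
          rcases hAB with ⟨e, e'⟩ | ⟨e, e'⟩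
          · exact gen _ _ _ _ e e' (by rw [e, e']; exact hne')
          · exact (gen _ _ _ _ e e' (by rw [e, e']; exact hne'.symm)).symm
        · intro q hq
          simp only [List.mem_cons, not_or] at hq
          rw [Store.reg_tick, fr₄.reg q (by simp [hq]), hr₃ q (by simp [hq]),
            frr q (by simp [hq])]
        · intro f hf hf'
          simp only [List.mem_cons, not_or] at hf
          rw [Store.field_tick, fr₄.field f (by simp [hf]) hf', hf₃, frf f (by simp [hf]) hf']
        · rw [charge_tick]
          have : charge G W V a s₃ ≤ charge G W V a s₂ + 8 := by
            unfold charge; rw [hf₃, hr₃ rTail (by simp)]; omega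
          omega
    refine ⟨fun hlt => fin _ ?_ ?_ ?_ ?_ ?_, fun hlt => fin _ ?_ ?_ ?_ ?_ ?_⟩
    · intro q hq; simp at hq; simp [hq]
    · simp
    · simp
    · right; simp [hA₂, hx₂']
    · simp at hlt; simpa using hlt.le
    · intro q hq; simp at hq; simp [hq]
    · simp
    · simp
    · left; simp [hA₂, hx₂']
    · simp at hlt; simpa using hlt

end Cmd

/-! ### The main loop -/

/-- The storage contains a description of the graph `Γ₀`, whose vertices and edges have the numbers
`vid` and `eid`, and of a sequence `L` of foldings of it. -/
structure Folding {n : ℕ} (Γ₀ : LGraph (Fin n)) (vid : Γ₀.V → ℕ) (eid name : Γ₀.E → ℕ)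
    (rt : ℕ → ℕ) (L : List (Γ₀.E × Γ₀.E)) (s : Store) : Prop where
  src : ∀ e, s.field fSrc (eid e) = vid (Γ₀.src e)
  tgt : ∀ e, s.field fTgt (eid e) = vid (Γ₀.tgt e)
  lab : ∀ e, s.field fLab (eid e) = Γ₀.label e
  name_eq : ∀ e, s.field fName (eid e) = name e
  alive : ∀ f, s.field fAlive f = 1 → ∃ e, eid e = f
  folds : Γ₀.FoldsTo (fun v => rt (vid v)) (fun e => s.field fAlive (eid e) = 1) L
  length_eq : s.reg 0 = L.length
  pairs : ∀ k (hk : k < L.length), s.field 1 k = name L[k].1 ∧ s.field 2 k = name L[k].2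

theorem Folding.frame {n : ℕ} {Γ₀ : LGraph (Fin n)} {vid : Γ₀.V → ℕ} {eid name : Γ₀.E → ℕ}
    {rt : ℕ → ℕ} {L : List (Γ₀.E × Γ₀.E)} {s s' : Store} (h : Folding Γ₀ vid eid name rt L s)
    (hr : s'.reg 0 = s.reg 0)
    (hf : ∀ f ∈ [1, 2, fSrc, fTgt, fLab, fName, fAlive], s'.field f = s.field f) :
    Folding Γ₀ vid eid name rt L s' := by
  constructor
  · rw [hf _ (by simp)]; exact h.src
  · rw [hf _ (by simp)]; exact h.tgt
  · rw [hf _ (by simp)]; exact h.lab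
  · rw [hf _ (by simp)]; exact h.name_eq
  · rw [hf _ (by simp)]; exact h.alive
  · rw [hf _ (by simp)]; exact h.folds
  · rw [hr]; exact h.length_eq
  · rw [hf _ (by simp), hf _ (by simp)]; exact h.pairs

theorem merges_merges {V : Finset ℕ} {rt rt₁ rt₂ : ℕ → ℕ} {a b c d : ℕ}
    (h₁ : Merges V rt rt₁ a b) (h₂ : Merges V rt₁ rt₂ c d) (hc : c ∈ V)
    (hd : d ∈ V) (h : rt a = rt b ∨ rt c = rt d) {u w : ℕ} (hu : u ∈ V) (hw : w ∈ V) :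
    rt₂ u = rt₂ w ↔ rt u = rt w ∨ (rt u = rt a ∧ rt w = rt b) ∨ (rt u = rt b ∧ rt w = rt a) ∨
      (rt u = rt c ∧ rt w = rt d) ∨ (rt u = rt d ∧ rt w = rt c) := by
  rcases h with h | h
  · have key : ∀ x ∈ V, ∀ y ∈ V, rt₁ x = rt₁ y ↔ rt x = rt y := by
      intro x hx y hy
      rw [h₁ x hx y hy]
      grind
    rw [h₂ u hu w hw, key u hu w hw, key u hu c hc, key w hw d hd, key u hu d hd, key w hw c hc]
    grind
  · have e : rt₁ c = rt₁ d := (h₁ c hc d hd).2 (Or.inl h)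
    have key : rt₂ u = rt₂ w ↔ rt₁ u = rt₁ w := by
      rw [h₂ u hu w hw]
      grind
    rw [key, h₁ u hu w hw]
    grind

namespace Cmd

/-- Fold the edge `rE` with the edge `rF`. -/
def fold (n : ℕ) : Cmd :=
  store fAlive rE rZero ;; load rName fName rE ;; store 1 0 rName ;;
  load rName fName rF ;; store 2 0 rName ;; succ 0 0 ;;
  load rA fSrc rE ;; load rB fSrc rF ;; merge n ;;
  load rA fTgt rE ;; load rB fTgt rF ;; merge n

theorem wp_fold {n : ℕ} {Γ₀ : LGraph (Fin n)} {vid : Γ₀.V → ℕ} {eid name : Γ₀.E → ℕ}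
    (heid : Function.Injective eid)
    {V : Finset ℕ} (hV : ∀ v, vid v ∈ V) {rt : ℕ → ℕ} {pend : Set ℕ} {L : List (Γ₀.E × Γ₀.E)}
    {G W a : ℕ} {s : Store} {Q : Store → Prop} {e f : Γ₀.E}
    (hw : Work n V fOut fInn fSrc fTgt rt ({g | s.field fAlive g = 1} \ {eid e}) pend s)
    (hfol : Folding Γ₀ vid eid name rt L s) (hG : V.card ≤ tower G)
    (hW : n * (2 * (6 * G + 9 * n + 14 + a) + 3) + 20 ≤ 6 * W)
    (hE : s.reg rE = eid e) (hF : s.reg rF = eid f) (hef : e ≠ f)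
    (he : s.field fAlive (eid e) = 1) (hf : s.field fAlive (eid f) = 1)
    (hlab : Γ₀.label e = Γ₀.label f)
    (hinc : rt (vid (Γ₀.src e)) = rt (vid (Γ₀.src f)) ∨
      rt (vid (Γ₀.tgt e)) = rt (vid (Γ₀.tgt f)))
    (h : ∀ s' rt' pend' L', Work n V fOut fInn fSrc fTgt rt' {g | s'.field fAlive g = 1} pend' s' →
      Folding Γ₀ vid eid name rt' L' s' → (∀ q ∈ [rOne, rPos, rHead], s'.reg q = s.reg q) →
      charge G W V a s' ≤ charge G W V a s + (24 * G + 100) → Q s') : (fold n).wp Q s := by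
  simp only [fold, wp]
  set s₁ : Store := (((((s.put fAlive (s.reg rE) (s.reg rZero)).set rName
    (s.field fName (s.reg rE))).put 1 (s.reg 0) (s.field fName (s.reg rE))).set rName
    (s.field fName (s.reg rF))).put 2 (s.reg 0) (s.field fName (s.reg rF))).set 0
    (s.reg 0 + 1) with hs₁
  have hgoal : (merge n).wp (fun s' => (merge n).wp Q
      ((s'.set rA (s'.field fTgt (s'.reg rE))).set rB (s'.field fTgt (s'.reg rF)))) ((s₁.set rA (vid (Γ₀.src e))).set rB (vid (Γ₀.src f))) := by
    have hfr : ∀ q ∉ [0, rName], s₁.reg q = s.reg q := by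
      intro q hq; simp at hq; simp [hs₁, hq]
    have hff : ∀ g ∉ [1, 2, fAlive], s₁.field g = s.field g := by
      intro g hg; simp at hg; simp [hs₁, hg]
    have hw₁ : Work n V fOut fInn fSrc fTgt rt ({g | s.field fAlive g = 1} \ {eid e}) pend s₁ := by
      refine ⟨?_, ?_, ?_, ?_, ?_⟩
      · rw [hff _ (by simp), hff _ (by simp)]; exact hw.forest
      · rw [hff _ (by simp), hff _ (by simp), hff _ (by simp)]
        have e₁ : (fun x => s₁.field (2 * x + fOut)) = fun x => s.field (2 * x + fOut) :=
          funext fun x => hff _ (by simp only [List.mem_cons, List.not_mem_nil, or_false]; omega)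
        have e₂ : (fun x => s₁.field (2 * x + fInn)) = fun x => s.field (2 * x + fInn) :=
          funext fun x => hff _ (by simp only [List.mem_cons, List.not_mem_nil, or_false]; omega)
        rw [e₁, e₂]
        exact hw.slots
      · rw [hff _ (by simp), hfr _ (by simp), hfr _ (by simp)]; exact hw.queue
      · rw [hff _ (by simp)]; exact hw.outside
      · rw [hfr _ (by simp)]; exact hw.zero
    have hc₁ : charge G W V a s₁ = charge G W V a s + 6 := by
      rw [hs₁, charge_set _ _ _ _ _ (by simp), charge_put _ _ _ _ _ (by simp) (by simp),
        charge_set _ _ _ _ _ (by simp), charge_put _ _ _ _ _ (by simp) (by simp),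
        charge_set _ _ _ _ _ (by simp), charge_put _ _ _ _ _ (by simp) (by simp)]
    refine wp_merge ((hw₁.set (by simp) (by simp) (by simp)).set (by simp) (by simp) (by simp))
      hG hW (by simpa using hV _) (by simpa using hV _) ?_
    intro s₂ rt₂ pend₂ hw₂ hm₂ fr₂ hc₂
    rw [charge_set _ _ _ _ _ (by simp), charge_set _ _ _ _ _ (by simp)] at hc₂
    simp only [Store.reg_set, if_true] at hm₂
    rw [if_neg (by simp)] at hm₂
    have hr₂ : ∀ q ∈ [0, rOne, rPos, rHead, rE, rF], s₂.reg q = s₁.reg q := by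
      intro q hq
      rw [fr₂.reg q (by fin_cases hq <;> simp)]
      fin_cases hq <;> simp
    have hf₂ : ∀ g ∈ [1, 2, fSrc, fTgt, fLab, fName, fAlive], s₂.field g = s₁.field g := by
      intro g hg
      rw [fr₂.field g (by fin_cases hg <;> simp) (by fin_cases hg <;> simp)]
      simp
    have hE₂ : s₂.reg rE = eid e := by rw [hr₂ _ (by simp), hfr _ (by simp), hE]
    have hF₂ : s₂.reg rF = eid f := by rw [hr₂ _ (by simp), hfr _ (by simp), hF]
    have hT₂ : s₂.field fTgt = s.field fTgt := by rw [hf₂ _ (by simp), hff _ (by simp)]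
    rw [hE₂, hF₂, hT₂, hfol.tgt, hfol.tgt]
    refine wp_merge ((hw₂.set (by simp) (by simp) (by simp)).set (by simp) (by simp) (by simp))
      hG hW (by simpa using hV _) (by simpa using hV _) ?_
    intro s₃ rt₃ pend₃ hw₃ hm₃ fr₃ hc₃
    rw [charge_set _ _ _ _ _ (by simp), charge_set _ _ _ _ _ (by simp)] at hc₃
    simp only [Store.reg_set, if_true] at hm₃
    rw [if_neg (by simp)] at hm₃
    have hr₃ : ∀ q ∈ [0, rOne, rPos, rHead], s₃.reg q = s₁.reg q := by
      intro q hq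
      rw [fr₃.reg q (by fin_cases hq <;> simp), ← hr₂ q (by fin_cases hq <;> simp)]
      fin_cases hq <;> simp
    have hf₃ : ∀ g ∈ [1, 2, fSrc, fTgt, fLab, fName, fAlive], s₃.field g = s₁.field g := by
      intro g hg
      rw [fr₃.field g (by fin_cases hg <;> simp) (by fin_cases hg <;> simp), ← hf₂ g hg]
      simp
    have hal : s₃.field fAlive = Function.update (s.field fAlive) (eid e) 0 := by
      rw [hf₃ _ (by simp)]; simp [hs₁, hE, hw.zero]
    have hA : {g | s.field fAlive g = 1} \ {eid e} = {g | s₃.field fAlive g = 1} := by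
      ext g
      rw [hal]
      by_cases hg : g = eid e
      · subst hg; simp
      · simp [hg]
    rw [hA] at hw₃
    refine h s₃ rt₃ pend₃ (L ++ [(e, f)]) hw₃ ⟨?_, ?_, ?_, ?_, ?_, ?_, ?_, ?_⟩ ?_ ?_
    · rw [hf₃ _ (by simp), hff _ (by simp)]; exact hfol.src
    · rw [hf₃ _ (by simp), hff _ (by simp)]; exact hfol.tgt
    · rw [hf₃ _ (by simp), hff _ (by simp)]; exact hfol.lab
    · rw [hf₃ _ (by simp), hff _ (by simp)]; exact hfol.name_eq
    · intro g hg
      rw [hal] at hg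
      by_cases hg' : g = eid e
      · exact ⟨e, hg'.symm⟩
      · rw [Function.update_of_ne hg'] at hg; exact hfol.alive g hg
    · refine hfol.folds.fold he hf hef hlab hinc
        (fun u w => merges_merges hm₂ hm₃ (hV _) (hV _) hinc (hV u) (hV w)) (fun g => ?_)
      rw [hal]
      by_cases hg : g = e
      · subst hg; simp
      · rw [Function.update_of_ne (fun hh => hg (heid hh))]; simp [hg]
    · rw [hr₃ _ (by simp)]; simp [hs₁, hfol.length_eq]
    · intro k hk
      have e₁ : s₃.field 1 = Function.update (s.field 1) L.length (name e) := by
        rw [hf₃ _ (by simp)]; simp [hs₁, hE, hfol.name_eq, hfol.length_eq]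
      have e₂ : s₃.field 2 = Function.update (s.field 2) L.length (name f) := by
        rw [hf₃ _ (by simp)]; simp [hs₁, hF, hfol.name_eq, hfol.length_eq]
      rw [e₁, e₂]
      by_cases hk' : k = L.length
      · subst hk'; simp
      · have hlt : k < L.length := by simp at hk; omega
        rw [Function.update_of_ne hk', Function.update_of_ne hk', List.getElem_append_left hlt]
        exact hfol.pairs k hlt
    · intro q hq
      rw [hr₃ q (List.mem_cons_of_mem _ hq), hfr q (by fin_cases hq <;> simp)]
    · omega
  have e₁ := hfol.src e
  have e₂ := hfol.src f
  rw [← hE] at e₁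
  rw [← hF] at e₂
  rw [← e₁, ← e₂] at hgoal
  simpa [hs₁] using hgoal

/-- Take an edge from the queue; install it, or fold it with an installed edge. -/
def process (n : ℕ) : Cmd :=
  load rE fQueue rHead ;; succ rHead rHead ;;
  load rX fSrc rE ;; find ;; copy rU rX ;;
  load rX fTgt rE ;; find ;; copy rV rX ;;
  load rLab fLab rE ;; loadAt n fOut rF rLab rU ;;
  ifEq rF rZero (loadAt n fInn rF rLab rV) skip ;;
  ifEq rF rZero (storeAt n fOut rLab rU rE ;; storeAt n fInn rLab rV rE) (fold n)

theorem wp_process {n : ℕ} {Γ₀ : LGraph (Fin n)} {vid : Γ₀.V → ℕ} {eid name : Γ₀.E → ℕ}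
    (heid : Function.Injective eid)
    {V : Finset ℕ} (hV : ∀ v, vid v ∈ V) {rt : ℕ → ℕ} {pend : Set ℕ} {L : List (Γ₀.E × Γ₀.E)}
    {G W a : ℕ} {s : Store} {Q : Store → Prop}
    (hw : Work n V fOut fInn fSrc fTgt rt {g | s.field fAlive g = 1} pend s)
    (hfol : Folding Γ₀ vid eid name rt L s) (hG : V.card ≤ tower G)
    (hW : n * (2 * (6 * G + 9 * n + 14 + a) + 3) + 20 ≤ 6 * W)
    (hne : s.reg rHead ≠ s.reg rTail)
    (h : ∀ s' rt' pend' L', Work n V fOut fInn fSrc fTgt rt' {g | s'.field fAlive g = 1} pend' s' →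
      Folding Γ₀ vid eid name rt' L' s' → (∀ q ∈ [rOne, rPos], s'.reg q = s.reg q) →
      s'.reg rHead = s.reg rHead + 1 →
      charge G W V a s' ≤ charge G W V a s + (36 * G + 12 * n + 140) → Q s') :
    (process n).wp Q s := by
  have hlt : s.reg rHead < s.reg rTail := lt_of_le_of_ne hw.queue.le hne
  have hmem := hw.queue.mem _ le_rfl hlt
  have halive : s.field fAlive (s.field fQueue (s.reg rHead)) = 1 := hw.slots.pend_subset hmem
  obtain ⟨e, he⟩ := hfol.alive _ halive
  have hedge := hw.slots.edge _ halive
  have hpop := hw.slots.pop hmem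
  have hqpop := hw.queue.pop hne
  rw [← he] at halive hpop hqpop hedge hmem
  simp only [process, wp]
  rw [← he]
  have hw₁ : Work n V fOut fInn fSrc fTgt rt ({g | s.field fAlive g = 1} \ {eid e})
      (pend \ {eid e}) ((s.set rE (eid e)).set rHead (s.reg rHead + 1)) :=
    ⟨hw.forest, hpop, by simpa using hqpop, hw.outside, by simpa using hw.zero⟩
  have hc₁ : charge G W V a ((s.set rE (eid e)).set rHead (s.reg rHead + 1)) =
      charge G W V a s + 2 := by
    rw [charge_set _ _ _ _ _ (by simp), charge_set _ _ _ _ _ (by simp)]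
  have hx₁ : ((s.set rE (eid e)).set rHead ((s.set rE (eid e)).reg rHead + 1)).field fSrc
      (((s.set rE (eid e)).set rHead ((s.set rE (eid e)).reg rHead + 1)).reg rE) =
      vid (Γ₀.src e) := by
    simp [hfol.src]
  have e₁ : (s.set rE (eid e)).reg rHead = s.reg rHead := by simp
  rw [hx₁, e₁]
  refine wp_find_work W a (hw₁.set (by simp) (by simp) (by simp)) (by simp) (by simp) hG
    (by simpa using hV _) ?_
  intro s₂ hw₂ hx₂ fr₂ hf₂ hc₂
  have hx₂' : s₂.reg rX = rt (vid (Γ₀.src e)) := by simpa using hx₂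
  have hr₂ : ∀ q ∉ [rX, rXp, rXpp, rE, rHead], s₂.reg q = s.reg q := by
    intro q hq
    simp only [List.mem_cons, not_or] at hq
    rw [fr₂.reg q (by simp [hq])]; simp [hq]
  have hE₂ : s₂.reg rE = eid e := by rw [fr₂.reg rE (by simp)]; simp
  have hH₂ : s₂.reg rHead = s.reg rHead + 1 := by rw [fr₂.reg rHead (by simp)]; simp
  have hT₂ : (s₂.set rU (s₂.reg rX)).field fTgt ((s₂.set rU (s₂.reg rX)).reg rE) =
      vid (Γ₀.tgt e) := by
    simp [hE₂, hf₂, hfol.tgt]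
  rw [hT₂]
  refine wp_find_work W a ((hw₂.set (by simp) (by simp) (by simp)).set (by simp) (by simp)
    (by simp)) (by simp) (by simp) hG (by simpa using hV _) ?_
  intro s₃ hw₃ hx₃ fr₃ hf₃ hc₃
  have hx₃' : s₃.reg rX = rt (vid (Γ₀.tgt e)) := by simpa using hx₃
  have hr₃ : ∀ q ∉ [rX, rXp, rXpp, rE, rHead, rU], s₃.reg q = s.reg q := by
    intro q hq
    simp only [List.mem_cons, not_or] at hq
    rw [fr₃.reg q (by simp [hq])]; simp [hq, hr₂]
  have hE₃ : s₃.reg rE = eid e := by rw [fr₃.reg rE (by simp)]; simp [hE₂]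
  have hH₃ : s₃.reg rHead = s.reg rHead + 1 := by rw [fr₃.reg rHead (by simp)]; simp [hH₂]
  have hU₃ : s₃.reg rU = rt (vid (Γ₀.src e)) := by rw [fr₃.reg rU (by simp)]; simp [hx₂']
  have hff₃ : ∀ f, f ≠ fPar → s₃.field f = s.field f := by
    intro f hf
    rw [hf₃ f hf, Store.field_set, Store.field_set, hf₂ f hf]; simp
  have hc₃' : charge G W V a s₃ ≤ charge G W V a s + (12 * G + 21) := by
    rw [charge_set _ _ _ _ _ (by simp)] at hc₂
    rw [charge_set _ _ _ _ _ (by simp), charge_set _ _ _ _ _ (by simp)] at hc₃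
    omega
  have hL₃ : (s₃.set rV (s₃.reg rX)).field fLab ((s₃.set rV (s₃.reg rX)).reg rE) =
      Γ₀.label e := by
    simp [hE₃, hff₃, hfol.lab]
  rw [hL₃, hx₃']
  have hlabn : (Γ₀.label e : ℕ) < n := (Γ₀.label e).2
  refine wp_loadAt (by simp) (by simp) (by simp) fun s₄ hr₄ hf₄ hc₄ => ?_
  have hF₄ : s₄.reg rF = s.field (2 * (Γ₀.label e : ℕ) + fOut) (rt (vid (Γ₀.src e))) := by
    rw [hr₄ _ (by simp), if_pos rfl]
    simp only [Store.field_set, Store.reg_set, if_true]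
    rw [if_neg (by simp), if_neg (by simp), hU₃, hff₃ _ (by omega)]
  have hr₄' : ∀ q ∉ [rX, rXp, rXpp, rE, rHead, rU, rV, rLab, rF, rTmp], s₄.reg q = s.reg q := by
    intro q hq
    simp only [List.mem_cons, not_or] at hq
    rw [hr₄ q (by simp [hq])]; simp [hq, hr₃]
  have hE₄ : s₄.reg rE = eid e := by rw [hr₄ _ (by simp)]; simp [hE₃]
  have hH₄ : s₄.reg rHead = s.reg rHead + 1 := by rw [hr₄ _ (by simp)]; simp [hH₃]
  have hU₄ : s₄.reg rU = rt (vid (Γ₀.src e)) := by rw [hr₄ _ (by simp)]; simp [hU₃]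
  have hV₄ : s₄.reg rV = rt (vid (Γ₀.tgt e)) := by rw [hr₄ _ (by simp)]; simp
  have hL₄ : s₄.reg rLab = Γ₀.label e := by rw [hr₄ _ (by simp)]; simp
  have hf₄' : s₄.field = s₃.field := by rw [hf₄]; simp
  have hZ₄ : s₄.reg rZero = 0 := by rw [hr₄' _ (by simp)]; exact hw.zero
  set x : ℕ := (Γ₀.label e).val with hx
  set u : ℕ := rt (vid (Γ₀.src e)) with hu
  set v : ℕ := rt (vid (Γ₀.tgt e)) with hv
  set D := (if s.field (2 * x + fOut) u = 0 then s.field (2 * x + fInn) v else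
    s.field (2 * x + fOut) u) with hD
  have key : ∀ s₅ : Store,
      (∀ q ∉ [rX, rXp, rXpp, rE, rHead, rU, rV, rLab, rF, rTmp], s₅.reg q = s.reg q) →
      s₅.reg rE = eid e → s₅.reg rHead = s.reg rHead + 1 → s₅.reg rU = u → s₅.reg rV = v →
      s₅.reg rLab = x → s₅.reg rF = D → s₅.field = s₃.field → s₅.clk ≤ s₃.clk + (6 * n + 4) →
      (ifEq rF rZero (storeAt n fOut rLab rU rE ;; storeAt n fInn rLab rV rE) (fold n)).wp
        Q s₅ := by
    intro s₅ hr₅ hE₅ hH₅ hU₅ hV₅ hL₅ hF₅ hf₅ hc₅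
    have hZ₅ : s₅.reg rZero = 0 := by rw [hr₅ _ (by simp)]; exact hw.zero
    have hff₅ : ∀ f, f ≠ fPar → s₅.field f = s.field f := fun f hf => by rw [hf₅, hff₃ f hf]
    have hw₅ : Work n V fOut fInn fSrc fTgt rt ({g | s.field fAlive g = 1} \ {eid e})
        (pend \ {eid e}) s₅ := by
      refine ⟨by rw [hf₅]; exact hw₃.forest, by rw [hf₅]; exact hw₃.slots, ?_,
        by rw [hf₅]; exact hw₃.outside, hZ₅⟩
      have := hw₃.queue
      rwa [hf₅, hH₅, hr₅ rTail (by simp), ← hH₃, ← hr₃ rTail (by simp)]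
    have hc₅' : charge G W V a s₅ ≤ charge G W V a s + (12 * G + 6 * n + 25) := by
      have : charge G W V a s₅ ≤ charge G W V a s₃ + (6 * n + 4) := by
        unfold charge
        rw [hf₅, hr₅ rTail (by simp), hr₃ rTail (by simp)]
        omega
      omega
    simp only [wp]
    refine ⟨fun hz => ?_, fun hz => ?_⟩
    · rw [hF₅, hZ₅] at hz
      have hz₁ : s.field (2 * x + fOut) u = 0 := by
        by_contra hcon
        rw [hD, if_neg hcon] at hz
        exact hcon hz
      have hz₂ : s.field (2 * x + fInn) v = 0 := by rwa [hD, if_pos hz₁] at hz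
      refine wp_storeAt (by rw [Store.reg_tick, hL₅]; exact hlabn) (by simp) (by simp) (by simp) ?_
      intro s₆ hr₆ hf₆ hc₆
      refine wp_storeAt (by rw [hr₆ _ (by simp), Store.reg_tick, hL₅]; exact hlabn)
        (by simp) (by simp) (by simp) ?_
      intro s₇ hr₇ hf₇ hc₇
      simp only [Store.reg_tick, Store.field_tick, hL₅, hU₅, hE₅] at hf₆ hr₆
      rw [hr₆ _ (by simp), hL₅, hr₆ _ (by simp), hV₅, hr₆ _ (by simp), hE₅] at hf₇
      have hr₇' : ∀ q, q ≠ rTmp → s₇.reg q = s₅.reg q := fun q hq => by rw [hr₇ q hq, hr₆ q hq]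
      have hf₇' : ∀ f, f < 20 → s₇.field f = s₅.field f := fun f hf => by
        funext c
        rw [hf₇, if_neg (by omega), hf₆, if_neg (by omega)]
      have hA : {g | s₇.field fAlive g = 1} =
          insert (eid e) ({g | s.field fAlive g = 1} \ {eid e}) := by
        rw [hf₇' _ (by simp), hff₅ _ (by simp), Set.insert_sdiff_singleton, Set.insert_eq_of_mem]
        exact halive
      refine h s₇ rt (pend \ {eid e}) L ?_ ?_ ?_ ?_ ?_
      · rw [hA]
        refine ⟨?_, ?_, ?_, ?_, ?_⟩
        · rw [hf₇' _ (by simp), hf₇' _ (by simp)]; exact hw₅.forest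
        · rw [hf₇' _ (by simp), hf₇' _ (by simp), hf₇' _ (by simp)]
          refine hw₅.slots.install (e := eid e) (x := x) (u := u) (v := v) (by simp)
            ?_ ?_ ?_ ?_ ?_ ?_ (fun y w => ?_) (fun y w => ?_)
          · rw [hff₅ _ (by simp), hff₅ _ (by simp), hff₅ _ (by simp)]; exact hedge
          · rw [hff₅ _ (by simp), hfol.lab]
          · rw [hff₅ _ (by simp), hfol.src]
          · rw [hff₅ _ (by simp), hfol.tgt]
          · rw [hff₅ _ (by omega)]; exact hz₁
          · rw [hff₅ _ (by omega)]; exact hz₂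
          · rw [hf₇, if_neg (by omega), hf₆]
            exact if_congr (by omega) rfl rfl
          · rw [hf₇, hf₆]
            have : ¬ (2 * y + fInn = 2 * x + fOut ∧ w = u) := by omega
            rw [if_neg this]
            exact if_congr (by omega) rfl rfl
        · rw [hf₇' _ (by simp), hr₇' _ (by simp), hr₇' _ (by simp)]; exact hw₅.queue
        · rw [hf₇' _ (by simp)]; exact hw₅.outside
        · rw [hr₇' _ (by simp)]; exact hZ₅
      · refine hfol.frame ?_ fun f hf => ?_
        · rw [hr₇' _ (by simp), hr₅ _ (by simp)]
        · rw [hf₇' _ (by fin_cases hf <;> simp), hff₅ _ (by fin_cases hf <;> simp)]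
      · intro q hq
        rw [hr₇' _ (by fin_cases hq <;> simp), hr₅ _ (by fin_cases hq <;> simp)]
      · rw [hr₇' _ (by simp), hH₅]
      · have : charge G W V a s₇ ≤ charge G W V a s₅ + (6 * n + 1) := by
          unfold charge
          rw [hf₇' _ (by simp), hf₇' _ (by simp), hr₇' _ (by simp)]
          simp only [Store.clk_tick] at hc₆
          omega
        omega
    · rw [hF₅, hZ₅] at hz
      have hspec : D ∈ {g | s.field fAlive g = 1} \ {eid e} ∧ s.field fLab D = x ∧
          (rt (s.field fSrc D) = u ∨ rt (s.field fTgt D) = v) := by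
        by_cases hz₁ : s.field (2 * x + fOut) u = 0
        · have hDv : D = s.field (2 * x + fInn) v := by rw [hD, if_pos hz₁]
          rw [hDv] at hz ⊢
          obtain ⟨k₁, k₂, k₃, -, -⟩ := hpop.inn_spec x hlabn v hz
          exact ⟨k₁, k₂, Or.inr k₃⟩
        · have hDv : D = s.field (2 * x + fOut) u := by rw [hD, if_neg hz₁]
          rw [hDv] at hz ⊢
          obtain ⟨k₁, k₂, k₃, -, -⟩ := hpop.out_spec x hlabn u hz
          exact ⟨k₁, k₂, Or.inl k₃⟩
      obtain ⟨⟨k₁, k₂⟩, k₃, k₄⟩ := hspec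
      obtain ⟨f, hf⟩ := hfol.alive _ k₁
      rw [← hf, hfol.src, hfol.tgt] at k₄
      rw [← hf, hfol.lab] at k₃
      have hfol₅ : Folding Γ₀ vid eid name rt L s₅ := by
        refine hfol.frame ?_ fun f hf => ?_
        · rw [hr₅ _ (by simp)]
        · rw [hff₅ _ (by fin_cases hf <;> simp)]
      have hal₅ : s₅.field fAlive = s.field fAlive := hff₅ _ (by simp)
      refine wp_fold (a := a) (W := W) (s := s₅.tick) (e := e) (f := f) heid hV
        (by rw [Store.field_tick, hal₅]; exact hw₅.tick)
        (hfol₅.frame rfl fun _ _ => rfl) hG hW hE₅ (hF₅.trans hf.symm) ?_ ?_ ?_ ?_ ?_ ?_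
      · rintro rfl
        exact k₂ hf.symm
      · rw [Store.field_tick, hal₅]; exact halive
      · rw [Store.field_tick, hal₅, hf]; exact k₁
      · exact Fin.ext k₃.symm
      · exact k₄.imp Eq.symm Eq.symm
      · intro s₆ rt₆ pend₆ L₆ hw₆ hfol₆ hr₆ hc₆
        rw [charge_tick] at hc₆
        refine h _ rt₆ pend₆ L₆ hw₆.tick (hfol₆.frame rfl fun _ _ => rfl) ?_ ?_ ?_
        · intro q hq
          rw [Store.reg_tick, hr₆ q (by fin_cases hq <;> simp), Store.reg_tick,
            hr₅ q (by fin_cases hq <;> simp)]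
        · rw [Store.reg_tick, hr₆ rHead (by simp), Store.reg_tick, hH₅]
        · rw [charge_tick]
          omega
  simp only [Store.clk_set] at hc₄
  refine ⟨fun hz => ?_, fun hz => ?_⟩
  · rw [hF₄, hZ₄] at hz
    refine wp_loadAt (by rw [Store.reg_tick, hL₄]; exact hlabn) (by simp) (by simp) ?_
    intro s₅ hr₅ hf₅ hc₅
    have hr₅' : ∀ q ∉ [rF, rTmp], s₅.reg q = s₄.reg q := by
      intro q hq
      simp only [List.mem_cons, not_or] at hq
      rw [hr₅ q (by simp [hq])]; simp [hq]
    refine key s₅ ?_ ?_ ?_ ?_ ?_ ?_ ?_ ?_ ?_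
    · intro q hq
      rw [← hr₄' q hq]
      simp only [List.mem_cons, not_or] at hq
      exact hr₅' q (by simp [hq])
    · rw [hr₅' _ (by simp), hE₄]
    · rw [hr₅' _ (by simp), hH₄]
    · rw [hr₅' _ (by simp), hU₄]
    · rw [hr₅' _ (by simp), hV₄]
    · rw [hr₅' _ (by simp), hL₄]
    · rw [hr₅ _ (by simp), if_pos rfl, hD, if_pos hz]
      simp only [Store.reg_tick, Store.field_tick]
      rw [hL₄, hV₄, hf₄', hff₃ _ (by omega)]
    · rw [hf₅, Store.field_tick, hf₄']
    · simp only [Store.clk_tick] at hc₅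
      omega
  · rw [hF₄, hZ₄] at hz
    refine key _ hr₄' hE₄ hH₄ hU₄ hV₄ hL₄ ?_ hf₄' ?_
    · rw [hD, if_neg hz]; exact hF₄
    · simp only [Store.clk_tick]
      omega

/-- Process edges until the queue is empty. -/
def foldAll (n : ℕ) : Cmd := untilEq rHead rTail (process n)

theorem wp_foldAll {n : ℕ} {Γ₀ : LGraph (Fin n)} {vid : Γ₀.V → ℕ} {eid name : Γ₀.E → ℕ}
    (heid : Function.Injective eid)
    {V : Finset ℕ} (hV : ∀ v, vid v ∈ V) {rt : ℕ → ℕ} {pend : Set ℕ} {L : List (Γ₀.E × Γ₀.E)}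
    {G W a : ℕ} {s : Store} {Q : Store → Prop}
    (hw : Work n V fOut fInn fSrc fTgt rt {g | s.field fAlive g = 1} pend s)
    (hfol : Folding Γ₀ vid eid name rt L s) (hG : V.card ≤ tower G)
    (ha : 36 * G + 12 * n + 142 ≤ a)
    (hW : n * (2 * (6 * G + 9 * n + 14 + a) + 3) + 20 ≤ 6 * W) (hhead : s.reg rHead = 0)
    (h : ∀ s' rt' L', Work n V fOut fInn fSrc fTgt rt' {g | s'.field fAlive g = 1} ∅ s' →
      Folding Γ₀ vid eid name rt' L' s' → (∀ q ∈ [rOne, rPos], s'.reg q = s.reg q) →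
      s'.clk + 6 * potential G W V (s'.field fPar) (s'.field fRank) ≤
        charge G W V a s + 1 → Q s') :
    (foldAll n).wp Q s := by
  simp only [foldAll, wp]
  refine ⟨fun s' => ∃ rt' pend' L',
    Work n V fOut fInn fSrc fTgt rt' {g | s'.field fAlive g = 1} pend' s' ∧
      Folding Γ₀ vid eid name rt' L' s' ∧ (∀ q ∈ [rOne, rPos], s'.reg q = s.reg q) ∧
      charge G W V a s' ≤ charge G W V a s + a * s'.reg rHead,
    charge G W V a s, ⟨rt, pend, L, hw, hfol, fun _ _ => rfl, by simp [hhead]⟩, ?_⟩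
  rintro s₁ ⟨rt₁, pend₁, L₁, hw₁, hfol₁, hr₁, hc₁⟩
  have hmul : a * s₁.reg rHead ≤ a * s₁.reg rTail := Nat.mul_le_mul_left a hw₁.queue.le
  refine ⟨?_, fun heq => ?_, fun hne => ?_⟩
  · unfold charge at hc₁ ⊢
    omega
  · have hpend : pend₁ = ∅ := by
      rw [Set.eq_empty_iff_forall_notMem]
      intro e he
      obtain ⟨i, h₁, h₂, -⟩ := hw₁.queue.exists_eq e he
      omega
    subst hpend
    refine h _ rt₁ L₁ hw₁.tick (hfol₁.frame rfl fun _ _ => rfl) hr₁ ?_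
    unfold charge at hc₁ ⊢
    simp only [Store.clk_tick, Store.field_tick]
    omega
  · refine wp_process (W := W) (a := a) (s := s₁.tick) heid hV hw₁.tick
      (hfol₁.frame rfl fun _ _ => rfl) hG hW hne ?_
    intro s₂ rt₂ pend₂ L₂ hw₂ hfol₂ hr₂ hh₂ hc₂
    refine ⟨rt₂, pend₂, L₂, hw₂.tick, hfol₂.frame rfl fun _ _ => rfl, fun q hq => ?_, ?_⟩
    · rw [Store.reg_tick, hr₂ q hq, Store.reg_tick, hr₁ q hq]
    · rw [charge_tick] at hc₂ ⊢
      rw [Store.reg_tick, hh₂, Store.reg_tick, Nat.mul_add]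
      omega

end Cmd

/-! ### Output -/

/-- The elements `v < i` with property `p` are numbered by `num` with the numbers `k < m`. -/
structure Numbers (p : ℕ → Prop) (num : ℕ → ℕ) (i m : ℕ) : Prop where
  lt : ∀ v < i, p v → num v < m
  inj : ∀ v < i, ∀ w < i, p v → p w → num v = num w → v = w
  surj : ∀ k < m, ∃ v < i, p v ∧ num v = k

namespace Numbers

variable {p : ℕ → Prop} {num : ℕ → ℕ} {i m : ℕ}

theorem zero (p : ℕ → Prop) (num : ℕ → ℕ) : Numbers p num 0 0 :=
  ⟨fun _ h => absurd h (Nat.not_lt_zero _), fun _ h => absurd h (Nat.not_lt_zero _),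
    fun _ h => absurd h (Nat.not_lt_zero _)⟩

theorem skip (h : Numbers p num i m) (hi : ¬ p i) : Numbers p num (i + 1) m := by
  have hlt : ∀ v, v < i + 1 → p v → v < i := fun v hv hp =>
    lt_of_le_of_ne (Nat.lt_succ_iff.1 hv) fun e => hi (e ▸ hp)
  refine ⟨fun v hv hp => h.lt v (hlt v hv hp) hp,
    fun v hv w hw hp hq => h.inj v (hlt v hv hp) w (hlt w hw hq) hp hq, fun k hk => ?_⟩
  obtain ⟨v, h₁, h₂⟩ := h.surj k hk
  exact ⟨v, by omega, h₂⟩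

theorem add (h : Numbers p num i m) (hi : p i) :
    Numbers p (Function.update num i m) (i + 1) (m + 1) := by
  have e : ∀ v, v < i → Function.update num i m v = num v := fun v hv =>
    Function.update_of_ne (by omega) _ _
  refine ⟨fun v hv hp => ?_, fun v hv w hw hp hq => ?_, fun k hk => ?_⟩
  · rcases Nat.lt_succ_iff_lt_or_eq.1 hv with hv | rfl
    · rw [e v hv]; exact (h.lt v hv hp).trans (Nat.lt_succ_self m)
    · simp
  · rcases Nat.lt_succ_iff_lt_or_eq.1 hv with hv | rfl <;>
      rcases Nat.lt_succ_iff_lt_or_eq.1 hw with hw | rfl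
    · rw [e v hv, e w hw]; exact h.inj v hv w hw hp hq
    · rw [e v hv, Function.update_self]
      intro hh
      exact absurd hh (h.lt v hv hp).ne
    · rw [e w hw, Function.update_self]
      intro hh
      exact absurd hh.symm (h.lt w hw hq).ne
    · simp
  · rcases Nat.lt_succ_iff_lt_or_eq.1 hk with hk | rfl
    · obtain ⟨v, h₁, h₂, h₃⟩ := h.surj k hk
      exact ⟨v, by omega, h₂, by rw [e v h₁, h₃]⟩
    · exact ⟨i, Nat.lt_succ_self i, hi, by simp⟩

end Numbers

namespace Cmd

/-- Number the roots among the vertices up to `rPos`. -/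
def numberVertices : Cmd :=
  const 1 0 ;; const rI 0 ;; succ rEnd rPos ;;
  untilEq rI rEnd (load rXp fPar rI ;; ifEq rXp rI (store fNum rI 1 ;; succ 1 1) skip ;;
    succ rI rI)

theorem wp_numberVertices {s : Store} {Q : Store → Prop}
    (h : ∀ s', Numbers (fun v => s.field fPar v = v) (s'.field fNum) (s.reg rPos + 1) (s'.reg 1) →
      s'.reg rEnd = s.reg rPos + 1 → (∀ q ∉ [1, rI, rEnd, rXp], s'.reg q = s.reg q) →
      (∀ f, f ≠ fNum → s'.field f = s.field f) → s'.clk ≤ s.clk + (8 * (s.reg rPos + 1) + 4) →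
      Q s') : numberVertices.wp Q s := by
  simp only [numberVertices, wp]
  refine ⟨fun s₁ => s₁.reg rI ≤ s.reg rPos + 1 ∧ s₁.reg rEnd = s.reg rPos + 1 ∧
    Numbers (fun v => s.field fPar v = v) (s₁.field fNum) (s₁.reg rI) (s₁.reg 1) ∧
    (∀ q ∉ [1, rI, rEnd, rXp], s₁.reg q = s.reg q) ∧
    (∀ f, f ≠ fNum → s₁.field f = s.field f) ∧
    s₁.clk ≤ s.clk + (8 * s₁.reg rI + 3), s.clk + (8 * (s.reg rPos + 1) + 3), ?_, ?_⟩
  · refine ⟨by simp, by simp, by simpa using Numbers.zero _ _, fun q hq => ?_, fun f _ => rfl,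
      by simp⟩
    simp at hq; simp [hq]
  · rintro s₁ ⟨hle, hend, hnum, hr, hf, hc⟩
    refine ⟨by omega, fun heq => ?_, fun hne => ⟨fun hroot => ?_, fun hroot => ?_⟩⟩
    · rw [heq, hend] at hnum hc
      refine h _ hnum hend hr hf ?_
      simp only [Store.clk_tick]; omega
    · have hroot' : s.field fPar (s₁.reg rI) = s₁.reg rI := by
        simpa [hf] using hroot
      refine ⟨?_, ?_, ?_, fun q hq => ?_, fun f hf' => ?_, ?_⟩
      · simp; omega
      · simpa using hend
      · simpa using hnum.add hroot'
      · rw [← hr q hq]; simp at hq; simp [hq]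
      · rw [← hf f hf']; simp [hf']
      · simp; omega
    · have hroot' : ¬ s.field fPar (s₁.reg rI) = s₁.reg rI := by
        simpa [hf] using hroot
      refine ⟨?_, ?_, ?_, fun q hq => ?_, fun f hf' => ?_, ?_⟩
      · simp; omega
      · simpa using hend
      · simpa using hnum.skip hroot'
      · rw [← hr q hq]; simp at hq; simp [hq]
      · rw [← hf f hf']; simp
      · simp; omega

/-- Write the edge `rI` to the output. -/
def writeEdge : Cmd :=
  load rX fSrc rI ;; find ;; load rF fNum rX ;; store 3 2 rF ;; load rF fLab rI ;; store 4 2 rF ;;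
  load rX fTgt rI ;; find ;; load rF fNum rX ;; store 5 2 rF ;; succ 2 2

theorem wp_writeEdge {V : Finset ℕ} {rt : ℕ → ℕ} {G : ℕ} (W : ℕ) {s : Store} {Q : Store → Prop}
    (hF : Forest V rt (s.field fPar) (s.field fRank)) (hG : V.card ≤ tower G)
    (hsrc : s.field fSrc (s.reg rI) ∈ V) (htgt : s.field fTgt (s.reg rI) ∈ V)
    (h : ∀ s', Forest V rt (s'.field fPar) (s'.field fRank) → s'.reg 2 = s.reg 2 + 1 →
      s'.field 3 = Function.update (s.field 3) (s.reg 2)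
        (s.field fNum (rt (s.field fSrc (s.reg rI)))) →
      s'.field 4 = Function.update (s.field 4) (s.reg 2) (s.field fLab (s.reg rI)) →
      s'.field 5 = Function.update (s.field 5) (s.reg 2)
        (s.field fNum (rt (s.field fTgt (s.reg rI)))) →
      (∀ q ∉ [2, rF, rX, rXp, rXpp], s'.reg q = s.reg q) →
      (∀ f ∉ [3, 4, 5, fPar], s'.field f = s.field f) →
      s'.clk + 6 * potential G W V (s'.field fPar) (s'.field fRank) ≤
        s.clk + 6 * potential G W V (s.field fPar) (s.field fRank) + (12 * G + 25) → Q s') :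
    writeEdge.wp Q s := by
  simp only [writeEdge, wp]
  refine wp_find W (s := s.set rX (s.field fSrc (s.reg rI))) hF hG (by simpa using hsrc) ?_
  intro s₁ hx₁ hr₁ hf₁ _ hF₁ hc₁
  have hx₁' : s₁.reg rX = rt (s.field fSrc (s.reg rI)) := by simpa using hx₁
  have hI₁ : s₁.reg rI = s.reg rI := by rw [hr₁ _ (by simp)]; simp
  have h2₁ : s₁.reg 2 = s.reg 2 := by rw [hr₁ _ (by simp)]; simp
  have hff₁ : ∀ f, f ≠ fPar → s₁.field f = s.field f := fun f hf => by rw [hf₁ f hf]; simp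
  set s₂ : Store := ((((s₁.set rF (s.field fNum (rt (s.field fSrc (s.reg rI))))).put 3 (s.reg 2)
    (s.field fNum (rt (s.field fSrc (s.reg rI))))).set rF (s.field fLab (s.reg rI))).put 4 (s.reg 2)
    (s.field fLab (s.reg rI))).set rX (s.field fTgt (s.reg rI)) with hs₂
  have hp₂ : s₂.field fPar = s₁.field fPar := by simp [hs₂]
  have hk₂ : s₂.field fRank = s₁.field fRank := by simp [hs₂]
  have goal : find.wp (fun s' => Q (((s'.set rF (s'.field fNum (s'.reg rX))).put 5 (s'.reg 2)
      (s'.field fNum (s'.reg rX))).set 2 (s'.reg 2 + 1))) s₂ := by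
    refine wp_find W (V := V) (rt := rt) (by rw [hp₂, hk₂]; exact hF₁) hG
      (by simpa [hs₂] using htgt) ?_
    intro s₃ hx₃ hr₃ hf₃ _ hF₃ hc₃
    have hx₃' : s₃.reg rX = rt (s.field fTgt (s.reg rI)) := by simpa [hs₂] using hx₃
    have h2₃ : s₃.reg 2 = s.reg 2 := by rw [hr₃ _ (by simp)]; simp [hs₂, h2₁]
    have hN₃ : s₃.field fNum = s.field fNum := by rw [hf₃ _ (by simp)]; simp [hs₂, hff₁]
    refine h _ ?_ ?_ ?_ ?_ ?_ ?_ ?_ ?_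
    · simpa using hF₃
    · simp [h2₃]
    · rw [Store.field_set, Store.field_put_of_ne _ _ _ (by simp), Store.field_set,
        hf₃ _ (by simp)]
      simp [hs₂, hff₁]
    · rw [Store.field_set, Store.field_put_of_ne _ _ _ (by simp), Store.field_set,
        hf₃ _ (by simp)]
      simp [hs₂, hff₁]
    · rw [Store.field_set, Store.field_put_self, Store.field_set,
        hf₃ _ (by simp), hN₃, hx₃', h2₃]
      simp [hs₂, hff₁]
    · intro q hq
      simp only [List.mem_cons, not_or] at hq
      simp only [Store.reg_set, Store.reg_put, hq, if_false]
      rw [hr₃ q (by simp [hq])]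
      simp only [hs₂, Store.reg_set, Store.reg_put, hq, if_false]
      rw [hr₁ q (by simp [hq])]
      simp [hq]
    · intro f hf
      simp only [List.mem_cons, not_or] at hf
      rw [Store.field_set, Store.field_put_of_ne _ _ _ (by simp [hf]), Store.field_set,
        hf₃ f (by simp [hf])]
      simp [hs₂, hf, hff₁]
    · rw [hp₂, hk₂] at hc₃
      simp only [hs₂, Store.clk_set, Store.clk_put, Store.field_set] at hc₃ hc₁ ⊢
      rw [Store.field_put_of_ne _ _ _ (by simp), Store.field_put_of_ne _ _ _ (by simp),
        Store.field_set]
      omega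
  simpa [hs₂, hx₁', hI₁, h2₁, hff₁] using goal

/-- Write the remaining edges to the output. -/
def numberEdges : Cmd :=
  const 2 0 ;; const rI 0 ;;
  untilEq rI rEnd (load rF fAlive rI ;; ifEq rF rOne writeEdge skip ;; succ rI rI)

theorem wp_numberEdges {V : Finset ℕ} {rt : ℕ → ℕ} {G : ℕ} (W : ℕ) {s : Store} {Q : Store → Prop}
    (hF : Forest V rt (s.field fPar) (s.field fRank)) (hG : V.card ≤ tower G)
    (hone : s.reg rOne = 1)
    (hV : ∀ e, s.field fAlive e = 1 → s.field fSrc e ∈ V ∧ s.field fTgt e ∈ V)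
    (h : ∀ s' idx, Numbers (fun e => s.field fAlive e = 1) idx (s.reg rEnd) (s'.reg 2) →
      (∀ e < s.reg rEnd, s.field fAlive e = 1 →
        s'.field 3 (idx e) = s.field fNum (rt (s.field fSrc e)) ∧
        s'.field 4 (idx e) = s.field fLab e ∧
        s'.field 5 (idx e) = s.field fNum (rt (s.field fTgt e))) →
      (∀ q ∉ [2, rF, rI, rX, rXp, rXpp], s'.reg q = s.reg q) →
      (∀ f ∉ [3, 4, 5, fPar], s'.field f = s.field f) →
      s'.clk ≤ s.clk + 6 * potential G W V (s.field fPar) (s.field fRank) +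
        (s.reg rEnd * (12 * G + 32) + 3) → Q s') : numberEdges.wp Q s := by
  simp only [numberEdges, wp]
  refine ⟨fun s₁ => s₁.reg rI ≤ s.reg rEnd ∧ Forest V rt (s₁.field fPar) (s₁.field fRank) ∧
    (∃ idx, Numbers (fun e => s.field fAlive e = 1) idx (s₁.reg rI) (s₁.reg 2) ∧
      ∀ e < s₁.reg rI, s.field fAlive e = 1 →
        s₁.field 3 (idx e) = s.field fNum (rt (s.field fSrc e)) ∧
        s₁.field 4 (idx e) = s.field fLab e ∧
        s₁.field 5 (idx e) = s.field fNum (rt (s.field fTgt e))) ∧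
      (∀ q ∉ [2, rF, rI, rX, rXp, rXpp], s₁.reg q = s.reg q) ∧
      (∀ f ∉ [3, 4, 5, fPar], s₁.field f = s.field f) ∧
      s₁.clk + 6 * potential G W V (s₁.field fPar) (s₁.field fRank) ≤
        s.clk + 6 * potential G W V (s.field fPar) (s.field fRank) +
        (s₁.reg rI * (12 * G + 32) + 2),
    s.clk + 6 * potential G W V (s.field fPar) (s.field fRank) +
        (s.reg rEnd * (12 * G + 32) + 2), ?_, ?_⟩
  · refine ⟨by simp, hF, ⟨id, by simpa using Numbers.zero _ _, by simp⟩, fun q hq => ?_,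
      fun f _ => rfl, ?_⟩
    · simp at hq; simp [hq]
    · simp; omega
  · rintro s₁ ⟨hle, hF₁, ⟨idx, hidx, hst⟩, hr, hf, hc⟩
    have hmul := Nat.mul_le_mul_right (12 * G + 32) hle
    have hend : s₁.reg rEnd = s.reg rEnd := hr _ (by simp)
    have hone₁ : s₁.reg rOne = 1 := by rw [hr _ (by simp), hone]
    have hal : s₁.field fAlive = s.field fAlive := hf _ (by simp)
    have hlt : ∀ e v, e < s₁.reg rI → s.field fAlive e = 1 →
        ∀ t : ℕ → ℕ, Function.update t (s₁.reg 2) v (idx e) = t (idx e) := fun e v he he' t =>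
      Function.update_of_ne (hidx.lt e he he').ne _ _
    refine ⟨by omega, fun heq => ?_, fun hne => ⟨fun halive => ?_, fun halive => ?_⟩⟩
    · rw [heq, hend] at hidx hst hc
      refine h _ idx hidx hst hr hf ?_
      simp only [Store.clk_tick]; omega
    · have halive' : s.field fAlive (s₁.reg rI) = 1 := by simpa [hal, hone₁] using halive
      have hVV := hV _ halive'
      refine wp_writeEdge W (V := V) (rt := rt) (by simpa using hF₁) hG ?_ ?_ ?_
      · simp only [Store.field_tick, Store.field_set, Store.reg_tick, Store.reg_set]
        rw [hf _ (by simp)]; simpa using hVV.1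
      · simp only [Store.field_tick, Store.field_set, Store.reg_tick, Store.reg_set]
        rw [hf _ (by simp)]; simpa using hVV.2
      · intro s₂ hF₂ h2₂ h3₂ h4₂ h5₂ hr₂ hf₂ hc₂
        simp only [Store.field_tick, Store.field_set, Store.reg_tick, Store.reg_set,
          Store.clk_tick, Store.clk_set] at h2₂ h3₂ h4₂ h5₂ hr₂ hf₂ hc₂
        simp only [Nat.reduceEqDiff, if_false] at h2₂ h3₂ h4₂ h5₂
        rw [hf fNum (by simp), hf fSrc (by simp)] at h3₂
        rw [hf fLab (by simp)] at h4₂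
        rw [hf fNum (by simp), hf fTgt (by simp)] at h5₂
        have hI₂ : s₂.reg rI = s₁.reg rI := by rw [hr₂ _ (by simp)]; simp
        refine ⟨?_, hF₂, ⟨Function.update idx (s₁.reg rI) (s₁.reg 2), ?_, ?_⟩, fun q hq => ?_,
          fun f hf' => ?_, ?_⟩
        · simp [hI₂]; omega
        · have := hidx.add halive'
          simpa [hI₂, h2₂] using this
        · intro e he he'
          simp only [Store.reg_tick, Store.reg_set, if_true, hI₂] at he
          simp only [Store.field_tick, Store.field_set, h3₂, h4₂, h5₂]
          rcases Nat.lt_succ_iff_lt_or_eq.1 he with he | rfl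
          · rw [Function.update_of_ne he.ne, hlt e _ he he', hlt e _ he he', hlt e _ he he']
            exact hst e he he'
          · simp
        · rw [← hr q hq]
          simp only [List.mem_cons, not_or] at hq
          simp only [Store.reg_tick, Store.reg_set, hq, if_false]
          rw [hr₂ q (by simp [hq])]
          simp [hq]
        · rw [← hf f hf', Store.field_tick, Store.field_set, hf₂ f hf']
        · simp only [Store.reg_tick, Store.reg_set, if_true, Store.clk_tick, Store.clk_set,
            Store.field_tick, Store.field_set, hI₂, Nat.add_mul]
          omega
    · have halive' : ¬ s.field fAlive (s₁.reg rI) = 1 := by simpa [hal, hone₁] using halive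
      refine ⟨?_, hF₁, ⟨idx, ?_, ?_⟩, fun q hq => ?_, fun f hf' => ?_, ?_⟩
      · simp; omega
      · simpa using hidx.skip halive'
      · intro e he he'
        simp only [Store.reg_tick, Store.reg_set, if_true] at he
        rcases Nat.lt_succ_iff_lt_or_eq.1 he with he | rfl
        · exact hst e (by simpa using he) he'
        · exact absurd he' (by simpa using halive')
      · rw [← hr q hq]
        simp at hq; simp [hq]
      · rw [← hf f hf']; simp
      · simp [Nat.add_mul]; omega

/-- Write the folded graph to the output. -/
def output : Cmd :=
  numberVertices ;; const rX 0 ;; find ;; load 3 fNum rX ;; numberEdges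

theorem wp_output {V : Finset ℕ} {rt : ℕ → ℕ} {G : ℕ} (W : ℕ) {s : Store} {Q : Store → Prop}
    (hF : Forest V rt (s.field fPar) (s.field fRank)) (hG : V.card ≤ tower G)
    (hone : s.reg rOne = 1) (h0 : 0 ∈ V)
    (hV : ∀ e, s.field fAlive e = 1 → s.field fSrc e ∈ V ∧ s.field fTgt e ∈ V)
    (h : ∀ s' num idx,
      Numbers (fun v => s.field fPar v = v) num (s.reg rPos + 1) (s'.reg 1) →
      Numbers (fun e => s.field fAlive e = 1) idx (s.reg rPos + 1) (s'.reg 2) →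
      s'.reg 3 = num (rt 0) →
      (∀ e < s.reg rPos + 1, s.field fAlive e = 1 →
        s'.field 3 (idx e) = num (rt (s.field fSrc e)) ∧
        s'.field 4 (idx e) = s.field fLab e ∧
        s'.field 5 (idx e) = num (rt (s.field fTgt e))) →
      s'.reg 0 = s.reg 0 → s'.field 1 = s.field 1 → s'.field 2 = s.field 2 →
      s'.clk ≤ s.clk + 6 * potential G W V (s.field fPar) (s.field fRank) +
        ((s.reg rPos + 1) * (18 * G + 60)) → Q s') : output.wp Q s := by
  simp only [output, wp]
  refine wp_numberVertices fun s₁ hn₁ he₁ hr₁ hf₁ hc₁ => ?_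
  have hP₁ : s₁.field fPar = s.field fPar := hf₁ _ (by simp)
  have hK₁ : s₁.field fRank = s.field fRank := hf₁ _ (by simp)
  refine wp_find W (V := V) (rt := rt) (by simpa [hP₁, hK₁] using hF) hG (by simpa using h0) ?_
  intro s₂ hx₂ hr₂ hf₂ _ hF₂ hc₂
  simp only [Store.field_set, Store.clk_set, hP₁, hK₁] at hc₂ hf₂
  have hx₂' : s₂.reg rX = rt 0 := by simpa using hx₂
  have hr₂' : ∀ q ∉ [rX, rXp, rXpp, 1, rI, rEnd], s₂.reg q = s.reg q := by
    intro q hq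
    simp only [List.mem_cons, not_or] at hq
    rw [hr₂ q (by simp [hq])]
    simp only [Store.reg_set, hq, if_false]
    exact hr₁ q (by simp [hq])
  have hf₂' : ∀ f ∉ [fNum, fPar], s₂.field f = s.field f := by
    intro f hf
    simp only [List.mem_cons, not_or] at hf
    rw [hf₂ f hf.2.1, hf₁ f hf.1]
  have hE₂ : s₂.reg rEnd = s.reg rPos + 1 := by rw [hr₂ _ (by simp)]; simp [he₁]
  have h1₂ : s₂.reg 1 = s₁.reg 1 := by rw [hr₂ _ (by simp)]; simp
  have hN₂ : s₂.field fNum = s₁.field fNum := hf₂ _ (by simp)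
  refine wp_numberEdges W (V := V) (rt := rt) (by simpa using hF₂) hG ?_ ?_ ?_
  · simp only [Store.reg_set]; rw [if_neg (by simp), hr₂' _ (by simp), hone]
  · simp only [Store.field_set]
    rw [hf₂' _ (by simp), hf₂' _ (by simp), hf₂' _ (by simp)]
    exact hV
  · intro s₃ idx hidx hst hr₃ hf₃ hc₃
    simp only [Store.field_set, Store.reg_set, Store.clk_set] at hidx hst hr₃ hf₃ hc₃
    simp only [Nat.reduceEqDiff, if_false, hE₂] at hidx hst hc₃
    rw [hf₂' fAlive (by simp)] at hidx hst
    rw [hf₂' fSrc (by simp), hf₂' fTgt (by simp), hf₂' fLab (by simp), hN₂] at hst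
    refine h s₃ (s₁.field fNum) idx ?_ hidx ?_ hst ?_ ?_ ?_ ?_
    · rw [hr₃ _ (by simp)]; simpa [h1₂] using hn₁
    · rw [hr₃ _ (by simp)]; simp [hx₂', hN₂]
    · rw [hr₃ _ (by simp)]; simp [hr₂']
    · rw [hf₃ _ (by simp), hf₂' _ (by simp)]
    · rw [hf₃ _ (by simp), hf₂' _ (by simp)]
    · have e₁ : (s.reg rPos + 1) * (18 * G + 60) =
          (s.reg rPos + 1) * (12 * G + 32) + 8 * (s.reg rPos + 1) +
          (s.reg rPos * (6 * G + 20) + (6 * G + 20)) := by ring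
      omega

end Cmd

/-! ### Reading the input -/

/-- The vertex reached after the letter at the place `p` of the string `S`. -/
def nextVertex (S : ℕ → ℕ) (p : ℕ) : ℕ := if 2 ≤ S p ∧ S (p + 1) ≠ 1 then p + 1 else 0

/-- The vertex reached before the letter at the place `p` of the string `S`. -/
def curVertex (S : ℕ → ℕ) : ℕ → ℕ
  | 0 => 0
  | p + 1 => nextVertex S p

/-- The first `p` letters of the string `S` have been read. -/
structure HasRead (n : ℕ) (S : ℕ → ℕ) (p : ℕ) (s : Store) : Prop where
  input : s.field 0 = S
  pos : s.reg rPos = p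
  cur : s.reg rCur = curVertex S p
  zero : s.reg rZero = 0
  one : s.reg rOne = 1
  head : s.reg rHead = 0
  count : s.reg 0 = 0
  par_zero : s.field fPar 0 = 0
  par_succ : ∀ i, s.field fPar (i + 1) = if i < p ∧ nextVertex S i = i + 1 then i + 1 else 0
  alive_zero : s.field fAlive 0 = 0
  alive_succ : ∀ i, s.field fAlive (i + 1) = if i < p ∧ 2 ≤ S i then 1 else 0
  name_eq : ∀ i < p, 2 ≤ S i → s.field fName (i + 1) = i
  edge : ∀ i < p, 2 ≤ S i → ∃ x < n, s.field fLab (i + 1) = x ∧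
    (S i = 2 * x + 2 ∧ s.field fSrc (i + 1) = curVertex S i ∧
        s.field fTgt (i + 1) = nextVertex S i ∨
      S i = 2 * x + 3 ∧ s.field fSrc (i + 1) = nextVertex S i ∧
        s.field fTgt (i + 1) = curVertex S i)
  queue : Queue (s.field fQueue) 0 (s.reg rTail) {e | s.field fAlive e = 1}
  tail_le : s.reg rTail ≤ p
  rank : ∀ v, s.field fRank v = 0
  slots : ∀ f v, 20 ≤ f → s.field f v = 0

namespace Cmd

/-- Decode the letter `rCode` into a label and an edge between `rCur` and `rNext`. -/
def decode : ℕ → Cmd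
  | 0 => skip
  | k + 1 =>
      const rTmp (2 * k + 2) ;;
      ifEq rCode rTmp (const rLab k ;; copy rSrc rCur ;; copy rTgt rNext)
        (const rTmp (2 * k + 3) ;;
          ifEq rCode rTmp (const rLab k ;; copy rSrc rNext ;; copy rTgt rCur) (decode k))

theorem wp_decode {k x : ℕ} {s : Store} {Q : Store → Prop} (hx : x < k)
    (hcode : s.reg rCode = 2 * x + 2 ∨ s.reg rCode = 2 * x + 3)
    (h : ∀ s', s'.reg rLab = x →
      (s.reg rCode = 2 * x + 2 ∧ s'.reg rSrc = s.reg rCur ∧ s'.reg rTgt = s.reg rNext ∨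
        s.reg rCode = 2 * x + 3 ∧ s'.reg rSrc = s.reg rNext ∧ s'.reg rTgt = s.reg rCur) →
      (∀ q ∉ [rTmp, rLab, rSrc, rTgt], s'.reg q = s.reg q) → s'.field = s.field →
      s'.clk ≤ s.clk + 8 * k → Q s') : (decode k).wp Q s := by
  induction k generalizing s Q with
  | zero => omega
  | succ k ih =>
    simp only [decode, wp]
    refine ⟨fun h₁ => h _ ?_ ?_ ?_ ?_ ?_, fun h₁ => ⟨fun h₂ => h _ ?_ ?_ ?_ ?_ ?_, fun h₂ => ?_⟩⟩
    · simp at h₁ ⊢; omega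
    · simp at h₁ ⊢; omega
    · intro q hq; simp at hq; simp [hq]
    · simp
    · simp; omega
    · simp at h₂ ⊢; omega
    · simp at h₂ ⊢; omega
    · intro q hq; simp at hq; simp [hq]
    · simp
    · simp; omega
    · simp at h₁ h₂
      refine ih (by omega) (by simpa using hcode) fun s' k₁ k₂ k₃ k₄ k₅ => h _ ?_ ?_ ?_ ?_ ?_
      · simpa using k₁
      · simpa using k₂
      · intro q hq
        rw [Store.reg_tick, Store.reg_tick, k₃ q hq]
        simp at hq; simp [hq]
      · simpa using k₄
      · simp at k₅ ⊢; omega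

/-- Read a letter and create the corresponding edge. -/
def readLetter (n : ℕ) : Cmd :=
  load rAhead 0 rId ;;
  ifEq rAhead rOne (const rNext 0) (copy rNext rId ;; store fPar rNext rNext) ;;
  decode n ;;
  store fSrc rId rSrc ;; store fTgt rId rTgt ;; store fLab rId rLab ;; store fName rId rPos ;;
  store fAlive rId rOne ;; store fQueue rTail rId ;; succ rTail rTail ;; copy rCur rNext

theorem wp_readLetter {n : ℕ} {S : ℕ → ℕ} {p x : ℕ} {s : Store} {Q : Store → Prop}
    (hs : HasRead n S p s) (hx : x < n) (hcode : s.reg rCode = S p)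
    (hS : S p = 2 * x + 2 ∨ S p = 2 * x + 3) (hid : s.reg rId = p + 1)
    (h : ∀ s', HasRead n S (p + 1) (s'.set rPos (p + 1)) → s'.reg rId = p + 1 →
      s'.clk ≤ s.clk + (8 * n + 20) → Q s') : (readLetter n).wp Q s := by
  have hS2 : 2 ≤ S p := by omega
  have key : ∀ s₁ : Store, s₁.reg rNext = nextVertex S p →
      (∀ q ∉ [rNext, rAhead], s₁.reg q = s.reg q) →
      (∀ f ∉ [fPar], s₁.field f = s.field f) → s₁.field fPar 0 = 0 →
      (∀ i, s₁.field fPar (i + 1) = if i < p + 1 ∧ nextVertex S i = i + 1 then i + 1 else 0) →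
      s₁.clk ≤ s.clk + 8 →
      (decode n ;;
        store fSrc rId rSrc ;; store fTgt rId rTgt ;; store fLab rId rLab ;;
        store fName rId rPos ;; store fAlive rId rOne ;; store fQueue rTail rId ;;
        succ rTail rTail ;; copy rCur rNext).wp Q s₁ := by
    intro s₁ hN₁ hr₁ hf₁ hp0 hps hc₁
    simp only [wp]
    have hcode₁ : s₁.reg rCode = S p := by rw [hr₁ _ (by simp), hcode]
    refine wp_decode hx (by rw [hcode₁]; exact hS) ?_
    intro s₂ hL₂ hST₂ hr₂ hf₂ hc₂
    rw [hcode₁, hN₁, hr₁ rCur (by simp), hs.cur] at hST₂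
    have hr₂' : ∀ q ∉ [rTmp, rLab, rSrc, rTgt, rNext, rAhead], s₂.reg q = s.reg q := by
      intro q hq
      simp only [List.mem_cons, not_or] at hq
      rw [hr₂ q (by simp [hq]), hr₁ q (by simp [hq])]
    have hN₂ : s₂.reg rNext = nextVertex S p := by rw [hr₂ _ (by simp), hN₁]
    have hId₂ : s₂.reg rId = p + 1 := by rw [hr₂' _ (by simp), hid]
    have hPos₂ : s₂.reg rPos = p := by rw [hr₂' _ (by simp), hs.pos]
    have hOne₂ : s₂.reg rOne = 1 := by rw [hr₂' _ (by simp), hs.one]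
    have hTail₂ : s₂.reg rTail = s.reg rTail := by rw [hr₂' _ (by simp)]
    have hff : ∀ f ∉ [fPar], s₂.field f = s.field f := fun f hf => by rw [hf₂, hf₁ f hf]
    set s₃ : Store := ((((((((s₂.put fSrc (p + 1) (s₂.reg rSrc)).put fTgt (p + 1) (s₂.reg rTgt)).put
      fLab (p + 1) x).put fName (p + 1) p).put fAlive (p + 1) 1).put fQueue (s.reg rTail)
      (p + 1)).set rTail (s.reg rTail + 1)).set rCur (nextVertex S p)) with hs₃
    have hfr : ∀ q ∉ [rTail, rCur], s₃.reg q = s₂.reg q := by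
      intro q hq; simp at hq; simp [hs₃, hq]
    have hfld : ∀ f ∉ [fSrc, fTgt, fLab, fName, fAlive, fQueue], s₃.field f = s₂.field f := by
      intro f hf; simp at hf; simp [hs₃, hf]
    have eS : s₃.field fSrc = Function.update (s.field fSrc) (p + 1) (s₂.reg rSrc) := by
      simp [hs₃, hff]
    have eT : s₃.field fTgt = Function.update (s.field fTgt) (p + 1) (s₂.reg rTgt) := by
      simp [hs₃, hff]
    have eL : s₃.field fLab = Function.update (s.field fLab) (p + 1) x := by
      simp [hs₃, hff]
    have eN : s₃.field fName = Function.update (s.field fName) (p + 1) p := by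
      simp [hs₃, hff]
    have eA : s₃.field fAlive = Function.update (s.field fAlive) (p + 1) 1 := by
      simp [hs₃, hff]
    have eQ : s₃.field fQueue = Function.update (s.field fQueue) (s.reg rTail) (p + 1) := by
      simp [hs₃, hff]
    have eA' : {e | s₃.field fAlive e = 1} = insert (p + 1) {e | s.field fAlive e = 1} := by
      ext e
      rw [eA]
      by_cases he : e = p + 1
      · subst he; simp
      · simp [he]
    have hnew : p + 1 ∉ {e | s.field fAlive e = 1} := by
      simp [hs.alive_succ]
    have fin : Q s₃ := by
      refine h s₃ ?_ ?_ ?_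
      · constructor <;> simp only [Store.field_set, Store.reg_set, if_true]
        · rw [hfld _ (by simp), hff _ (by simp)]; exact hs.input
        · simp [hs₃, curVertex]
        · rw [if_neg (by simp), hfr _ (by simp), hr₂' _ (by simp), hs.zero]
        · rw [if_neg (by simp), hfr _ (by simp), hOne₂]
        · rw [if_neg (by simp), hfr _ (by simp), hr₂' _ (by simp), hs.head]
        · rw [if_neg (by simp), hfr _ (by simp), hr₂' _ (by simp), hs.count]
        · rw [hfld _ (by simp), hf₂, hp0]
        · rw [hfld _ (by simp), hf₂]; exact hps
        · rw [eA]; simp [hs.alive_zero]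
        · intro i
          rw [eA]
          by_cases hi : i = p
          · subst hi; simp [hS2]
          · rw [Function.update_of_ne (by omega), hs.alive_succ]
            exact if_congr (by omega) rfl rfl
        · intro i hi h2
          rw [eN]
          by_cases hip : i = p
          · subst hip; simp
          · rw [Function.update_of_ne (by omega)]; exact hs.name_eq i (by omega) h2
        · intro i hi h2
          rw [eL, eS, eT]
          by_cases hip : i = p
          · subst hip
            simp only [Function.update_self]
            exact ⟨x, hx, rfl, hST₂⟩
          · rw [Function.update_of_ne (by omega), Function.update_of_ne (by omega),
              Function.update_of_ne (by omega)]
            exact hs.edge i (by omega) h2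
        · rw [eA', eQ]
          simpa [hs₃] using hs.queue.push hnew
        · have := hs.tail_le
          simp [hs₃]; omega
        · rw [hfld _ (by simp), hff _ (by simp)]; exact hs.rank
        · intro f v hf
          rw [hfld _ (by simp only [List.mem_cons, List.not_mem_nil, or_false]; omega),
            hff _ (by simp only [List.mem_cons, List.not_mem_nil, or_false]; omega)]
          exact hs.slots f v hf
      · rw [hfr _ (by simp), hId₂]
      · simp only [hs₃, Store.clk_set, Store.clk_put]
        omega
    simpa [hs₃, hId₂, hL₂, hPos₂, hOne₂, hTail₂, hN₂] using fin
  have hz : s.field 0 (s.reg rId) = S (p + 1) := by rw [hs.input, hid]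
  have hOne := hs.one
  have hpar : ∀ i, i ≠ p → s.field fPar (i + 1) =
      if i < p + 1 ∧ nextVertex S i = i + 1 then i + 1 else 0 := fun i hi => by
    rw [hs.par_succ]; exact if_congr (by omega) rfl rfl
  have hparp : s.field fPar (p + 1) = 0 := by rw [hs.par_succ]; simp
  rw [readLetter]
  simp only [wp] at key ⊢
  refine ⟨fun h₁ => key _ ?_ ?_ ?_ ?_ ?_ ?_, fun h₁ => key _ ?_ ?_ ?_ ?_ ?_ ?_⟩
  · simp [hz, hOne] at h₁
    simp [nextVertex, h₁]
  · intro q hq; simp at hq; simp [hq]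
  · simp
  · simpa using hs.par_zero
  · intro i
    simp [hz, hOne] at h₁
    by_cases hi : i = p
    · subst hi
      simp [nextVertex, h₁, hparp]
    · simpa using hpar i hi
  · simp
  · simp [hz, hOne] at h₁
    simp [nextVertex, h₁, hS2, hid]
  · intro q hq; simp at hq; simp [hq]
  · intro f hf; simp at hf; simp [hf]
  · simp [hid, hs.par_zero]
  · intro i
    simp [hz, hOne] at h₁
    by_cases hi : i = p
    · subst hi
      simp [nextVertex, h₁, hS2, hid]
    · simpa [hid, Function.update_apply, hi] using hpar i hi
  · simp

/-- Read the input. -/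
def read (n : ℕ) : Cmd :=
  const rOne 1 ;; load rCode 0 rPos ;;
  untilEq rCode rZero
    (succ rId rPos ;; ifEq rCode rOne skip (readLetter n) ;; copy rPos rId ;; load rCode 0 rPos)

theorem wp_read {n : ℕ} {S : ℕ → ℕ} {T : ℕ} {s : Store} {Q : Store → Prop}
    (hs : HasRead n S 0 (s.set rOne 1)) (hclk : s.clk = 0)
    (hT : S T = 0) (hlt : ∀ p < T, S p ≠ 0)
    (hS : ∀ p, 2 ≤ S p → ∃ x < n, S p = 2 * x + 2 ∨ S p = 2 * x + 3)
    (h : ∀ s', HasRead n S T s' → s'.clk ≤ T * (8 * n + 30) + 3 → Q s') : (read n).wp Q s := by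
  have hset : ∀ {p s r v}, HasRead n S p s → r ∉ [0, rZero, rOne, rPos, rHead, rTail, rCur] →
      HasRead n S p (s.set r v) := by
    intro p s r v hs hr
    simp only [List.mem_cons, not_or] at hr
    obtain ⟨h0, h1, h2, h3, h4, h5, h6, -⟩ := hr
    constructor <;> simp only [Store.field_set, Store.reg_set]
    · exact hs.input
    · rw [if_neg (Ne.symm h3)]; exact hs.pos
    · rw [if_neg (Ne.symm h6)]; exact hs.cur
    · rw [if_neg (Ne.symm h1)]; exact hs.zero
    · rw [if_neg (Ne.symm h2)]; exact hs.one
    · rw [if_neg (Ne.symm h4)]; exact hs.head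
    · rw [if_neg (Ne.symm h0)]; exact hs.count
    · exact hs.par_zero
    · exact hs.par_succ
    · exact hs.alive_zero
    · exact hs.alive_succ
    · exact hs.name_eq
    · exact hs.edge
    · rw [if_neg (Ne.symm h5)]; exact hs.queue
    · rw [if_neg (Ne.symm h5)]; exact hs.tail_le
    · exact hs.rank
    · exact hs.slots
  have htick : ∀ {p s}, HasRead n S p s → HasRead n S p s.tick := fun hs =>
    ⟨hs.input, hs.pos, hs.cur, hs.zero, hs.one, hs.head, hs.count, hs.par_zero, hs.par_succ,
      hs.alive_zero, hs.alive_succ, hs.name_eq, hs.edge, hs.queue, hs.tail_le, hs.rank, hs.slots⟩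
  simp only [read, wp]
  refine ⟨fun s₁ => ∃ p ≤ T, HasRead n S p s₁ ∧ s₁.reg rCode = S p ∧
    s₁.clk ≤ p * (8 * n + 30) + 2, T * (8 * n + 30) + 2, ?_, ?_⟩
  · refine ⟨0, Nat.zero_le _, hset hs (by simp), ?_, by simp [hclk]⟩
    simp only [Store.reg_set, if_true]
    rw [hs.input, ← hs.pos]
    simp
  · rintro s₁ ⟨p, hp, hs₁, hcode, hc⟩
    have hmul := Nat.mul_le_mul_right (8 * n + 30) hp
    refine ⟨by omega, fun heq => ?_, fun hne => ?_⟩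
    · rw [hcode, hs₁.zero] at heq
      have hpT : p = T := by
        by_contra hcon
        exact hlt p (lt_of_le_of_ne hp hcon) heq
      subst hpT
      exact h _ (htick hs₁) (by simp only [Store.clk_tick]; omega)
    · rw [hcode, hs₁.zero] at hne
      have hpT : p < T := by
        refine lt_of_le_of_ne hp ?_
        rintro rfl
        exact hne hT
      have hpos := hs₁.pos
      refine ⟨fun h1 => ?_, fun h1 => ?_⟩
      · have h1' : S p = 1 := by
          have := hs₁.one
          simp at h1
          omega
        have hnv : nextVertex S p = 0 := by simp [nextVertex, h1']
        refine ⟨p + 1, hpT, ?_, ?_, ?_⟩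
        · refine htick (hset ?_ (by simp))
          constructor <;> simp only [Store.field_set, Store.reg_set, Store.field_tick,
            Store.reg_tick, Nat.reduceEqDiff, if_true, if_false]
          · exact hs₁.input
          · rw [hpos]
          · rw [curVertex, hnv, hs₁.cur]
            rcases p with _ | p
            · rfl
            · simp [curVertex, nextVertex, h1']
          · exact hs₁.zero
          · exact hs₁.one
          · exact hs₁.head
          · exact hs₁.count
          · exact hs₁.par_zero
          · intro i
            rw [hs₁.par_succ]
            refine if_congr ⟨fun hh => ⟨by omega, hh.2⟩, fun hh => ⟨?_, hh.2⟩⟩ rfl rfl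
            have : i ≠ p := by rintro rfl; omega
            omega
          · exact hs₁.alive_zero
          · intro i
            rw [hs₁.alive_succ]
            refine if_congr ⟨fun hh => ⟨by omega, hh.2⟩, fun hh => ⟨?_, hh.2⟩⟩ rfl rfl
            have : i ≠ p := by rintro rfl; omega
            omega
          · intro i hi h2
            have : i ≠ p := by rintro rfl; omega
            exact hs₁.name_eq i (by omega) h2
          · intro i hi h2
            have : i ≠ p := by rintro rfl; omega
            exact hs₁.edge i (by omega) h2
          · exact hs₁.queue
          · exact hs₁.tail_le.trans (Nat.le_succ p)
          · exact hs₁.rank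
          · exact hs₁.slots
        · simp [hs₁.input, hpos]
        · simp [Nat.add_mul]; omega
      · have h1' : S p ≠ 1 := by
          intro h1'
          apply h1
          have := hs₁.one
          simp
          omega
        obtain ⟨x, hx, hSx⟩ := hS p (by omega)
        refine wp_readLetter (x := x) (p := p) (S := S) ?_ hx ?_ hSx ?_ ?_
        · exact htick (hset (htick hs₁) (by simp))
        · simpa using hcode
        · simp [hpos]
        · intro s₂ hs₂ hid hc₂
          refine ⟨p + 1, hpT, ?_, ?_, ?_⟩
          · refine htick (hset ?_ (by simp))
            rw [Store.reg_tick, hid]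
            exact ⟨hs₂.input, hs₂.pos, hs₂.cur, hs₂.zero, hs₂.one, hs₂.head, hs₂.count,
              hs₂.par_zero, hs₂.par_succ, hs₂.alive_zero, hs₂.alive_succ, hs₂.name_eq, hs₂.edge,
              hs₂.queue, hs₂.tail_le, hs₂.rank, hs₂.slots⟩
          · have := hs₂.input
            simp only [Store.field_set] at this
            simp [hid, this]
          · simp [Nat.add_mul] at hc₂ ⊢; omega

end Cmd

/-! ### The input string and the bouquet -/

variable {n : ℕ} {J : List (Word n)}

/-- The input string, as a function that is `0` from the end of the string on. -/
def inputFun (J : List (Word n)) (p : ℕ) : ℕ := (inputString J).getD p 0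

/-- The place where the `i`-th word starts. -/
def wordStart (J : List (Word n)) (i : ℕ) : ℕ := (inputString (J.take i)).length

theorem inputString_append (J K : List (Word n)) :
    inputString (J ++ K) = inputString J ++ inputString K := by
  simp [inputString]

theorem wordStart_succ (i : Fin J.length) :
    wordStart J (i + 1) = wordStart J i + (J.get i).length + 1 := by
  unfold wordStart
  rw [List.take_add_one, List.getElem?_eq_getElem i.2, inputString_append]
  simp [inputString, add_assoc]

theorem wordStart_mono (J : List (Word n)) : Monotone (wordStart J) := by
  refine monotone_nat_of_le_succ fun i => ?_
  by_cases hi : i < J.length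
  · have := wordStart_succ (J := J) ⟨i, hi⟩
    simp only at this
    omega
  · unfold wordStart
    rw [List.take_of_length_le (by omega), List.take_of_length_le (by omega)]

theorem inputString_eq (i : Fin J.length) : inputString J =
    inputString (J.take i) ++ (((J.get i).map letterCode ++ [1]) ++
      inputString (J.drop (i + 1))) := by
  have h : inputString (J.drop i) =
      ((J.get i).map letterCode ++ [1]) ++ inputString (J.drop (i + 1)) := by
    rw [List.drop_eq_getElem_cons i.2, inputString, List.flatMap_cons]
    rfl
  rw [← h, ← inputString_append, List.take_append_drop]

theorem inputFun_letter (i : Fin J.length) (k : Fin (J.get i).length) :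
    inputFun J (wordStart J i + k) = letterCode ((J.get i).get k) := by
  have hk := k.2
  rw [inputFun, inputString_eq i, wordStart, List.getD_eq_getElem?_getD,
    List.getElem?_append_right (by omega), Nat.add_sub_cancel_left,
    List.getElem?_append_left (by simp), List.getElem?_append_left (by simp)]
  simp

theorem inputFun_mark (i : Fin J.length) :
    inputFun J (wordStart J i + (J.get i).length) = 1 := by
  rw [inputFun, inputString_eq i, wordStart, List.getD_eq_getElem?_getD,
    List.getElem?_append_right (by omega), Nat.add_sub_cancel_left,
    List.getElem?_append_left (by simp), List.getElem?_append_right (by simp)]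
  simp

theorem exists_place {m p : ℕ} (hm : m ≤ J.length) (hp : p < wordStart J m) :
    ∃ (i : Fin J.length) (k : ℕ), k ≤ (J.get i).length ∧ p = wordStart J i + k := by
  induction m with
  | zero => simp [wordStart, inputString] at hp
  | succ m ih =>
    by_cases h : p < wordStart J m
    · exact ih (by omega) h
    · refine ⟨⟨m, hm⟩, p - wordStart J m, ?_, ?_⟩
      · have := wordStart_succ (J := J) ⟨m, hm⟩
        simp only at this
        omega
      · simp only; omega

theorem wordStart_length (J : List (Word n)) : wordStart J J.length = (inputString J).length := by
  rw [wordStart, List.take_length]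

theorem two_le_letterCode (a : Fin n × Bool) : 2 ≤ letterCode a := by
  unfold letterCode; split_ifs <;> omega

theorem inputFun_end (J : List (Word n)) : inputFun J (inputString J).length = 0 := by
  simp [inputFun]

theorem inputFun_ne_zero {p : ℕ} (hp : p < (inputString J).length) : inputFun J p ≠ 0 := by
  obtain ⟨i, k, hk, rfl⟩ := exists_place le_rfl (hp.trans_eq (wordStart_length J).symm)
  rcases hk.lt_or_eq with hk | rfl
  · rw [inputFun_letter i ⟨k, hk⟩]
    have := two_le_letterCode ((J.get i).get ⟨k, hk⟩)
    omega
  · rw [inputFun_mark]; omega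

theorem lt_length_of_two_le {p : ℕ} (h : 2 ≤ inputFun J p) : p < (inputString J).length := by
  by_contra hp
  rw [inputFun, List.getD_eq_default _ _ (by omega)] at h
  omega

theorem exists_edge {p : ℕ} (h : 2 ≤ inputFun J p) : ∃ e : BouquetEdge J, edgeName J e = p := by
  obtain ⟨i, k, hk, rfl⟩ := exists_place le_rfl
    ((lt_length_of_two_le h).trans_eq (wordStart_length J).symm)
  rcases hk.lt_or_eq with hk | rfl
  · exact ⟨⟨i, ⟨k, hk⟩⟩, rfl⟩
  · rw [inputFun_mark] at h; omega

theorem inputFun_edgeName (e : BouquetEdge J) :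
    inputFun J (edgeName J e) = letterCode ((J.get e.1).get e.2) := inputFun_letter e.1 e.2

theorem wordStart_add_inj {i j : Fin J.length} {k l : ℕ} (hk : k ≤ (J.get i).length)
    (hl : l ≤ (J.get j).length) (h : wordStart J i + k = wordStart J j + l) : i = j ∧ k = l := by
  have key : ∀ {i j : Fin J.length} {k l : ℕ}, k ≤ (J.get i).length →
      wordStart J i + k = wordStart J j + l → ¬ i < j := by
    intro i j k l hk h hij
    have h₁ := wordStart_mono J (show (i : ℕ) + 1 ≤ j from hij)
    rw [wordStart_succ] at h₁
    omega
  have hij : i = j := le_antisymm (not_lt.1 (key hl h.symm)) (not_lt.1 (key hk h))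
  subst hij
  exact ⟨rfl, by omega⟩

theorem edgeName_injective (J : List (Word n)) : Function.Injective (edgeName J) := by
  rintro ⟨i, k⟩ ⟨j, l⟩ h
  obtain ⟨rfl, h'⟩ := wordStart_add_inj (J := J) (i := i) (j := j) k.2.le l.2.le h
  rw [Fin.ext h']

/-- The number of a vertex of the bouquet. -/
def vertexId (J : List (Word n)) : BouquetVertex J → ℕ
  | none => 0
  | some v => wordStart J v.1 + v.2 + 1

theorem vertexId_injective (J : List (Word n)) : Function.Injective (vertexId J) := by
  rintro (_ | ⟨i, k⟩) (_ | ⟨j, l⟩) h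
  · rfl
  · simp [vertexId] at h
  · simp [vertexId] at h
  · simp only [vertexId] at h
    obtain ⟨rfl, h'⟩ := wordStart_add_inj (J := J) (i := i) (j := j) (k := k) (l := l)
      (by omega) (by omega) (by omega)
    rw [Fin.ext h']

theorem vertexId_loopVertex_zero (i : Fin J.length) : vertexId J (loopVertex J i 0) = 0 := by
  simp [loopVertex, vertexId]

theorem nextVertex_edge (i : Fin J.length) {k : ℕ} (hk : k < (J.get i).length) :
    nextVertex (inputFun J) (wordStart J i + k) = vertexId J (loopVertex J i (k + 1)) := by
  have h2 : 2 ≤ inputFun J (wordStart J i + k) := by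
    rw [inputFun_letter i ⟨k, hk⟩]; exact two_le_letterCode _
  unfold nextVertex loopVertex
  by_cases hk' : k + 1 < (J.get i).length
  · have h3 : inputFun J (wordStart J i + k + 1) ≠ 1 := by
      rw [add_assoc, inputFun_letter i ⟨k + 1, hk'⟩]
      have := two_le_letterCode ((J.get i).get ⟨k + 1, hk'⟩)
      omega
    rw [if_pos ⟨h2, h3⟩, dif_pos ⟨Nat.succ_pos k, hk'⟩]
    simp [vertexId]
  · have h3 : inputFun J (wordStart J i + k + 1) = 1 := by
      rw [add_assoc, show k + 1 = (J.get i).length by omega, inputFun_mark]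
    rw [if_neg (fun h => h.2 h3), dif_neg (fun h => hk' h.2)]
    rfl

theorem curVertex_edge (i : Fin J.length) {k : ℕ} (hk : k < (J.get i).length) :
    curVertex (inputFun J) (wordStart J i + k) = vertexId J (loopVertex J i k) := by
  rcases k with _ | k
  · rw [vertexId_loopVertex_zero, add_zero]
    obtain ⟨i, hi⟩ := i
    rcases i with _ | i
    · simp [wordStart, inputString, curVertex]
    · have h := wordStart_succ (J := J) ⟨i, by omega⟩
      have h1 := inputFun_mark (J := J) ⟨i, by omega⟩
      simp only at h h1 ⊢
      rw [h, curVertex, nextVertex, if_neg]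
      rw [h1]; omega
  · rw [← add_assoc, curVertex, nextVertex_edge i (by omega)]

theorem exists_vertexId_eq {p : ℕ} (h : nextVertex (inputFun J) p = p + 1) :
    ∃ v, vertexId J v = p + 1 := by
  have h2 : 2 ≤ inputFun J p := by
    unfold nextVertex at h
    split_ifs at h with h'
    omega
  obtain ⟨⟨i, k⟩, rfl⟩ := exists_edge h2
  exact ⟨loopVertex J i (k + 1), by rw [← nextVertex_edge i k.2]; exact h⟩

theorem nextVertex_of_vertexId (v : (i : Fin J.length) × Fin ((J.get i).length - 1)) :
    ∃ p < (inputString J).length, vertexId J (some v) = p + 1 ∧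
      nextVertex (inputFun J) p = p + 1 := by
  obtain ⟨i, k, hk⟩ := v
  have hk' : k < (J.get i).length := by omega
  refine ⟨wordStart J i + k, ?_, rfl, ?_⟩
  · have h₁ := wordStart_mono J (show (i : ℕ) + 1 ≤ J.length from i.2)
    rw [wordStart_succ, wordStart_length] at h₁
    omega
  · rw [nextVertex_edge i hk', loopVertex, dif_pos ⟨Nat.succ_pos k, by omega⟩]
    simp [vertexId]

/-! ### Size of the input -/

theorem totalLength_eq_sum (J : List (Word n)) :
    totalLength J = ∑ i : Fin J.length, (J.get i).length := by
  rw [totalLength, ← Fin.sum_univ_fun_getElem]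
  rfl

theorem length_inputString (J : List (Word n)) :
    (inputString J).length = totalLength J + J.length := by
  induction J with
  | nil => simp [inputString, totalLength]
  | cons w J ih =>
    have : inputString (w :: J) = (w.map letterCode ++ [1]) ++ inputString J := by
      simp [inputString]
    rw [this, List.length_append, ih]
    simp [totalLength]
    omega

theorem length_le_totalLength (h : ∀ w ∈ J, w ≠ []) : J.length ≤ totalLength J := by
  induction J with
  | nil => simp
  | cons w J ih =>
    have h₁ := ih fun v hv => h v (List.mem_cons_of_mem _ hv)
    have h₂ := List.length_pos_iff.2 (h w List.mem_cons_self)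
    simp only [totalLength, List.map_cons, List.sum_cons, List.length_cons] at h₁ ⊢
    omega

theorem card_bouquetVertex_le (h : ∀ w ∈ J, w ≠ []) (hN : 2 ≤ totalLength J) :
    Fintype.card (BouquetVertex J) ≤ totalLength J := by
  rw [Fintype.card_option, Fintype.card_sigma, totalLength_eq_sum]
  have hne : 0 < J.length := by
    rw [List.length_pos_iff]; rintro rfl; simp [totalLength] at hN
  have hpos : ∀ i : Fin J.length, 0 < (J.get i).length := fun i =>
    List.length_pos_iff.2 (h _ (List.get_mem J i))
  refine Nat.succ_le_of_lt (Finset.sum_lt_sum (fun i _ => by simp)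
    ⟨⟨0, hne⟩, Finset.mem_univ _, ?_⟩)
  have := hpos ⟨0, hne⟩
  rw [Fintype.card_fin]
  omega

/-! ### The folding program -/

section Correctness

variable {n : ℕ} {J : List (Word n)}

/-- The numbers of the vertices of the bouquet. -/
def vertexIds (J : List (Word n)) : Finset ℕ := Finset.univ.image (vertexId J)

theorem mem_vertexIds {v : ℕ} : v ∈ vertexIds J ↔ ∃ u, vertexId J u = v := by
  simp [vertexIds]

theorem vertexId_mem (u : BouquetVertex J) : vertexId J u ∈ vertexIds J :=
  mem_vertexIds.2 ⟨u, rfl⟩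

theorem card_vertexIds (J : List (Word n)) :
    (vertexIds J).card = Fintype.card (BouquetVertex J) := by
  rw [vertexIds, Finset.card_image_of_injective _ (vertexId_injective J), Finset.card_univ]

theorem le_length_of_mem_vertexIds {v : ℕ} (h : v ∈ vertexIds J) : v ≤ (inputString J).length := by
  obtain ⟨u, rfl⟩ := mem_vertexIds.1 h
  rcases u with _ | u
  · exact Nat.zero_le _
  · obtain ⟨p, hp, h₁, -⟩ := nextVertex_of_vertexId u
    omega

/-- The number of an edge of the bouquet. -/
def edgeId (J : List (Word n)) (e : BouquetEdge J) : ℕ := edgeName J e + 1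

theorem edgeId_injective (J : List (Word n)) : Function.Injective (edgeId J) := fun _ _ h =>
  edgeName_injective J (Nat.succ_injective h)

theorem two_le_inputFun_edgeName (e : BouquetEdge J) : 2 ≤ inputFun J (edgeName J e) :=
  (two_le_letterCode _).trans_eq (inputFun_edgeName e).symm

theorem edgeName_lt (e : BouquetEdge J) : edgeName J e < (inputString J).length :=
  lt_length_of_two_le (two_le_inputFun_edgeName e)

theorem hasRead_initial (J : List (Word n)) :
    HasRead n (inputFun J) 0
      (Store.set ⟨(initialConfig J).reg, (initialConfig J).field, 0⟩ rOne 1) := by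
  constructor <;> simp [initialConfig, curVertex]
  · rfl
  · exact ⟨le_rfl, by simp, by simp, by simp⟩
  · intros; omega

namespace HasRead

variable {s : Store}

theorem edge_eq (h : HasRead n (inputFun J) (inputString J).length s) (e : BouquetEdge J) :
    s.field fSrc (edgeId J e) = vertexId J ((bouquet J).src e) ∧
    s.field fTgt (edgeId J e) = vertexId J ((bouquet J).tgt e) ∧
    s.field fLab (edgeId J e) = (bouquet J).label e := by
  have hcode := inputFun_edgeName e
  obtain ⟨x, hx, hlab, hor⟩ := h.edge (edgeName J e) (edgeName_lt e)
    (two_le_inputFun_edgeName e)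
  have hcur : curVertex (inputFun J) (edgeName J e) = vertexId J (loopVertex J e.1 e.2) :=
    curVertex_edge e.1 e.2.2
  have hnext : nextVertex (inputFun J) (edgeName J e) = vertexId J (loopVertex J e.1 (e.2 + 1)) :=
    nextVertex_edge e.1 e.2.2
  rw [hcode, hcur, hnext] at hor
  change s.field fLab (edgeId J e) = x at hlab
  rw [hlab]
  simp only [bouquet]
  unfold letterCode at hor
  cases hb : ((J.get e.1).get e.2).2
  · rw [hb] at hor
    rcases hor with ⟨h₁, -⟩ | ⟨h₁, h₂, h₃⟩
    · simp only [Bool.false_eq_true, if_false] at h₁; omega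
    · simp only [Bool.false_eq_true, if_false] at h₁ ⊢
      exact ⟨h₂, h₃, by omega⟩
  · rw [hb] at hor
    rcases hor with ⟨h₁, h₂, h₃⟩ | ⟨h₁, -⟩
    · simp only [if_true] at h₁ ⊢
      exact ⟨h₂, h₃, by omega⟩
    · simp only [if_true] at h₁; omega

theorem alive_edgeId (h : HasRead n (inputFun J) (inputString J).length s) (e : BouquetEdge J) :
    s.field fAlive (edgeId J e) = 1 := by
  rw [edgeId, h.alive_succ, if_pos ⟨edgeName_lt e, two_le_inputFun_edgeName e⟩]

theorem exists_edgeId (h : HasRead n (inputFun J) (inputString J).length s) {f : ℕ}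
    (hf : s.field fAlive f = 1) : ∃ e : BouquetEdge J, edgeId J e = f := by
  rcases f with _ | p
  · simp [h.alive_zero] at hf
  · rw [h.alive_succ] at hf
    split_ifs at hf with h'
    obtain ⟨e, rfl⟩ := exists_edge h'.2
    exact ⟨e, rfl⟩

theorem par_eq_iff (h : HasRead n (inputFun J) (inputString J).length s) (v : ℕ) :
    s.field fPar v = v ↔ v ∈ vertexIds J := by
  rcases v with _ | p
  · simp only [h.par_zero, true_iff]
    exact vertexId_mem none
  · rw [h.par_succ]
    constructor
    · intro hp
      split_ifs at hp with h'
      obtain ⟨u, hu⟩ := exists_vertexId_eq h'.2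
      exact mem_vertexIds.2 ⟨u, hu⟩
    · intro hp
      obtain ⟨u, hu⟩ := mem_vertexIds.1 hp
      rcases u with _ | u
      · simp [vertexId] at hu
      · obtain ⟨q, hq, h₁, h₂⟩ := nextVertex_of_vertexId u
        have : q = p := by omega
        subst this
        rw [if_pos ⟨hq, h₂⟩]

theorem work (h : HasRead n (inputFun J) (inputString J).length s) :
    Work n (vertexIds J) fOut fInn fSrc fTgt id {g | s.field fAlive g = 1}
      {g | s.field fAlive g = 1} s := by
  refine ⟨forest_discrete (fun x hx => (h.par_eq_iff x).2 hx) h.rank, ?_, ?_,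
    fun v hv hp => hv ((h.par_eq_iff v).1 hp), h.zero⟩
  · refine ⟨fun f hf => ?_, fun x _ v hv => absurd (h.slots _ _ (by omega)) hv,
      fun x _ v hv => absurd (h.slots _ _ (by omega)) hv, subset_rfl, fun e he => Or.inl he⟩
    obtain ⟨e, rfl⟩ := h.exists_edgeId hf
    obtain ⟨h₁, h₂, h₃⟩ := h.edge_eq e
    rw [h₁, h₂, h₃]
    exact ⟨Nat.succ_ne_zero _, vertexId_mem _, vertexId_mem _, Fin.is_lt _⟩
  · rw [h.head]; exact h.queue

theorem folding (h : HasRead n (inputFun J) (inputString J).length s) :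
    Folding (bouquet J) (vertexId J) (edgeId J) (edgeName J) id [] s :=
  ⟨fun e => (h.edge_eq e).1, fun e => (h.edge_eq e).2.1, fun e => (h.edge_eq e).2.2,
    fun e => h.name_eq _ (edgeName_lt e) (two_le_inputFun_edgeName e),
    fun _ hf => h.exists_edgeId hf,
    LGraph.foldsTo_nil _ (vertexId_injective J) fun e => h.alive_edgeId e,
    by rw [h.count]; rfl, fun k hk => absurd hk (Nat.not_lt_zero k)⟩

end HasRead

/-- What the output means when the queue is empty. -/
theorem Folding.stores {rt : ℕ → ℕ} {L : List (BouquetEdge J × BouquetEdge J)}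
    {s s' : Store} {num idx : ℕ → ℕ} {pc : ℕ}
    (hw : Work n (vertexIds J) fOut fInn fSrc fTgt rt {g | s.field fAlive g = 1} ∅ s)
    (hfol : Folding (bouquet J) (vertexId J) (edgeId J) (edgeName J) rt L s)
    (hnum : Numbers (fun v => s.field fPar v = v) num ((inputString J).length + 1) (s'.reg 1))
    (hidx : Numbers (fun e => s.field fAlive e = 1) idx ((inputString J).length + 1) (s'.reg 2))
    (hbase : s'.reg 3 = num (rt 0))
    (hst : ∀ e < (inputString J).length + 1, s.field fAlive e = 1 →
        s'.field 3 (idx e) = num (rt (s.field fSrc e)) ∧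
        s'.field 4 (idx e) = s.field fLab e ∧
        s'.field 5 (idx e) = num (rt (s.field fTgt e)))
    (h0 : s'.reg 0 = s.reg 0) (h1 : s'.field 1 = s.field 1) (h2 : s'.field 2 = s.field 2) :
    StoresFoldingProcess J (s'.cfg pc) := by
  have hroot : ∀ u, s.field fPar (rt (vertexId J u)) = rt (vertexId J u) := fun u =>
    hw.forest.par_rt _ (vertexId_mem u)
  have hlt : ∀ u, rt (vertexId J u) < (inputString J).length + 1 := fun u =>
    Nat.lt_succ_of_le (le_length_of_mem_vertexIds (hw.forest.rt_mem _ (vertexId_mem u)))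
  have helt : ∀ e, edgeId J e < (inputString J).length + 1 := fun e =>
    Nat.succ_lt_succ (edgeName_lt e)
  have hsrc : ∀ e : BouquetEdge J,
      s.field fSrc (edgeId J e) = vertexId J ((bouquet J).src e) := hfol.src
  have htgt : ∀ e : BouquetEdge J,
      s.field fTgt (edgeId J e) = vertexId J ((bouquet J).tgt e) := hfol.tgt
  have hlab : ∀ e : BouquetEdge J, s.field fLab (edgeId J e) = (bouquet J).label e := hfol.lab
  have hslot : ∀ e : BouquetEdge J, s.field fAlive (edgeId J e) = 1 →
      s.field (2 * ((bouquet J).label e : ℕ) + fOut) (rt (vertexId J ((bouquet J).src e))) =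
        edgeId J e ∧
      s.field (2 * ((bouquet J).label e : ℕ) + fInn) (rt (vertexId J ((bouquet J).tgt e))) =
        edgeId J e := by
    intro e he
    rcases hw.slots.cover _ he with h | h
    · exact absurd h (Set.notMem_empty _)
    · rwa [hlab, hsrc, htgt] at h
  refine stores_of_foldsTo hfol.folds ⟨h0.trans hfol.length_eq, fun k => ?_⟩
    (fun e e' he he' hl hinc => ?_) num (fun u => hnum.lt _ (hlt u) (hroot u))
    (fun u w h => hnum.inj _ (hlt u) _ (hlt w) (hroot u) (hroot w) h) (fun k hk => ?_) hbase
    (fun e => idx (edgeId J e)) (fun e he => hidx.lt _ (helt e) he)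
    (fun e e' he he' h => edgeId_injective J (hidx.inj _ (helt e) _ (helt e') he he' h))
    (fun k hk => ?_) (fun e he => ?_)
  · change s'.field 1 k = _ ∧ s'.field 2 k = _
    rw [h1, h2]
    exact hfol.pairs k k.2
  · have k₁ := hslot e he
    have k₂ := hslot e' he'
    apply edgeId_injective J
    rw [hl] at k₁
    rcases hinc with h | h
    · rw [← k₁.1, h, k₂.1]
    · rw [← k₁.2, h, k₂.2]
  · obtain ⟨v, -, hv, rfl⟩ := hnum.surj k hk
    have hvV : v ∈ vertexIds J := by
      by_contra hcon
      exact hw.outside v hcon hv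
    obtain ⟨u, rfl⟩ := mem_vertexIds.1 hvV
    exact ⟨u, by rw [hw.forest.rt_eq_self _ hvV hv]⟩
  · obtain ⟨f, -, hf, rfl⟩ := hidx.surj k hk
    obtain ⟨e, rfl⟩ := hfol.alive f hf
    exact ⟨e, hf, rfl⟩
  · obtain ⟨k₁, k₂, k₃⟩ := hst _ (helt e) he
    exact ⟨k₁.trans (congrArg (fun v => num (rt v)) (hsrc e)), k₂.trans (hlab e),
      k₃.trans (congrArg (fun v => num (rt v)) (htgt e))⟩

end Correctness

namespace Cmd

/-- The folding program. -/
def foldingProgram (n : ℕ) : Cmd := read n ;; foldAll n ;; output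

theorem wp_foldingProgram {n : ℕ} (J : List (Word n)) {G W a : ℕ}
    (hG : (vertexIds J).card ≤ tower G) (ha : 36 * G + 12 * n + 142 ≤ a)
    (hW : n * (2 * (6 * G + 9 * n + 14 + a) + 3) + 20 ≤ 6 * W) :
    (foldingProgram n).wp (fun s => (∀ pc, StoresFoldingProcess J (s.cfg pc)) ∧
      s.clk ≤ (inputString J).length * (8 * n + 30) + 4 +
        6 * ((vertexIds J).card * (W + G + 1)) + a * (inputString J).length +
        ((inputString J).length + 1) * (18 * G + 60))
      ⟨(initialConfig J).reg, (initialConfig J).field, 0⟩ := by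
  simp only [foldingProgram, wp]
  refine wp_read (hasRead_initial J) rfl (inputFun_end J) (fun p hp => inputFun_ne_zero hp)
    (fun p hp => ?_) fun s₁ hs₁ hc₁ => ?_
  · obtain ⟨e, rfl⟩ := exists_edge hp
    refine ⟨(bouquet J).label e, Fin.is_lt _, ?_⟩
    rw [inputFun_edgeName, letterCode]
    simp only [bouquet]
    split_ifs
    · exact Or.inl rfl
    · exact Or.inr rfl
  · have hch : charge G W (vertexIds J) a s₁ ≤ s₁.clk +
        6 * ((vertexIds J).card * (W + G + 1)) + a * (inputString J).length := by
      unfold charge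
      rw [potential_discrete G W _ (fun x hx => (hs₁.par_eq_iff x).2 hx) hs₁.rank]
      have := Nat.mul_le_mul_left a hs₁.tail_le
      omega
    refine wp_foldAll (edgeId_injective J) (V := vertexIds J) vertexId_mem hs₁.work hs₁.folding
      hG ha hW hs₁.head ?_
    intro s₂ rt L hw₂ hfol₂ hr₂ hc₂
    have hpos : s₂.reg rPos = (inputString J).length := by rw [hr₂ _ (by simp), hs₁.pos]
    refine wp_output W hw₂.forest hG (by rw [hr₂ _ (by simp), hs₁.one])
      (vertexId_mem (J := J) none)
      (fun e he => ⟨(hw₂.slots.edge e he).2.1, (hw₂.slots.edge e he).2.2.1⟩) ?_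
    intro s₃ num idx hnum hidx hbase hst h0 h1 h2 hc₃
    rw [hpos] at hnum hidx hst hc₃
    exact ⟨fun pc => Folding.stores hw₂ hfol₂ hnum hidx hbase hst h0 h1 h2,
      by omega⟩

end Cmd

theorem time_le {N T V G g a W c ca cW : ℕ} (hN : 2 ≤ N) (hT : T ≤ 2 * N) (hV : V ≤ N)
    (hG : G ≤ g) (hg : 1 ≤ g) (ha : a ≤ ca * g) (hW : W ≤ cW * g) :
    T * c + 4 + 6 * (V * (W + G + 1)) + a * T + (T + 1) * (18 * G + 60) ≤
      (2 * c + 4 + 6 * (cW + 2) + 2 * ca + 234) * (N * g) := by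
  have hNg : N ≤ N * g := Nat.le_mul_of_pos_right N hg
  have e₁ : T * c ≤ 2 * (N * g) * c := Nat.mul_le_mul_right c (by omega)
  have e₂ : V * (W + G + 1) ≤ N * (cW * g + 2 * g) := Nat.mul_le_mul hV (by omega)
  have e₃ : a * T ≤ ca * g * (2 * N) := Nat.mul_le_mul ha hT
  have e₄ : (T + 1) * (18 * G + 60) ≤ 3 * N * (78 * g) := Nat.mul_le_mul (by omega) (by omega)
  calc _ ≤ 2 * (N * g) * c + 4 * (N * g) + 6 * (N * (cW * g + 2 * g)) + ca * g * (2 * N) +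
        3 * N * (78 * g) := by omega
    _ = _ := by ring

end Stallings

theorem theorem1 (n : ℕ) :
    ∃ (P : Stallings.Program) (C : ℕ), ∀ J : List (Stallings.Word n),
      ∃ (t : ℕ) (c : Stallings.Config),
        P.HaltsWithin (Stallings.initialConfig J) t c ∧
        Stallings.StoresFoldingProcess J c ∧
        ((∀ w ∈ J, w ≠ []) → 2 ≤ Stallings.totalLength J →
          t ≤ C * (Stallings.totalLength J * Stallings.logStar (Stallings.totalLength J))) := by
  refine ⟨(Stallings.Cmd.foldingProgram n).code 0, 2 * (8 * n + 30) + 4 +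
    6 * (n * (42 * n + 399) + 20 + 2) + 2 * (12 * n + 178) + 234, fun J => ?_⟩
  set G := Stallings.grade (Stallings.vertexIds J).card with hGdef
  have hG : (Stallings.vertexIds J).card ≤ Stallings.tower G := Stallings.le_tower_grade _
  set a := 36 * G + 12 * n + 142 with ha
  set W := n * (2 * (6 * G + 9 * n + 14 + a) + 3) + 20 with hW
  obtain ⟨s, hs, hst, hclk⟩ := Stallings.Cmd.haltsWithin_of_wp (c₀ := Stallings.initialConfig J) rfl
    (Stallings.Cmd.wp_foldingProgram J (G := G) (W := W) (a := a) hG ha.ge (by omega))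
  refine ⟨s.clk, _, hs, hst _, fun hJ hN => hclk.trans ?_⟩
  have hV : (Stallings.vertexIds J).card ≤ Stallings.totalLength J := by
    rw [Stallings.card_vertexIds]
    exact Stallings.card_bouquetVertex_le hJ hN
  have hT : (Stallings.inputString J).length ≤ 2 * Stallings.totalLength J := by
    have := Stallings.length_le_totalLength hJ
    rw [Stallings.length_inputString]
    omega
  have hg := Stallings.logStar_pos hN
  have hGg : G ≤ Stallings.logStar (Stallings.totalLength J) :=
    Stallings.grade_le (hV.trans (Stallings.le_tower_logStar _))
  generalize Stallings.logStar (Stallings.totalLength J) = g at hg hGg ⊢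
  have hng : n ≤ n * g := Nat.le_mul_of_pos_right n hg
  have ha' : a ≤ (12 * n + 178) * g := by
    rw [ha, Nat.add_mul, Nat.mul_assoc]
    omega
  have hW' : W ≤ (n * (42 * n + 399) + 20) * g := by
    have h₁ : 2 * (6 * G + 9 * n + 14 + a) + 3 ≤ (42 * n + 399) * g := by
      rw [ha, Nat.add_mul, Nat.mul_assoc]
      omega
    calc W ≤ n * ((42 * n + 399) * g) + 20 * g := by
          rw [hW]
          exact Nat.add_le_add (Nat.mul_le_mul_left n h₁) (by omega)
      _ = _ := by ring
  exact Stallings.time_le hN hT hV hGg hg ha' hW'
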